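/- Let $\nu$ be a $\sigma$-finite measure on a measurable space $\Omega$, let $c:\Omega\to[0,\infty)$ and $T:\Omega\to\mathbb R^k$ be measurable, and consider the natural exponential family of densities $f(x;\theta)=c(x)\exp\{\theta' T(x)-\kappa(\theta)\}$ with respect to $\nu$, where $\kappa(\theta)=\log\int c(x)e^{\theta'T(x)}\,\nu(dx)$ and the natural parameter space $\Theta\subset\mathbb R^k$ consists of all $\theta$ for which this integral is finite and positive. Under $\theta$ let $X_1,X_2,\dots$ be i.i.d. with density $f(\cdot;\theta)$, and put $\mathbf T_n=\sum_{i=1}^n T(X_i)$, $\mu=\mu(\theta)=\nabla\kappa(\theta)$, $V=V(\theta)=\nabla^2\kappa(\theta)$ (Hessian matrix), $D=V^{-1}$, $\mathbf B_m=\mathbf T_m-m\mu$. Assume Condition D: for every compact $\Gamma\subset\operatorname{int}\Theta$ there is an integer $r\ge1$ such that the characteristic function $\eta_\theta(\phi)=E_\theta\exp(i\phi'\mathbf T_r)$ is Lebesgue integrable for all $\theta\in\Gamma$ and $\sup_{\theta\in\Gamma}\int_{\mathbb R^k}|\eta_\theta(\phi)|\,d\phi<\infty$. Let $\kappa_{ijl}=\partial^3\kappa/\partial\theta_i\partial\theta_j\partial\theta_l$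 and let $\psi_{1,1}(u)=\psi_{1,1}(u;\theta)=-\sum_{\ell=1}^k a_{1,1;\ell}(\theta)u_\ell$ be the linear part of the first polynomial $\psi_1$ in the Edgeworth expansion of the density of $(\mathbf T_n-n\mu)/\sqrt n$, that is, $$a_{1,1;\ell}=\tfrac12\sum_i\kappa_{iii}D_{ii}D_{i\ell}+\tfrac12\sum_{i\ne j}\kappa_{iij}\,(2D_{ij}D_{i\ell}+D_{ii}D_{j\ell})+\sum_{i<j<p}\kappa_{ijp}\,(D_{ij}D_{p\ell}+D_{ip}D_{j\ell}+D_{jp}D_{i\ell}).$$ Fix an integer $m>0$ and a measurable $\bar J\ge0$ on $\Omega^m$ with $E_\theta\bar J(X_1,\dots,X_m)<\infty$ for all $\theta\in\operatorname{int}\Theta$. For measurable $J$ on $\Omega^m$ with $|J|\le\bar J$ almost everywhere write $\mathbf J=J(X_1,\dots,X_m)$ and $$R(J,\theta)=\frac{mk}2E_\theta(\mathbf J)-\frac12E_\theta\{\mathbf J\,\mathbf B_m'V^{-1}\mathbf B_m\}-E_\theta\{\mathbf J\,\psi_{1,1}(\mathbf B_m)\}.$$ For $\theta\in\operatorname{int}\Theta$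 and all such $J$, the expectations in $R(J,\theta)$ exist, $\theta\mapsto E_\theta(\mathbf J)$ is twice continuously differentiable near $\theta$, and $$R(J,\theta)=-\tfrac12\operatorname{trace}\{V^{-1}\nabla^2E_\theta(\mathbf J)\}-\psi_{1,1}\{\nabla E_\theta(\mathbf J)\}.$$ Moreover, for every compact $\Gamma\subset\operatorname{int}\Theta$, $$\limsup_{n\to\infty}\,n^2\sup_{\theta\in\Gamma}\sup_{J}\Bigl|E\{\mathbf J\mid\mathbf T_n=n\mu(\theta)\}-E_\theta(\mathbf J)-\frac{R(J,\theta)}n\Bigr|<\infty \qquad\text{and}\qquad \sup_{\theta\in\Gamma}\sup_J|R(J,\theta)|<\infty,$$ where the suprema are over all measurable $J$ with $|J|\le\bar J$ almost everywhere. Here $E\{\mathbf J\mid\mathbf T_n=t\}$ is the value at $t$ of a version of the conditional expectation (one function of $t$ serving for all $\theta\in\operatorname{int}\Theta$) that is continuous at $t$, with $t$ in the support of $\mathbf T_n$; for all sufficiently large $n$ this value exists and is unique at $t=n\mu(\theta)$, for all $\theta\in\Gamma$ and all such $J$. -/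

import Mathlib

open MeasureTheory ProbabilityTheory Filter Topology
open scoped RealInnerProductSpace Matrix

noncomputable section

/-- The data of a natural exponential family on the sample space `Ω` with `k`-dimensional
parameter: a σ-finite carrier measure `ν`, a nonnegative factor `c` and a statistic `T`. The member
with parameter `θ` has density `c x * exp (⟪θ, T x⟫ - κ θ)` with respect to `ν`. -/
structure ExpFamily (Ω : Type*) [MeasurableSpace Ω] (k : ℕ) where
  ν : Measure Ω
  sigmaFinite : SigmaFinite ν
  c : Ω → ℝ
  measurable_c : Measurable c
  c_nonneg : ∀ x, 0 ≤ c x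
  T : Ω → EuclideanSpace ℝ (Fin k)
  measurable_T : Measurable T

/-- The partial derivative of `f` in the `i`-th coordinate. -/
def pderiv {k : ℕ} (i : Fin k) (f : EuclideanSpace ℝ (Fin k) → ℝ)
    (θ : EuclideanSpace ℝ (Fin k)) : ℝ :=
  fderiv ℝ f θ (EuclideanSpace.single i 1)

/-- The Hessian matrix of `f`. -/
def hessian {k : ℕ} (f : EuclideanSpace ℝ (Fin k) → ℝ)
    (θ : EuclideanSpace ℝ (Fin k)) : Matrix (Fin k) (Fin k) ℝ :=
  Matrix.of fun i j => pderiv i (pderiv j f) θ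

namespace ExpFamily

variable {Ω : Type*} [MeasurableSpace Ω] {k : ℕ} (F : ExpFamily Ω k)

/-- The normalizing integral `∫ c(x) exp(θ'T(x)) ν(dx)`. -/
def partition (θ : EuclideanSpace ℝ (Fin k)) : ℝ :=
  ∫ x, F.c x * Real.exp ⟪θ, F.T x⟫ ∂F.ν

/-- The natural parameter space `Θ`: all `θ` for which `c(x) exp(θ'T(x))` can be normalized to a
probability density. -/
def paramSpace : Set (EuclideanSpace ℝ (Fin k)) :=
  {θ | Integrable (fun x => F.c x * Real.exp ⟪θ, F.T x⟫) F.ν ∧ 0 < F.partition θ}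

/-- The cumulant function `κ`. -/
def kappa (θ : EuclideanSpace ℝ (Fin k)) : ℝ := Real.log (F.partition θ)

/-- The density `f(x;θ)`. -/
def density (θ : EuclideanSpace ℝ (Fin k)) (x : Ω) : ℝ :=
  F.c x * Real.exp (⟪θ, F.T x⟫ - F.kappa θ)

/-- The law of a single observation. -/
def law₁ (θ : EuclideanSpace ℝ (Fin k)) : Measure Ω :=
  F.ν.withDensity fun x => ENNReal.ofReal (F.density θ x)

/-- The joint law of an i.i.d. sample `X_1, …, X_n`. -/
def law (n : ℕ) (θ : EuclideanSpace ℝ (Fin k)) : Measure (Fin n → Ω) :=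
  Measure.pi fun _ => F.law₁ θ

/-- The sufficient statistic `T_n = ∑ T(X_i)`. -/
def stat (n : ℕ) (x : Fin n → Ω) : EuclideanSpace ℝ (Fin k) := ∑ i, F.T (x i)

/-- For every compact subset `Γ` of the interior of `Θ` there is a sample size `r` such that the
characteristic function of `T_r` is Lebesgue integrable for all `θ ∈ Γ`, with integrals of the
modulus bounded over `Γ`. -/
def ConditionD : Prop :=
  ∀ Γ : Set (EuclideanSpace ℝ (Fin k)), IsCompact Γ → Γ ⊆ interior F.paramSpace →
    ∃ r : ℕ, 0 < r ∧
      (∀ θ ∈ Γ, Integrable (fun φ => charFun ((F.law r θ).map (F.stat r)) φ) volume) ∧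
      ∃ M : ℝ, ∀ θ ∈ Γ, ∫ φ, ‖charFun ((F.law r θ).map (F.stat r)) φ‖ ≤ M

/-- `E_θ J(X_1, …, X_m)`. -/
def mean {m : ℕ} (J : (Fin m → Ω) → ℝ) (θ : EuclideanSpace ℝ (Fin k)) : ℝ :=
  ∫ x, J x ∂F.law m θ

/-- The mean vector `μ(θ) = ∇κ(θ)` of `T_1`. -/
def mu (θ : EuclideanSpace ℝ (Fin k)) : EuclideanSpace ℝ (Fin k) := gradient F.kappa θ

/-- `V(θ) = ∇²κ(θ)`. -/
def V (θ : EuclideanSpace ℝ (Fin k)) : Matrix (Fin k) (Fin k) ℝ := hessian F.kappa θ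

/-- `D = V⁻¹`. -/
def D (θ : EuclideanSpace ℝ (Fin k)) : Matrix (Fin k) (Fin k) ℝ := (F.V θ)⁻¹

/-- The third order cumulants `κ_{ijl}` of `T_1`, the third partial derivatives of `κ`. -/
def kappa₃ (θ : EuclideanSpace ℝ (Fin k)) (i j l : Fin k) : ℝ :=
  pderiv i (pderiv j (pderiv l F.kappa)) θ

/-- The coefficients `a_{1,1;l}(θ)`; the three sums are over `i`, over `i ≠ j` and over
`i < j < p`. -/
def a₁₁ (θ : EuclideanSpace ℝ (Fin k)) (l : Fin k) : ℝ :=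
  (∑ i, F.kappa₃ θ i i i * F.D θ i i * F.D θ i l / 2) +
  (∑ i, ∑ j, if i ≠ j then
    F.kappa₃ θ i i j * (2 * F.D θ i j * F.D θ i l + F.D θ i i * F.D θ j l) / 2 else 0) +
  (∑ i, ∑ j, ∑ p, if i < j ∧ j < p then
    F.kappa₃ θ i j p *
      (F.D θ i j * F.D θ p l + F.D θ i p * F.D θ j l + F.D θ j p * F.D θ i l) else 0)

/-- `ψ_{1,1}(u;θ)`, the linear term of the first polynomial `ψ_1` of the Edgeworth expansion of the
density of `(T_n - nμ)/√n`. -/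
def psi₁₁ (θ u : EuclideanSpace ℝ (Fin k)) : ℝ := - ∑ l, F.a₁₁ θ l * u l

/-- `B_m = T_m - mμ`. -/
def B (m : ℕ) (θ : EuclideanSpace ℝ (Fin k)) (x : Fin m → Ω) : EuclideanSpace ℝ (Fin k) :=
  ∑ i, (F.T (x i) - F.mu θ)

/-- The quadratic form `B_m' V(θ)⁻¹ B_m`. -/
def Q (m : ℕ) (θ : EuclideanSpace ℝ (Fin k)) (x : Fin m → Ω) : ℝ :=
  (F.B m θ x).ofLp ⬝ᵥ ((F.V θ)⁻¹ *ᵥ (F.B m θ x).ofLp)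

/-- The correction term `R(J,θ)`. -/
def R {m : ℕ} (J : (Fin m → Ω) → ℝ) (θ : EuclideanSpace ℝ (Fin k)) : ℝ :=
  (m : ℝ) * (k : ℝ) / 2 * F.mean J θ
    - 1 / 2 * ∫ x, J x * F.Q m θ x ∂F.law m θ
    - ∫ x, J x * F.psi₁₁ θ (F.B m θ x) ∂F.law m θ

/-- The statistic `J(X_1, …, X_m)` as a function of the whole sample `X_1, …, X_n`. -/
def extend {m n : ℕ} (h : m ≤ n) (J : (Fin m → Ω) → ℝ) (x : Fin n → Ω) : ℝ :=
  J fun i => x (Fin.castLE h i)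

/-- `g` is a version of the regression function `t ↦ E(J(X_1, …, X_m) | T_n = t)`: a single
function that serves for all parameter values in the interior of `Θ`. -/
def IsCondVersion {m n : ℕ} (h : m ≤ n) (J : (Fin m → Ω) → ℝ)
    (g : EuclideanSpace ℝ (Fin k) → ℝ) : Prop :=
  Measurable g ∧ ∀ θ ∈ interior F.paramSpace,
    (fun x => g (F.stat n x)) =ᵐ[F.law n θ]
      (F.law n θ)[extend h J | MeasurableSpace.comap (F.stat n) inferInstance]

/-- `v` is the value `E(J(X_1, …, X_m) | T_n = t)` at the individual point `t`: the point `t` is in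
the support of `T_n`, and `v` is the value at `t` of a version of the conditional expectation that
is continuous at `t`. -/
def IsCondValue {m n : ℕ} (h : m ≤ n) (J : (Fin m → Ω) → ℝ)
    (t : EuclideanSpace ℝ (Fin k)) (v : ℝ) : Prop :=
  (∀ θ ∈ interior F.paramSpace, ∀ U ∈ 𝓝 t, 0 < (F.law n θ).map (F.stat n) U) ∧
  ∃ g : EuclideanSpace ℝ (Fin k) → ℝ, F.IsCondVersion h J g ∧ ContinuousAt g t ∧ g t = v

end ExpFamily

end

/-!
Under Condition D the sum `T_N` has a bounded continuous density for large `N`, namely the Fourier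
inverse of its characteristic function (`eq_withDensity_fourierDensity`). Write `n = m + N`. The
first `m` observations are independent of the sum over the remaining `N` ones, so Bayes' formula
expresses `E(J | T_n = t)` as the quotient of the densities at `t` of `E_θ[J; T_n ∈ ·]` and of
`T_n` (`convDensity_div_ae_eq_condExp`). Both are continuous. A change of parameter multiplies the
law of the sample by a function of `T_n`, which does not affect the conditional expectation, so
this quotient is a version for all parameters at once (`ae_eq_condExp_withDensity`). Its value at
`t` is the only possible value wherever the density of `T_n` is positive
(`ExpFamily.IsCondValue.unique`).

At `t = n μ(θ)`, with `χ` the characteristic function of `T_1 - μ(θ)`, Fourier inversion gives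
```
E(J | T_n = t) - E_θ J = ∫ E_θ[(J - E_θ J) e^{i⟨φ, B_m⟩}] χ(φ)^N dφ / ∫ χ(φ)^(m + N) dφ
```
(`ExpFamily.numerator_div_sub_mean`). The amplitude in the numerator vanishes at the origin, where
it is `i a(φ) + A(φ) + O(|φ|³)` with `a = E_θ[(J - E_θ J) ⟨φ, B_m⟩]` and
`-2 A = E_θ[(J - E_θ J) ⟨φ, B_m⟩²]`, while `log χ = -q/2 - i s + O(|φ|⁴)` with `q(φ) = ⟨φ, V φ⟩`
and `s` one sixth of the third cumulant of `⟨φ, T_1⟩`. Only real parts matter, since both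
integrals are real. By parity the real part of the integrand is `exp (-N q / 2) (A + N a s)` up to
terms which are smaller by a factor `N⁻¹`, and not only `N^(-1/2)`: this is why a single
correction term leaves an error of order `n⁻²`. After rescaling, the quotient is `1/n` times the
average of `A + a s` under the Gaussian density proportional to `exp (-q / 2)`
(`CubicExpansion.ratio_bounds`). Isserlis' formula evaluates it
(`integral_quadratic_add_linear_mul_cubic_gaussian`), and the result is `R(J, θ)`, once the
coefficients `a_{1,1;l}` are written as one sum over all triples of indices (`ExpFamily.a₁₁_eq`,
`ExpFamily.R_eq_gaussian`). The second form of `R(J, θ)` comes from differentiating `θ ↦ E_θ J`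
twice under the integral sign (`ExpFamily.R_eq_trace`).

All the bounds depend on the family only through moments of `T_1` and of `Jbar` times powers of
`B_m`, a lower bound for the eigenvalues of `V`, and a bound for `χ` away from the origin. Each of
these holds uniformly near a given parameter, the last one because Condition D and the
Riemann–Lebesgue lemma keep `|χ|` away from one, and the law of `T_1` is continuous in total
variation (`ExpFamily.eventually_tailBound`). Compactness of `Γ` does the rest.
-/

noncomputable section

/-! ### Fourier inversion for probability measures -/

section FourierInversion

open scoped FourierTransform SchwartzMap ContDiff

variable {E : Type*} [NormedAddCommGroup E] [InnerProductSpace ℝ E] [FiniteDimensional ℝ E]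
  [MeasurableSpace E] [BorelSpace E]

/-- The candidate for the Lebesgue density of `μ` given by Fourier inversion. The rescaling of the
characteristic function by `2π` matches Mathlib's normalization of the Fourier transform. -/
def fourierDensity (μ : Measure E) (t : E) : ℂ :=
  𝓕 (fun w : E => charFun μ ((2 * Real.pi) • w)) t

lemma integrable_charFun_two_pi_smul {μ : Measure E} (hμ : Integrable (charFun μ) volume) :
    Integrable (fun w : E => charFun μ ((2 * Real.pi) • w)) volume :=
  hμ.comp_smul (by positivity)

lemma continuous_fourierDensity {μ : Measure E} (hμ : Integrable (charFun μ) volume) :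
    Continuous (fourierDensity μ) :=
  VectorFourier.fourierIntegral_continuous Real.continuous_fourierChar
    (by exact continuous_inner) (integrable_charFun_two_pi_smul hμ)

lemma norm_fourierDensity_le (μ : Measure E) (t : E) :
    ‖fourierDensity μ t‖ ≤ ∫ w : E, ‖charFun μ ((2 * Real.pi) • w)‖ :=
  VectorFourier.norm_fourierIntegral_le_integral_norm _ _ _ _ _

lemma fourierDensity_eq (μ : Measure E) (t : E) :
    fourierDensity μ t = (((2 * Real.pi) ^ Module.finrank ℝ E)⁻¹ : ℝ) *
      ∫ φ : E, Complex.exp (-(⟪φ, t⟫ : ℝ) * Complex.I) * charFun μ φ := by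
  have h := Measure.integral_comp_smul_of_nonneg (volume : Measure E)
    (fun φ : E => Complex.exp (-(⟪φ, t⟫ : ℝ) * Complex.I) * charFun μ φ) (2 * Real.pi)
    (hR := by positivity)
  rw [fourierDensity, Real.fourier_eq', ← Complex.real_smul, ← h]
  congr 1
  ext v
  simp only [smul_eq_mul, inner_smul_left]
  congr 2
  simp

/-- Parseval's identity for a Schwartz function against a finite measure. -/
lemma integral_schwartz_mul_fourierDensity {μ : Measure E} [IsFiniteMeasure μ]
    (hμ : Integrable (charFun μ) volume) (h : 𝓢(E, ℂ)) :
    ∫ t, h t * fourierDensity μ t = ∫ x, h x ∂μ := by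
  have h1 : ∫ ξ, 𝓕 (h : E → ℂ) ξ * charFun μ ((2 * Real.pi) • ξ)
      = ∫ t, h t * fourierDensity μ t :=
    VectorFourier.integral_fourierIntegral_smul_eq_flip (L := innerₗ E)
      Real.continuous_fourierChar continuous_inner h.integrable
      (integrable_charFun_two_pi_smul hμ) |>.trans (by
        congr 1; ext t; simp only [flip_innerₗ]; rfl)
  have hF : Integrable (𝓕 (h : E → ℂ)) := by
    rw [← SchwartzMap.fourier_coe]; exact (𝓕 h).integrable
  have h2 : ∫ ξ, VectorFourier.fourierIntegral Real.fourierChar volume (-innerₗ E)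
      (𝓕 (h : E → ℂ)) ξ • (1 : ℂ) ∂μ
      = ∫ w, 𝓕 (h : E → ℂ) w •
        VectorFourier.fourierIntegral Real.fourierChar μ (-innerₗ E).flip (fun _ => (1 : ℂ)) w :=
    VectorFourier.integral_fourierIntegral_smul_eq_flip (L := -innerₗ E)
      Real.continuous_fourierChar (by exact continuous_inner.neg) hF (integrable_const _)
  rw [← h1]
  have h3 : ∀ w : E, charFun μ ((2 * Real.pi) • w) =
      VectorFourier.fourierIntegral Real.fourierChar μ (-innerₗ E).flip (fun _ => (1 : ℂ)) w := by
    intro w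
    rw [charFun_apply, VectorFourier.fourierIntegral]
    congr 1; ext x
    simp [Circle.smul_def, Real.fourierChar_apply, inner_smul_right, real_inner_comm]
  have h4 : ∀ x : E, VectorFourier.fourierIntegral Real.fourierChar volume (-innerₗ E)
      (𝓕 (h : E → ℂ)) x = h x := by
    intro x
    have : 𝓕⁻ (𝓕 (h : E → ℂ)) x = h x := by
      rw [h.continuous.fourierInv_fourier_eq h.integrable hF]
    rw [← this]
    rfl
  simp_rw [h3]
  simp only [smul_eq_mul, mul_one] at h2
  rw [← h2]
  simp_rw [h4]

/-- Parseval's identity for a real test function. -/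
lemma integral_smooth_mul_fourierDensity {μ : Measure E} [IsFiniteMeasure μ]
    (hμ : Integrable (charFun μ) volume) {h : E → ℝ} (hs : ContDiff ℝ ∞ h)
    (hc : HasCompactSupport h) :
    ∫ t, (h t : ℂ) * fourierDensity μ t = (∫ x, h x ∂μ : ℝ) := by
  have hc' : HasCompactSupport (fun x => (h x : ℂ)) := hc.comp_left (g := Complex.ofReal) (by simp)
  have hs' : ContDiff ℝ ∞ (fun x => (h x : ℂ)) := Complex.ofRealCLM.contDiff.comp hs
  have := integral_schwartz_mul_fourierDensity hμ (hc'.toSchwartzMap hs')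
  simp only [HasCompactSupport.toSchwartzMap_toFun] at this
  rw [← integral_complex_ofReal]
  exact this

lemma integrable_smooth_mul_fourierDensity {μ : Measure E}
    (hμ : Integrable (charFun μ) volume) {h : E → ℝ} (hs : ContDiff ℝ ∞ h)
    (hc : HasCompactSupport h) :
    Integrable (fun t => (h t : ℂ) * fourierDensity μ t) := by
  refine Continuous.integrable_of_hasCompactSupport
    ((Complex.continuous_ofReal.comp hs.continuous).mul (continuous_fourierDensity hμ)) ?_
  exact (hc.comp_left (g := Complex.ofReal) (by simp)).mul_right

lemma fourierDensity_im {μ : Measure E} [IsFiniteMeasure μ]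
    (hμ : Integrable (charFun μ) volume) (t : E) : (fourierDensity μ t).im = 0 := by
  have hcont : Continuous fun t => (fourierDensity μ t).im :=
    Complex.continuous_im.comp (continuous_fourierDensity hμ)
  have : ∀ᵐ t ∂(volume : Measure E), (fourierDensity μ t).im = 0 := by
    refine ae_eq_zero_of_integral_contDiff_smul_eq_zero hcont.locallyIntegrable fun g hg hgc => ?_
    have h1 := congrArg Complex.im (integral_smooth_mul_fourierDensity hμ hg hgc)
    rw [Complex.ofReal_im] at h1
    have h2 := integral_im (integrable_smooth_mul_fourierDensity hμ hg hgc)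
    simp only [RCLike.im_to_complex] at h2
    rw [← h1, ← h2]
    simp
  exact congrFun ((hcont.ae_eq_iff_eq volume continuous_const).1 this) t

lemma integral_smooth_mul_fourierDensity_re {μ : Measure E} [IsFiniteMeasure μ]
    (hμ : Integrable (charFun μ) volume) {h : E → ℝ} (hs : ContDiff ℝ ∞ h)
    (hc : HasCompactSupport h) :
    ∫ t, h t * (fourierDensity μ t).re = ∫ x, h x ∂μ := by
  have h1 := congrArg Complex.re (integral_smooth_mul_fourierDensity hμ hs hc)
  rw [Complex.ofReal_re] at h1
  have h2 := integral_re (integrable_smooth_mul_fourierDensity hμ hs hc)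
  simp only [RCLike.re_to_complex] at h2
  rw [← h1, ← h2]
  simp

/-- A bump function where the density is negative would have a negative integral against `μ`. -/
lemma fourierDensity_re_nonneg {μ : Measure E} [IsFiniteMeasure μ]
    (hμ : Integrable (charFun μ) volume) (t : E) : 0 ≤ (fourierDensity μ t).re := by
  by_contra! hneg
  have hcont : Continuous fun t => (fourierDensity μ t).re :=
    Complex.continuous_re.comp (continuous_fourierDensity hμ)
  obtain ⟨ε, hε, hball⟩ := Metric.eventually_nhds_iff_ball.1
    (hcont.continuousAt.eventually (gt_mem_nhds hneg))
  let b : ContDiffBump t := ⟨ε / 2, ε, by positivity, by linarith⟩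
  have h1 := integral_smooth_mul_fourierDensity_re hμ b.contDiff b.hasCompactSupport
  have h2 : 0 ≤ ∫ x, b x ∂μ := integral_nonneg fun x => b.nonneg
  have h3 : 0 < ∫ x, b x * -(fourierDensity μ x).re := by
    refine Continuous.integral_pos_of_hasCompactSupport_nonneg_nonzero (x := t) ?_ ?_ ?_ ?_
    · exact b.continuous.mul hcont.neg
    · exact b.hasCompactSupport.mul_right
    · intro x
      by_cases hx : x ∈ Metric.ball t ε
      · exact mul_nonneg b.nonneg (by linarith [hball x hx])
      · simp [b.zero_of_le_dist (x := x) (by simpa using hx)]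
    · have : b t = 1 := b.one_of_mem_closedBall (by simp [b]; positivity)
      simp only [this]; simpa using hneg.ne
  simp only [mul_neg, integral_neg] at h3
  linarith

/-- The integral over each ball is at most the total mass of `μ`. -/
lemma integrable_fourierDensity_re {μ : Measure E} [IsFiniteMeasure μ]
    (hμ : Integrable (charFun μ) volume) :
    Integrable (fun t => (fourierDensity μ t).re) volume := by
  have hcont : Continuous fun t => (fourierDensity μ t).re :=
    Complex.continuous_re.comp (continuous_fourierDensity hμ)
  refine (aecover_closedBall (x := (0 : E)) (l := atTop) (r := fun n : ℕ => (n : ℝ))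
    tendsto_natCast_atTop_atTop).integrable_of_integral_bounded_of_nonneg_ae (μ.real Set.univ)
    (fun n => hcont.continuousOn.integrableOn_compact (isCompact_closedBall _ _))
    (ae_of_all _ (fourierDensity_re_nonneg hμ)) ?_
  filter_upwards [eventually_gt_atTop 0] with n hn
  let b : ContDiffBump (0 : E) := ⟨n, n + 1, by positivity, by linarith⟩
  calc ∫ x in Metric.closedBall 0 (n : ℝ), (fourierDensity μ x).re
      = ∫ x in Metric.closedBall 0 (n : ℝ), b x * (fourierDensity μ x).re := by
        refine setIntegral_congr_fun Metric.isClosed_closedBall.measurableSet fun x hx => ?_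
        simp only [b.one_of_mem_closedBall (x := x) hx, one_mul]
    _ ≤ ∫ x, b x * (fourierDensity μ x).re := by
        refine setIntegral_le_integral ?_
          (ae_of_all _ fun x => mul_nonneg b.nonneg (fourierDensity_re_nonneg hμ x))
        exact (b.continuous.mul hcont).integrable_of_hasCompactSupport
          b.hasCompactSupport.mul_right
    _ = ∫ x, b x ∂μ := integral_smooth_mul_fourierDensity_re hμ b.contDiff b.hasCompactSupport
    _ ≤ ∫ x, (1 : ℝ) ∂μ := by
        refine integral_mono_of_nonneg (ae_of_all _ fun x => b.nonneg) (integrable_const _)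
          (ae_of_all _ fun x => b.le_one)
    _ = μ.real Set.univ := by simp

/-- A finite measure with integrable characteristic function has the density given by Fourier
inversion. -/
theorem eq_withDensity_fourierDensity {μ : Measure E} [IsFiniteMeasure μ]
    (hμ : Integrable (charFun μ) volume) :
    μ = volume.withDensity fun t => ENNReal.ofReal (fourierDensity μ t).re := by
  have hint := integrable_fourierDensity_re hμ
  have hre : ∀ t, fourierDensity μ t = ((fourierDensity μ t).re : ℂ) := fun t =>
    Complex.ext rfl (by simp [fourierDensity_im hμ t])
  have hintC : Integrable (fourierDensity μ) volume := by
    rw [funext hre]; exact hint.ofReal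
  have hcont : Continuous fun t => (fourierDensity μ t).re :=
    Complex.continuous_re.comp (continuous_fourierDensity hμ)
  have : IsFiniteMeasure (volume.withDensity fun t => ENNReal.ofReal (fourierDensity μ t).re) :=
    isFiniteMeasure_withDensity_ofReal hint.2
  refine Measure.ext_of_charFun (funext fun φ => ?_)
  have hψc : Continuous (fun w : E => charFun μ ((2 * Real.pi) • w)) :=
    continuous_charFun.comp (continuous_const_smul _)
  have hinv := hψc.fourierInv_fourier_eq (integrable_charFun_two_pi_smul hμ) hintC
  have h1 := congrFun hinv ((2 * Real.pi)⁻¹ • φ)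
  simp only [smul_smul] at h1
  rw [mul_inv_cancel₀ (by positivity), one_smul] at h1
  rw [← h1, charFun_apply, integral_withDensity_eq_integral_toReal_smul
    hcont.measurable.ennreal_ofReal (ae_of_all _ fun _ => ENNReal.ofReal_lt_top),
    Real.fourierInv_eq']
  congr 1; ext t
  rw [ENNReal.toReal_ofReal (fourierDensity_re_nonneg hμ t)]
  change _ • fourierDensity μ t = _
  rw [hre t, Complex.real_smul, smul_eq_mul, mul_comm]
  simp only [Complex.ofReal_re, inner_smul_right]
  congr 4
  field_simp

/-- The Riemann–Lebesgue lemma for a measure with a density. -/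
lemma tendsto_charFun_withDensity_cocompact {f : E → ℝ}
    (hfm : Measurable f) (h0 : ∀ t, 0 ≤ f t) :
    Tendsto (charFun (volume.withDensity fun t => ENNReal.ofReal (f t))) (cocompact E) (𝓝 0) := by
  have h1 := tendsto_integral_exp_inner_smul_cocompact (V := E) (fun t => (f t : ℂ))
  have h2 : Tendsto (fun φ : E => (-(2 * Real.pi)⁻¹) • φ) (cocompact E) (cocompact E) :=
    (Homeomorph.smulOfNeZero (-(2 * Real.pi)⁻¹)
      (neg_ne_zero.2 (inv_ne_zero (by positivity)))).isClosedEmbedding.tendsto_cocompact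
  refine (h1.comp h2).congr fun φ => ?_
  rw [charFun_apply, integral_withDensity_eq_integral_toReal_smul
    hfm.ennreal_ofReal (ae_of_all _ fun _ => ENNReal.ofReal_lt_top)]
  simp only [Function.comp]
  congr 1; ext t
  rw [ENNReal.toReal_ofReal (h0 t), Circle.smul_def, Real.fourierChar_apply, Complex.real_smul,
    smul_eq_mul, mul_comm]
  simp only [inner_smul_right]
  congr 3
  push_cast
  field_simp

lemma tendsto_charFun_cocompact {μ : Measure E} [IsFiniteMeasure μ]
    (hμ : Integrable (charFun μ) volume) : Tendsto (charFun μ) (cocompact E) (𝓝 0) := by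
  rw [eq_withDensity_fourierDensity hμ]
  exact tendsto_charFun_withDensity_cocompact
    (Complex.continuous_re.comp (continuous_fourierDensity hμ)).measurable
    (fourierDensity_re_nonneg hμ)

end FourierInversion

/-! ### Powers of a function with a third order expansion at the origin -/

section LaplaceMethod

lemma exists_pow_le_mul_exp (j : ℕ) {b : ℝ} (hb : 0 < b) :
    ∃ M : ℝ, 0 < M ∧ ∀ x : ℝ, 0 ≤ x → x ^ j ≤ M * Real.exp (b * x) := by
  refine ⟨j.factorial / b ^ j, by positivity, fun x hx => ?_⟩
  have h := Real.pow_div_factorial_le_exp (b * x) (by positivity) j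
  rw [div_le_iff₀ (by positivity), mul_pow] at h
  rw [div_mul_eq_mul_div, le_div_iff₀ (by positivity)]
  linarith

lemma abs_exp_sub_exp_le {a b m : ℝ} (ha : a ≤ m) (hb : b ≤ m) :
    |Real.exp a - Real.exp b| ≤ |a - b| * Real.exp m := by
  wlog h : b ≤ a generalizing a b
  · rw [abs_sub_comm, abs_sub_comm a]
    exact this hb ha (le_of_not_ge h)
  rw [abs_of_nonneg (sub_nonneg.2 (Real.exp_le_exp.2 h)), abs_of_nonneg (sub_nonneg.2 h)]
  have h1 : Real.exp a - Real.exp b ≤ (a - b) * Real.exp a := by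
    have := Real.add_one_le_exp (b - a)
    rw [Real.exp_sub] at this
    have h3 := Real.exp_pos a
    rw [le_div_iff₀ h3] at this
    linarith
  exact h1.trans (by gcongr)

variable {E : Type*} [NormedAddCommGroup E]

/-- `χ` has the expansion `1 - q/2 - i s` at the origin, up to terms of order four in the real part
and of order five in the imaginary part, where `q` is comparable to `‖φ‖²` and `s` is cubic. For
the characteristic function of a centred random vector `Y`, `q` is the variance of `⟪φ, Y⟫`, and `s`
is one sixth of its third moment. -/
structure CubicExpansion (c K : ℝ) (χ : E → ℂ) (q s : E → ℝ) : Prop where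
  re : ∀ φ, |(χ φ).re - 1 + q φ / 2| ≤ K * ‖φ‖ ^ 4
  im : ∀ φ, |(χ φ).im + s φ| ≤ K * ‖φ‖ ^ 5
  lower : ∀ φ, c * ‖φ‖ ^ 2 ≤ q φ
  upper : ∀ φ, q φ ≤ K * ‖φ‖ ^ 2
  cubic : ∀ φ, |s φ| ≤ K * ‖φ‖ ^ 3

/-- If the imaginary part of `z` is of smaller order than its real part, then `log (1 + z) - z` has
an imaginary part of smaller order than its real part. -/
lemma log_one_add_bounds {K t : ℝ} {z : ℂ} (hK : 1 ≤ K) (ht0 : 0 ≤ t) (ht1 : t ≤ 1)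
    (htb : t ^ 2 * (8 * K) ≤ 1) (hzr : |z.re| ≤ 2 * K * t ^ 2) (hzi : |z.im| ≤ 2 * K * t ^ 3) :
    1 + z ≠ 0 ∧ |(Complex.log (1 + z)).re - z.re| ≤ 72 * K ^ 3 * t ^ 4 ∧
      |(Complex.log (1 + z)).im - z.im| ≤ 72 * K ^ 3 * t ^ 5 := by
  have hK3 : K ^ 2 ≤ K ^ 3 := by nlinarith
  have h32 : t ^ 3 ≤ t ^ 2 := pow_le_pow_of_le_one ht0 ht1 (by norm_num)
  have h32' : K * t ^ 3 ≤ K * t ^ 2 := by gcongr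
  have hzn : ‖z‖ ≤ 4 * K * t ^ 2 := (Complex.norm_le_abs_re_add_abs_im z).trans (by linarith)
  have hzh : ‖z‖ ≤ 1 / 2 := by linarith
  have hne : (1 : ℂ) + z ≠ 0 := by
    intro h0
    have : z = -1 := by linear_combination h0
    rw [this] at hzh; norm_num at hzh
  have hT := Complex.norm_log_sub_logTaylor_le 2 (z := z) (by linarith)
  have hTay : Complex.logTaylor (2 + 1) z = z - z ^ 2 / 2 := by
    simp [Complex.logTaylor_succ, Complex.logTaylor_zero]; ring
  rw [hTay] at hT
  have hinv0 : 0 ≤ (1 - ‖z‖)⁻¹ := inv_nonneg.2 (by linarith)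
  have hinv : (1 - ‖z‖)⁻¹ ≤ 2 := by
    rw [inv_le_comm₀ (by linarith) (by norm_num)]; linarith
  have hrem : ‖Complex.log (1 + z) - (z - z ^ 2 / 2)‖ ≤ 64 * K ^ 3 * t ^ 6 := by
    refine hT.trans ?_
    have e1 : ‖z‖ ^ (2 + 1) ≤ 64 * K ^ 3 * t ^ 6 := by
      calc ‖z‖ ^ 3 ≤ (4 * K * t ^ 2) ^ 3 := by gcongr
        _ = _ := by ring
    have : (0 : ℝ) ≤ 64 * K ^ 3 * t ^ 6 := by positivity
    calc ‖z‖ ^ (2 + 1) * (1 - ‖z‖)⁻¹ / ((2 : ℕ) + 1)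
        ≤ (64 * K ^ 3 * t ^ 6) * 2 / ((2 : ℕ) + 1) := by
          gcongr
      _ ≤ _ := by push_cast; linarith
  generalize Complex.log (1 + z) = l at hrem ⊢
  have hwr := (Complex.abs_re_le_norm _).trans hrem
  have hwi := (Complex.abs_im_le_norm _).trans hrem
  have er : (l - (z - z ^ 2 / 2)).re = l.re - z.re + (z.re ^ 2 - z.im ^ 2) / 2 := by
    simp [pow_two]; ring
  have ei : (l - (z - z ^ 2 / 2)).im = l.im - z.im + z.re * z.im := by
    simp [pow_two]; ring
  rw [er] at hwr
  rw [ei] at hwi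
  have e1 : z.re ^ 2 ≤ 4 * K ^ 2 * t ^ 4 := by
    rw [← sq_abs]
    calc |z.re| ^ 2 ≤ (2 * K * t ^ 2) ^ 2 := by gcongr
      _ = _ := by ring
  have e2 : z.im ^ 2 ≤ 4 * K ^ 2 * t ^ 4 := by
    rw [← sq_abs]
    calc |z.im| ^ 2 ≤ (2 * K * t ^ 2) ^ 2 := by gcongr; linarith
      _ = _ := by ring
  have hpr : |z.re * z.im| ≤ 4 * K ^ 2 * t ^ 5 := by
    rw [abs_mul]
    calc |z.re| * |z.im| ≤ (2 * K * t ^ 2) * (2 * K * t ^ 3) := by gcongr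
      _ = _ := by ring
  have p64 : K ^ 3 * t ^ 6 ≤ K ^ 3 * t ^ 4 := by
    gcongr ?_ * ?_; exact pow_le_pow_of_le_one ht0 ht1 (by norm_num)
  have p65 : K ^ 3 * t ^ 6 ≤ K ^ 3 * t ^ 5 := by
    gcongr ?_ * ?_; exact pow_le_pow_of_le_one ht0 ht1 (by norm_num)
  have k24 : K ^ 2 * t ^ 4 ≤ K ^ 3 * t ^ 4 := by gcongr
  have k25 : K ^ 2 * t ^ 5 ≤ K ^ 3 * t ^ 5 := by gcongr
  have n1 := sq_nonneg z.re
  have n2 := sq_nonneg z.im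
  rw [abs_le] at hwr hwi hpr
  refine ⟨hne, ?_, ?_⟩
  · rw [abs_le]; constructor <;> linarith
  · rw [abs_le]; constructor <;> linarith

/-- Near the origin the logarithm of `χ` has real part `-q/2 + O(‖φ‖⁴)` and imaginary part
`-s + O(‖φ‖⁵)`. -/
lemma CubicExpansion.exists_log {c K : ℝ} (hc : 0 < c) (hK : 1 ≤ K) :
    ∃ δ C : ℝ, 0 < δ ∧ δ ≤ 1 ∧ 1 ≤ C ∧ ∀ (χ : E → ℂ) (q s : E → ℝ), CubicExpansion c K χ q s →
      ∀ φ, ‖φ‖ ≤ δ → ∃ l : ℂ, χ φ = Complex.exp l ∧ |l.re + q φ / 2| ≤ C * ‖φ‖ ^ 4 ∧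
        |l.im + s φ| ≤ C * ‖φ‖ ^ 5 ∧ |l.im| ≤ C * ‖φ‖ ^ 3 ∧ l.re ≤ -(c / 4) * ‖φ‖ ^ 2 := by
  have hK3 : K ≤ K ^ 3 := le_self_pow₀ hK (by norm_num)
  set C0 : ℝ := 73 * K ^ 3 with hC0
  have hC0pos : 1 ≤ C0 := by linarith
  set δ2 : ℝ := min 1 (min (1 / (8 * K)) (c / (4 * C0))) with hδ2
  have hδ2pos : 0 < δ2 := by positivity
  refine ⟨Real.sqrt δ2, C0 + K, by positivity, ?_, by linarith, ?_⟩
  · rw [Real.sqrt_le_one]; exact min_le_left _ _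
  intro χ q s h φ hφ
  have hre := h.re φ
  have him := h.im φ
  have hlo := h.lower φ
  have hup := h.upper φ
  have hs := h.cubic φ
  have ht0 : 0 ≤ ‖φ‖ := norm_nonneg _
  generalize ‖φ‖ = t at *
  have ht2 : t ^ 2 ≤ δ2 := by
    have := pow_le_pow_left₀ ht0 hφ 2
    rwa [Real.sq_sqrt hδ2pos.le] at this
  have hta : t ^ 2 ≤ 1 := ht2.trans (min_le_left _ _)
  have htb : t ^ 2 ≤ 1 / (8 * K) := ht2.trans ((min_le_right _ _).trans (min_le_left _ _))
  have htc : t ^ 2 ≤ c / (4 * C0) := ht2.trans ((min_le_right _ _).trans (min_le_right _ _))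
  rw [le_div_iff₀ (by positivity)] at htb htc
  have ht1 : t ≤ 1 := by nlinarith
  have hq0 : 0 ≤ q φ := le_trans (by positivity) hlo
  have h42 : K * t ^ 4 ≤ K * t ^ 2 := by
    gcongr ?_ * ?_; exact pow_le_pow_of_le_one ht0 ht1 (by norm_num)
  have h53 : K * t ^ 5 ≤ K * t ^ 3 := by
    gcongr ?_ * ?_; exact pow_le_pow_of_le_one ht0 ht1 (by norm_num)
  have hzr : |(χ φ - 1).re| ≤ 2 * K * t ^ 2 := by
    rw [Complex.sub_re, Complex.one_re]
    rw [abs_le] at hre ⊢; constructor <;> linarith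
  have hzi : |(χ φ - 1).im| ≤ 2 * K * t ^ 3 := by
    rw [Complex.sub_im, Complex.one_im, sub_zero]
    rw [abs_le] at him hs ⊢; constructor <;> linarith
  obtain ⟨hne, hlr, hli⟩ := log_one_add_bounds hK ht0 ht1 htb hzr hzi
  rw [add_sub_cancel] at hne hlr hli
  rw [Complex.sub_re, Complex.one_re] at hlr
  rw [Complex.sub_im, Complex.one_im, sub_zero] at hli
  have k14 : K * t ^ 4 ≤ K ^ 3 * t ^ 4 := by gcongr
  have k15 : K * t ^ 5 ≤ K ^ 3 * t ^ 5 := by gcongr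
  have g1 : |(Complex.log (χ φ)).re + q φ / 2| ≤ C0 * t ^ 4 := by
    rw [abs_le] at hlr hre ⊢
    constructor <;> linarith
  have g2 : |(Complex.log (χ φ)).im + s φ| ≤ C0 * t ^ 5 := by
    rw [abs_le] at hli him ⊢
    constructor <;> linarith
  have hKt4 : 0 ≤ K * t ^ 4 := by positivity
  have hKt5 : 0 ≤ K * t ^ 5 := by positivity
  refine ⟨Complex.log (χ φ), (Complex.exp_log hne).symm, by linarith, by linarith, ?_, ?_⟩
  · have : C0 * t ^ 5 ≤ C0 * t ^ 3 := by
      gcongr ?_ * ?_; exact pow_le_pow_of_le_one ht0 ht1 (by norm_num)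
    rw [abs_le] at g2 hs ⊢
    constructor <;> linarith
  · have h2 : t ^ 2 * (4 * C0) * t ^ 2 ≤ c * t ^ 2 := by gcongr
    rw [abs_le] at g1
    linarith

/-- The comparison of `χ ^ N` with a Gaussian. The bounds are written in terms of the rescaled
variable `N * ‖φ‖ ^ 2`. -/
lemma CubicExpansion.exists_pow_bounds {c K : ℝ} (hc : 0 < c) (hK : 1 ≤ K) :
    ∃ δ C : ℝ, 0 < δ ∧ δ ≤ 1 ∧ 1 ≤ C ∧ ∀ (χ : E → ℂ) (q s : E → ℝ), CubicExpansion c K χ q s →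
      ∀ φ, ‖φ‖ ≤ δ → ∀ N : ℕ, 0 < N →
        ‖χ φ ^ N‖ ≤ Real.exp (-(c / 4) * (N * ‖φ‖ ^ 2)) ∧
        |(χ φ ^ N).im| ≤ C * (N * ‖φ‖ ^ 3) * Real.exp (-(c / 4) * (N * ‖φ‖ ^ 2)) ∧
        |(χ φ ^ N).re - Real.exp (-(N * q φ / 2))| ≤
          C * ((N * ‖φ‖ ^ 2) ^ 2 + (N * ‖φ‖ ^ 2) ^ 3) / N *
            Real.exp (-(c / 4) * (N * ‖φ‖ ^ 2)) ∧
        |(χ φ ^ N).im + N * s φ * Real.exp (-(N * q φ / 2))| ≤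
          C * ‖φ‖ * ((N * ‖φ‖ ^ 2) ^ 2 + (N * ‖φ‖ ^ 2) ^ 3 + (N * ‖φ‖ ^ 2) ^ 4) / N *
            Real.exp (-(c / 4) * (N * ‖φ‖ ^ 2)) := by
  obtain ⟨δ, C, hδ, hδ1, hC, H⟩ := CubicExpansion.exists_log (E := E) hc hK
  have hC2 : C ≤ C ^ 2 := by nlinarith
  have hC3 : C ^ 2 ≤ C ^ 3 := by nlinarith
  refine ⟨δ, K * C ^ 3, hδ, hδ1, by nlinarith, fun χ q s h φ hφ N hN => ?_⟩
  obtain ⟨l, hl, hr, hi, hi', hneg⟩ := H χ q s h φ hφ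
  have hs := h.cubic φ
  have hlo := h.lower φ
  have ht0 : 0 ≤ ‖φ‖ := norm_nonneg _
  generalize ‖φ‖ = t at *
  have hNpos : (0 : ℝ) < N := by exact_mod_cast hN
  set G := Real.exp (-(c / 4) * (N * t ^ 2)) with hG
  have hGpos : 0 < G := Real.exp_pos _
  have hpow : χ φ ^ N = Complex.exp (N * l) := by rw [hl, Complex.exp_nat_mul]
  have hNl : ((N : ℂ) * l).re = N * l.re := by simp
  have hNli : ((N : ℂ) * l).im = N * l.im := by simp
  have hle : N * l.re ≤ -(c / 4) * (N * t ^ 2) := by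
    calc N * l.re ≤ N * (-(c / 4) * t ^ 2) := by gcongr
      _ = _ := by ring
  have hle' : -(N * q φ / 2) ≤ -(c / 4) * (N * t ^ 2) := by
    have h1 : N * (c * t ^ 2) ≤ N * q φ := by gcongr
    have h2 : 0 ≤ N * (c * t ^ 2) := by positivity
    linarith
  have hexp : Real.exp (N * l.re) ≤ G := by rw [hG]; gcongr
  have hsmall : |Real.exp (N * l.re) - Real.exp (-(N * q φ / 2))| ≤ C * (N * t ^ 4) * G := by
    refine (abs_exp_sub_exp_le hle hle').trans ?_
    rw [← hG]
    gcongr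
    have : N * l.re - -(N * q φ / 2) = N * (l.re + q φ / 2) := by ring
    rw [this, abs_mul, abs_of_pos hNpos]
    calc N * |l.re + q φ / 2| ≤ N * (C * t ^ 4) := by gcongr
      _ = _ := by ring
  have hang : |N * l.im| ≤ C * (N * t ^ 3) := by
    rw [abs_mul, abs_of_pos hNpos]
    calc N * |l.im| ≤ N * (C * t ^ 3) := by gcongr
      _ = _ := by ring
  have hang2 : |N * l.im + N * s φ| ≤ C * (N * t ^ 5) := by
    rw [← mul_add, abs_mul, abs_of_pos hNpos]
    calc N * |l.im + s φ| ≤ N * (C * t ^ 5) := by gcongr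
      _ = _ := by ring
  have hsN : |N * s φ| ≤ K * (N * t ^ 3) := by
    rw [abs_mul, abs_of_pos hNpos]
    calc N * |s φ| ≤ N * (K * t ^ 3) := by gcongr
      _ = _ := by ring
  have hre : (χ φ ^ N).re = Real.exp (N * l.re) * Real.cos (N * l.im) := by
    rw [hpow, Complex.exp_re, hNl, hNli]
  have him : (χ φ ^ N).im = Real.exp (N * l.re) * Real.sin (N * l.im) := by
    rw [hpow, Complex.exp_im, hNl, hNli]
  have hnorm : ‖χ φ ^ N‖ ≤ G := by
    rw [hpow, Complex.norm_exp, hNl]; exact hexp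
  have hC3' : C ^ 3 ≤ K * C ^ 3 := le_mul_of_one_le_left (by positivity) hK
  have hCK : K * C ≤ K * C ^ 3 := by gcongr; linarith
  refine ⟨hnorm, ?_, ?_, ?_⟩
  · rw [him, abs_mul, abs_of_pos (Real.exp_pos _)]
    calc Real.exp (N * l.re) * |Real.sin (N * l.im)| ≤ G * (C * (N * t ^ 3)) := by
          gcongr
          exact (Real.abs_sin_le_abs).trans hang
      _ = C * (N * t ^ 3) * G := by ring
      _ ≤ K * C ^ 3 * (N * t ^ 3) * G := by gcongr; linarith
  · have e1 : |Real.cos (N * l.im) - 1| ≤ (C * (N * t ^ 3)) ^ 2 := by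
      have h1 := Real.one_sub_sq_div_two_le_cos (x := N * l.im)
      have h2 := Real.cos_le_one (N * l.im)
      have h3 : (N * l.im) ^ 2 ≤ (C * (N * t ^ 3)) ^ 2 := by
        rw [← sq_abs]; gcongr
      have h4 := sq_nonneg (N * l.im)
      rw [abs_le]; constructor <;> linarith
    calc |(χ φ ^ N).re - Real.exp (-(N * q φ / 2))|
        = |Real.exp (N * l.re) * (Real.cos (N * l.im) - 1) +
            (Real.exp (N * l.re) - Real.exp (-(N * q φ / 2)))| := by rw [hre]; congr 1; ring
      _ ≤ |Real.exp (N * l.re) * (Real.cos (N * l.im) - 1)| +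
            |Real.exp (N * l.re) - Real.exp (-(N * q φ / 2))| := abs_add_le _ _
      _ ≤ G * (C * (N * t ^ 3)) ^ 2 + C * (N * t ^ 4) * G := by
          rw [abs_mul, abs_of_pos (Real.exp_pos _)]
          gcongr
      _ = (C * (N * t ^ 2) ^ 2 + C ^ 2 * (N * t ^ 2) ^ 3) / N * G := by field_simp; ring
      _ ≤ (K * C ^ 3 * (N * t ^ 2) ^ 2 + K * C ^ 3 * (N * t ^ 2) ^ 3) / N * G := by
          gcongr <;> linarith
      _ = _ := by ring
  · have e1 : |Real.sin (N * l.im) - N * l.im| ≤ (C * (N * t ^ 3)) ^ 3 := by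
      have h1 := Real.abs_sub_sin_le (N * l.im)
      rw [abs_sub_comm] at h1
      have h2 : |N * l.im| ^ 3 ≤ (C * (N * t ^ 3)) ^ 3 := by gcongr
      have h3 : 0 ≤ |N * l.im| ^ 3 := by positivity
      linarith
    have t1 : |Real.exp (N * l.re) * (Real.sin (N * l.im) - N * l.im)| ≤
        G * (C * (N * t ^ 3)) ^ 3 := by
      rw [abs_mul, abs_of_pos (Real.exp_pos _)]; gcongr
    have t2 : |Real.exp (N * l.re) * (N * l.im + N * s φ)| ≤ G * (C * (N * t ^ 5)) := by
      rw [abs_mul, abs_of_pos (Real.exp_pos _)]; gcongr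
    have t3 : |N * s φ * (Real.exp (N * l.re) - Real.exp (-(N * q φ / 2)))| ≤
        K * (N * t ^ 3) * (C * (N * t ^ 4) * G) := by
      rw [abs_mul]; gcongr
    calc |(χ φ ^ N).im + N * s φ * Real.exp (-(N * q φ / 2))|
        = |Real.exp (N * l.re) * (Real.sin (N * l.im) - N * l.im) +
            Real.exp (N * l.re) * (N * l.im + N * s φ) -
            N * s φ * (Real.exp (N * l.re) - Real.exp (-(N * q φ / 2)))| := by
          rw [him]; congr 1; ring
      _ ≤ |Real.exp (N * l.re) * (Real.sin (N * l.im) - N * l.im)| +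
            |Real.exp (N * l.re) * (N * l.im + N * s φ)| +
            |N * s φ * (Real.exp (N * l.re) - Real.exp (-(N * q φ / 2)))| := by
          refine (abs_sub _ _).trans ?_
          gcongr
          exact abs_add_le _ _
      _ ≤ G * (C * (N * t ^ 3)) ^ 3 + G * (C * (N * t ^ 5)) +
            K * (N * t ^ 3) * (C * (N * t ^ 4) * G) := by linarith
      _ = t * (C * (N * t ^ 2) ^ 2 + K * C * (N * t ^ 2) ^ 3
          + C ^ 3 * (N * t ^ 2) ^ 4) / N * G := by
          field_simp; ring
      _ ≤ t * (K * C ^ 3 * (N * t ^ 2) ^ 2 + K * C ^ 3 * (N * t ^ 2) ^ 3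
            + K * C ^ 3 * (N * t ^ 2) ^ 4) / N * G := by
          gcongr <;> linarith
      _ = _ := by ring

end LaplaceMethod

/-! ### Products of an amplitude and a high power -/

section LaplaceIntegral

variable {E : Type*} [NormedAddCommGroup E]

/-- The factor `H` vanishes at the origin, with second order real part `A` and first order imaginary
part `a`. -/
structure VanishingExpansion (K : ℝ) (H : E → ℂ) (A a : E → ℝ) : Prop where
  norm_le : ∀ φ, ‖H φ‖ ≤ K
  re : ∀ φ, |(H φ).re - A φ| ≤ K * ‖φ‖ ^ 4
  im : ∀ φ, |(H φ).im - a φ| ≤ K * ‖φ‖ ^ 3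
  quadratic : ∀ φ, |A φ| ≤ K * ‖φ‖ ^ 2
  linear : ∀ φ, |a φ| ≤ K * ‖φ‖

lemma exists_poly_le_mul_exp {b : ℝ} (hb : 0 < b) :
    ∃ M : ℝ, 0 < M ∧ ∀ x : ℝ, 0 ≤ x →
      x + x ^ 2 + x ^ 3 + x ^ 4 + x ^ 5 ≤ M * Real.exp (b * x) := by
  obtain ⟨M1, h1, H1⟩ := exists_pow_le_mul_exp 1 hb
  obtain ⟨M2, h2, H2⟩ := exists_pow_le_mul_exp 2 hb
  obtain ⟨M3, h3, H3⟩ := exists_pow_le_mul_exp 3 hb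
  obtain ⟨M4, h4, H4⟩ := exists_pow_le_mul_exp 4 hb
  obtain ⟨M5, h5, H5⟩ := exists_pow_le_mul_exp 5 hb
  refine ⟨M1 + M2 + M3 + M4 + M5, by positivity, fun x hx => ?_⟩
  have := H1 x hx
  have := H2 x hx
  have := H3 x hx
  have := H4 x hx
  have := H5 x hx
  simp only [pow_one, add_mul] at *
  linarith

/-- Polynomial factors in `x` are absorbed by half of the exponential decay. -/
lemma exists_poly_mul_exp_neg_le {c : ℝ} (hc : 0 < c) :
    ∃ M : ℝ, 0 < M ∧ ∀ x : ℝ, 0 ≤ x →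
      (x + x ^ 2 + x ^ 3 + x ^ 4 + x ^ 5) * Real.exp (-(c / 4) * x) ≤
        M * Real.exp (-(c / 8) * x) := by
  obtain ⟨M, hM, H⟩ := exists_poly_le_mul_exp (b := c / 8) (by positivity)
  refine ⟨M, hM, fun x hx => ?_⟩
  calc (x + x ^ 2 + x ^ 3 + x ^ 4 + x ^ 5) * Real.exp (-(c / 4) * x)
      ≤ M * Real.exp (c / 8 * x) * Real.exp (-(c / 4) * x) := by gcongr; exact H x hx
    _ = M * Real.exp (-(c / 8) * x) := by
        rw [mul_assoc, ← Real.exp_add]; congr 2; ring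

/-- Since `Re (H χ^N) = Re H Re χ^N - Im H Im χ^N`, only the even part `A` of `H` and the product of
its odd part `a` with the odd part `s` of the logarithm of `χ` contribute up to order `N⁻²`. -/
lemma CubicExpansion.pointwise_vanishing {c K : ℝ} (hc : 0 < c) (hK : 1 ≤ K) :
    ∃ δ C : ℝ, 0 < δ ∧ 0 < C ∧ ∀ (χ : E → ℂ) (q s : E → ℝ), CubicExpansion c K χ q s →
      ∀ φ, ∀ N : ℕ, 0 < N →
        (∀ (H : E → ℂ) (A a : E → ℝ), VanishingExpansion K H A a →
          (‖φ‖ ≤ δ → |(H φ * χ φ ^ N).re - Real.exp (-(N * q φ / 2)) * (A φ + N * a φ * s φ)| ≤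
            C / (N : ℝ) ^ 2 * Real.exp (-(c / 8) * (N * ‖φ‖ ^ 2))) ∧
          (δ < ‖φ‖ → |Real.exp (-(N * q φ / 2)) * (A φ + N * a φ * s φ)| ≤
            C / (N : ℝ) ^ 2 * Real.exp (-(c / 8) * (N * ‖φ‖ ^ 2)))) ∧
        (∀ H : E → ℂ, ‖H φ - 1‖ ≤ K * ‖φ‖ ^ 2 →
          (‖φ‖ ≤ δ → |(H φ * χ φ ^ N).re - Real.exp (-(N * q φ / 2))| ≤
            C / N * Real.exp (-(c / 8) * (N * ‖φ‖ ^ 2))) ∧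
          (δ < ‖φ‖ → |Real.exp (-(N * q φ / 2))| ≤
            C / N * Real.exp (-(c / 8) * (N * ‖φ‖ ^ 2)))) := by
  obtain ⟨δ, C, hδ, hδ1, hC, HB⟩ := CubicExpansion.exists_pow_bounds (E := E) hc hK
  obtain ⟨M, hM, HM⟩ := exists_poly_mul_exp_neg_le hc
  refine ⟨δ, 4 * K ^ 2 * C * M / δ ^ 2, hδ, by positivity, fun χ q s h φ N hN => ?_⟩
  have hlo := h.lower φ
  have hs := h.cubic φ
  have hB := fun hφ => HB χ q s h φ hφ N hN
  have ht0 : 0 ≤ ‖φ‖ := norm_nonneg _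
  have hNpos : (0 : ℝ) < N := by exact_mod_cast hN
  have hM' := HM (N * ‖φ‖ ^ 2) (by positivity)
  have hG0 := Real.exp_pos (-(c / 4) * (N * ‖φ‖ ^ 2))
  have hqG : Real.exp (-(N * q φ / 2)) ≤ Real.exp (-(c / 4) * (N * ‖φ‖ ^ 2)) := by
    gcongr
    have h1 : N * (c * ‖φ‖ ^ 2) ≤ N * q φ := by gcongr
    have h2 : 0 ≤ N * (c * ‖φ‖ ^ 2) := by positivity
    linarith
  have hKsq : K ≤ K ^ 2 := le_self_pow₀ hK (by norm_num)
  have hδ2 : δ ^ 2 ≤ 1 := pow_le_one₀ hδ.le hδ1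
  -- the constants of the individual estimates are all dominated by the one chosen
  have hfin : ∀ y : ℝ, y ≤ 4 * K ^ 2 * C / δ ^ 2 *
      ((N * ‖φ‖ ^ 2) + (N * ‖φ‖ ^ 2) ^ 2 + (N * ‖φ‖ ^ 2) ^ 3 + (N * ‖φ‖ ^ 2) ^ 4 +
        (N * ‖φ‖ ^ 2) ^ 5) * Real.exp (-(c / 4) * (N * ‖φ‖ ^ 2)) →
      y ≤ 4 * K ^ 2 * C * M / δ ^ 2 * Real.exp (-(c / 8) * (N * ‖φ‖ ^ 2)) := by
    intro y hy
    refine hy.trans ?_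
    rw [mul_assoc]
    calc _ ≤ 4 * K ^ 2 * C / δ ^ 2 * (M * Real.exp (-(c / 8) * (N * ‖φ‖ ^ 2))) := by gcongr
      _ = _ := by ring
  have hKC : 4 * K ^ 2 * C ≤ 4 * K ^ 2 * C / δ ^ 2 := by
    rw [le_div_iff₀ (by positivity)]
    exact mul_le_of_le_one_right (by positivity) hδ2
  generalize Real.exp (-(c / 8) * (N * ‖φ‖ ^ 2)) = G8 at *
  generalize Real.exp (-(c / 4) * (N * ‖φ‖ ^ 2)) = G at *
  have he0 := Real.exp_pos (-(N * q φ / 2))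
  generalize Real.exp (-(N * q φ / 2)) = e at *
  refine ⟨fun H A a hH => ⟨fun hφ => ?_, fun hφ => ?_⟩, fun H hH => ⟨fun hφ => ?_, fun hφ => ?_⟩⟩
  · obtain ⟨b1, b2, b3, b4⟩ := hB hφ
    have r1 := hH.re φ
    have r2 := hH.im φ
    have r3 := hH.quadratic φ
    have r4 := hH.linear φ
    rw [div_mul_eq_mul_div, le_div_iff₀ (by positivity)]
    refine hfin _ ?_
    generalize χ φ ^ N = X at *
    generalize ‖φ‖ = t at *
    have b1' : |X.re| ≤ G := (Complex.abs_re_le_norm X).trans b1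
    have key : |(H φ * X).re - e * (A φ + N * a φ * s φ)| ≤
        K * t ^ 4 * G + K * t ^ 2 * (C * ((N * t ^ 2) ^ 2 + (N * t ^ 2) ^ 3) / N * G) +
        K * t ^ 3 * (C * (N * t ^ 3) * G) +
        K * t * (C * t * ((N * t ^ 2) ^ 2 + (N * t ^ 2) ^ 3 + (N * t ^ 2) ^ 4) / N * G) := by
      have e1 : (H φ * X).re - e * (A φ + N * a φ * s φ) =
          ((H φ).re - A φ) * X.re + A φ * (X.re - e) - ((H φ).im - a φ) * X.im
            - a φ * (X.im + N * s φ * e) := by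
        rw [Complex.mul_re]; ring
      have s1 : |((H φ).re - A φ) * X.re| ≤ K * t ^ 4 * G := by rw [abs_mul]; gcongr
      have s2 : |A φ * (X.re - e)| ≤
          K * t ^ 2 * (C * ((N * t ^ 2) ^ 2 + (N * t ^ 2) ^ 3) / N * G) := by
        rw [abs_mul]; gcongr
      have s3 : |((H φ).im - a φ) * X.im| ≤ K * t ^ 3 * (C * (N * t ^ 3) * G) := by
        rw [abs_mul]; gcongr
      have s4 : |a φ * (X.im + N * s φ * e)| ≤
          K * t * (C * t * ((N * t ^ 2) ^ 2 + (N * t ^ 2) ^ 3 + (N * t ^ 2) ^ 4) / N * G) := by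
        rw [abs_mul]; gcongr
      rw [e1]
      rw [abs_le] at *
      constructor <;> linarith
    have hx : 0 ≤ N * t ^ 2 := by positivity
    calc |(H φ * X).re - e * (A φ + N * a φ * s φ)| * N ^ 2 ≤
          (K * t ^ 4 * G + K * t ^ 2 * (C * ((N * t ^ 2) ^ 2 + (N * t ^ 2) ^ 3) / N * G) +
        K * t ^ 3 * (C * (N * t ^ 3) * G) +
        K * t * (C * t * ((N * t ^ 2) ^ 2 + (N * t ^ 2) ^ 3 +
          (N * t ^ 2) ^ 4) / N * G)) * N ^ 2 := by
          gcongr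
      _ = (K * (N * t ^ 2) ^ 2 + K * C * ((N * t ^ 2) ^ 3 + (N * t ^ 2) ^ 4) +
            K * C * (N * t ^ 2) ^ 3 +
            K * C * ((N * t ^ 2) ^ 3 + (N * t ^ 2) ^ 4 + (N * t ^ 2) ^ 5)) * G := by
          field_simp
      _ ≤ 4 * K ^ 2 * C / δ ^ 2 * ((N * t ^ 2) + (N * t ^ 2) ^ 2 + (N * t ^ 2) ^ 3 +
            (N * t ^ 2) ^ 4 + (N * t ^ 2) ^ 5) * G := by
          gcongr ?_ * _
          generalize (N : ℝ) * t ^ 2 = x at *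
          have u1 : K ≤ K * C := le_mul_of_one_le_right (by linarith) hC
          have u2 : K * C ≤ K ^ 2 * C := by gcongr
          have u3 : 4 * (K * C) ≤ 4 * K ^ 2 * C / δ ^ 2 := le_trans (by linarith) hKC
          generalize 4 * K ^ 2 * C / δ ^ 2 = D at *
          have hKC0 : 0 ≤ K * C := by positivity
          have v1 : K * x ^ 2 ≤ K * C * x ^ 2 := by gcongr
          have v2 : 4 * (K * C) * (x + x ^ 2 + x ^ 3 + x ^ 4 + x ^ 5) ≤
              D * (x + x ^ 2 + x ^ 3 + x ^ 4 + x ^ 5) := by gcongr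
          have w1 : 0 ≤ K * C * x := by positivity
          have w2 : 0 ≤ K * C * x ^ 2 := by positivity
          have w3 : 0 ≤ K * C * x ^ 3 := by positivity
          have w4 : 0 ≤ K * C * x ^ 4 := by positivity
          have w5 : 0 ≤ K * C * x ^ 5 := by positivity
          linarith
  · have r3 := hH.quadratic φ
    have r4 := hH.linear φ
    rw [div_mul_eq_mul_div, le_div_iff₀ (by positivity)]
    refine hfin _ ?_
    generalize ‖φ‖ = t at *
    have hδt : δ ^ 2 ≤ t ^ 2 := by gcongr
    have s1 : |A φ + N * a φ * s φ| ≤ K * t ^ 2 + N * (K * t) * (K * t ^ 3) := by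
      refine (abs_add_le _ _).trans ?_
      rw [abs_mul, abs_mul, abs_of_pos hNpos]; gcongr
    calc |e * (A φ + N * a φ * s φ)| * N ^ 2
        ≤ (G * (K * t ^ 2 + N * (K * t) * (K * t ^ 3))) * N ^ 2 := by
          rw [abs_mul, abs_of_pos he0]; gcongr
      _ = (N * K * (N * t ^ 2) + N * K ^ 2 * (N * t ^ 2) ^ 2) * G := by ring
      _ ≤ (N * K * (N * t ^ 2) + N * K ^ 2 * (N * t ^ 2) ^ 2) * (t ^ 2 / δ ^ 2) * G := by
          gcongr ?_ * _
          refine le_mul_of_one_le_right (by positivity) ?_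
          rwa [le_div_iff₀ (by positivity), one_mul]
      _ = (K * (N * t ^ 2) ^ 2 + K ^ 2 * (N * t ^ 2) ^ 3) / δ ^ 2 * G := by ring
      _ ≤ 4 * K ^ 2 * C / δ ^ 2 * ((N * t ^ 2) + (N * t ^ 2) ^ 2 + (N * t ^ 2) ^ 3 +
            (N * t ^ 2) ^ 4 + (N * t ^ 2) ^ 5) * G := by
          rw [div_mul_eq_mul_div (4 * K ^ 2 * C)]
          gcongr ?_ / _ * _
          have hx : 0 ≤ (N : ℝ) * t ^ 2 := by positivity
          generalize (N : ℝ) * t ^ 2 = x at *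
          have u1 : K ^ 2 ≤ K ^ 2 * C := le_mul_of_one_le_right (by positivity) hC
          have v1 : K * x ^ 2 ≤ K ^ 2 * C * x ^ 2 := by gcongr; linarith
          have v2 : K ^ 2 * x ^ 3 ≤ K ^ 2 * C * x ^ 3 := by gcongr
          have w1 : 0 ≤ K ^ 2 * C * x := by positivity
          have w2 : 0 ≤ K ^ 2 * C * x ^ 2 := by positivity
          have w3 : 0 ≤ K ^ 2 * C * x ^ 3 := by positivity
          have w4 : 0 ≤ K ^ 2 * C * x ^ 4 := by positivity
          have w5 : 0 ≤ K ^ 2 * C * x ^ 5 := by positivity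
          linarith
  · obtain ⟨b1, b2, b3, b4⟩ := hB hφ
    rw [div_mul_eq_mul_div, le_div_iff₀ (by positivity)]
    refine hfin _ ?_
    generalize χ φ ^ N = X at *
    generalize ‖φ‖ = t at *
    have key : |(H φ * X).re - e| ≤
        K * t ^ 2 * G + C * ((N * t ^ 2) ^ 2 + (N * t ^ 2) ^ 3) / N * G := by
      have e1 : (H φ * X).re - e = ((H φ - 1) * X).re + (X.re - e) := by
        rw [sub_mul, one_mul, Complex.sub_re]; ring
      rw [e1]
      refine (abs_add_le _ _).trans (add_le_add ?_ b3)
      refine (Complex.abs_re_le_norm _).trans ?_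
      rw [norm_mul]; gcongr
    calc |(H φ * X).re - e| * N ≤
          (K * t ^ 2 * G + C * ((N * t ^ 2) ^ 2 + (N * t ^ 2) ^ 3) / N * G) * N := by gcongr
      _ = (K * (N * t ^ 2) + C * ((N * t ^ 2) ^ 2 + (N * t ^ 2) ^ 3)) * G := by field_simp
      _ ≤ 4 * K ^ 2 * C / δ ^ 2 * ((N * t ^ 2) + (N * t ^ 2) ^ 2 + (N * t ^ 2) ^ 3 +
            (N * t ^ 2) ^ 4 + (N * t ^ 2) ^ 5) * G := by
          have hx : 0 ≤ (N : ℝ) * t ^ 2 := by positivity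
          generalize (N : ℝ) * t ^ 2 = x at *
          gcongr ?_ * _
          have u1 : K ^ 2 ≤ K ^ 2 * C := le_mul_of_one_le_right (by positivity) hC
          have u2 : C ≤ K ^ 2 * C := le_mul_of_one_le_left (by positivity) (by linarith)
          have u0 : 0 ≤ K ^ 2 * C := by positivity
          generalize 4 * K ^ 2 * C / δ ^ 2 = D at *
          have v1 : K * x ≤ D * x := by gcongr; linarith
          have v2 : C * x ^ 2 ≤ D * x ^ 2 := by gcongr; linarith
          have v3 : C * x ^ 3 ≤ D * x ^ 3 := by gcongr; linarith
          have w4 : 0 ≤ D * x ^ 4 := by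
            have : 0 ≤ D := by linarith
            positivity
          have w5 : 0 ≤ D * x ^ 5 := by
            have : 0 ≤ D := by linarith
            positivity
          linarith
  · rw [div_mul_eq_mul_div, le_div_iff₀ (by positivity)]
    refine hfin _ ?_
    generalize ‖φ‖ = t at *
    have hδt : δ ^ 2 ≤ t ^ 2 := by gcongr
    rw [abs_of_pos he0]
    calc e * N ≤ (G * N) * (t ^ 2 / δ ^ 2) := by
          refine (mul_le_mul_of_nonneg_right hqG hNpos.le).trans ?_
          refine le_mul_of_one_le_right (by positivity) ?_
          rwa [le_div_iff₀ (by positivity), one_mul]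
      _ = 1 / δ ^ 2 * (N * t ^ 2) * G := by ring
      _ ≤ 4 * K ^ 2 * C / δ ^ 2 * ((N * t ^ 2) + (N * t ^ 2) ^ 2 + (N * t ^ 2) ^ 3 +
            (N * t ^ 2) ^ 4 + (N * t ^ 2) ^ 5) * G := by
          have hx : 0 ≤ (N : ℝ) * t ^ 2 := by positivity
          generalize (N : ℝ) * t ^ 2 = x at *
          have h1 : 1 ≤ 4 * K ^ 2 * C := by
            have u2 : C ≤ K ^ 2 * C := le_mul_of_one_le_left (by positivity) (by linarith)
            linarith
          gcongr
          have : 0 ≤ x ^ 2 + x ^ 3 + x ^ 4 + x ^ 5 := by positivity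
          linarith

variable [InnerProductSpace ℝ E] [FiniteDimensional ℝ E] [MeasurableSpace E] [BorelSpace E]

lemma integrable_exp_neg_mul_sq_norm {b : ℝ} (hb : 0 < b) :
    Integrable (fun φ : E => Real.exp (-b * ‖φ‖ ^ 2)) := by
  have h := (GaussianFourier.integrable_cexp_neg_mul_sq_norm_add (V := E) (b := (b : ℂ))
    (by simpa using hb) 0 0).re
  refine h.congr (ae_of_all _ fun φ => ?_)
  simp only [zero_mul, add_zero, RCLike.re_to_complex]
  have : (-(b : ℂ) * (‖φ‖ : ℂ) ^ 2) = ((-b * ‖φ‖ ^ 2 : ℝ) : ℂ) := by push_cast; ring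
  rw [this, ← Complex.ofReal_exp, Complex.ofReal_re]

/-- Substituting `φ = u / √N`. -/
lemma integral_comp_sqrt_smul (f : E → ℝ) {N : ℕ} (hN : 0 < N) :
    ∫ φ, f (Real.sqrt N • φ) = (Real.sqrt N ^ Module.finrank ℝ E)⁻¹ * ∫ φ, f φ :=
  Measure.integral_comp_smul_of_nonneg (volume : Measure E) f _ (hR := by positivity)

lemma integral_exp_neg_mul_nat_mul_sq_norm (b : ℝ) {N : ℕ} (hN : 0 < N) :
    ∫ φ : E, Real.exp (-b * (N * ‖φ‖ ^ 2)) =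
      (Real.sqrt N ^ Module.finrank ℝ E)⁻¹ * ∫ φ : E, Real.exp (-b * ‖φ‖ ^ 2) := by
  rw [← integral_comp_sqrt_smul _ hN]
  congr 1; ext φ
  rw [norm_smul, mul_pow, Real.norm_of_nonneg (Real.sqrt_nonneg _), Real.sq_sqrt (by positivity)]

/-- A geometric factor beats every power of `N`. -/
lemma exists_pow_le_mul_inv {ρ : ℝ} (h0 : 0 < ρ) (h1 : ρ < 1) (r d : ℕ) :
    ∃ C : ℝ, 0 < C ∧ ∀ N : ℕ, 0 < N → r ≤ N →
      ρ ^ (N - r) ≤ C / (N : ℝ) ^ 2 * (Real.sqrt N ^ d)⁻¹ := by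
  have ht := tendsto_pow_const_mul_const_pow_of_abs_lt_one (d + 2) (r := ρ)
    (by rwa [abs_of_pos h0])
  obtain ⟨B, hB⟩ := ht.bddAbove_range
  have hB0 : ρ ≤ B := by
    have := hB ⟨1, rfl⟩
    simpa using this
  refine ⟨B / ρ ^ r, div_pos (h0.trans_le hB0) (by positivity), fun N hN hr => ?_⟩
  have hNpos : (0 : ℝ) < N := by exact_mod_cast hN
  have hN1 : (1 : ℝ) ≤ N := by exact_mod_cast hN
  have hsq : Real.sqrt N ^ d ≤ (N : ℝ) ^ d := by
    gcongr
    rw [Real.sqrt_le_left (by positivity)]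
    nlinarith
  have h2 : (N : ℝ) ^ (d + 2) * ρ ^ N ≤ B := hB ⟨N, rfl⟩
  have h3 : ρ ^ (N - r) = ρ ^ N / ρ ^ r := by
    rw [pow_sub₀ _ h0.ne' hr]; rfl
  have hs : 0 < Real.sqrt N ^ d := by positivity
  rw [h3, div_div, ← div_eq_mul_inv, div_div, div_le_div_iff₀ (by positivity) (by positivity)]
  calc ρ ^ N * (ρ ^ r * N ^ 2 * Real.sqrt N ^ d) ≤ ρ ^ N * (ρ ^ r * N ^ 2 * (N : ℝ) ^ d) := by
        gcongr
    _ = ((N : ℝ) ^ (d + 2) * ρ ^ N) * ρ ^ r := by ring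
    _ ≤ B * ρ ^ r := by gcongr

end LaplaceIntegral

/-! ### Ratios of Fourier integrals -/

section LaplaceRatio

variable {E : Type*} [NormedAddCommGroup E] [InnerProductSpace ℝ E] [FiniteDimensional ℝ E]
  [MeasurableSpace E] [BorelSpace E]

lemma abs_integral_sub_le_of_abs_sub_le {X : Type*} [MeasurableSpace X] {μ : Measure X}
    {f g b : X → ℝ} (hf : Integrable f μ) (hg : AEStronglyMeasurable g μ) (hb : Integrable b μ)
    (h : ∀ x, |f x - g x| ≤ b x) : |(∫ x, f x ∂μ) - ∫ x, g x ∂μ| ≤ ∫ x, b x ∂μ := by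
  have hd : Integrable (fun x => f x - g x) μ :=
    hb.mono' (hf.1.sub hg) (ae_of_all _ fun x => (Real.norm_eq_abs _).trans_le (h x))
  have hg' : Integrable g μ := by
    have := hf.sub hd
    simpa [Pi.sub_def] using this
  rw [← integral_sub hf hg']
  exact norm_integral_le_of_norm_le hb
    (ae_of_all _ fun x => (Real.norm_eq_abs _).trans_le (h x))

/-- What is needed of `χ` away from the origin: it is bounded away from `1` in modulus, and its
`r`-th power is integrable. -/
structure TailBound (δ ρ : ℝ) (r : ℕ) (M : ℝ) (χ : E → ℂ) : Prop where
  measurable : Measurable χ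
  norm_le_one : ∀ φ, ‖χ φ‖ ≤ 1
  norm_le : ∀ φ, δ < ‖φ‖ → ‖χ φ‖ ≤ ρ
  integrable : Integrable (fun φ => ‖χ φ‖ ^ r) volume
  integral_le : ∫ φ, ‖χ φ‖ ^ r ≤ M

lemma TailBound.integrable_re_mul_pow {δ ρ M K : ℝ} {r N : ℕ} {χ : E → ℂ}
    (h : TailBound δ ρ r M χ) {H : E → ℂ} (hH : Measurable H) (hHK : ∀ φ, ‖H φ‖ ≤ K)
    (hr : r ≤ N) : Integrable (fun φ => (H φ * χ φ ^ N).re) volume := by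
  refine (h.integrable.const_mul K).mono'
    (Complex.measurable_re.comp (hH.mul (h.measurable.pow_const N))).aestronglyMeasurable
    (ae_of_all _ fun φ => ?_)
  refine (Complex.abs_re_le_norm _).trans ?_
  rw [norm_mul, norm_pow]
  have h1 : ‖χ φ‖ ^ N ≤ ‖χ φ‖ ^ r :=
    pow_le_pow_of_le_one (norm_nonneg _) (h.norm_le_one φ) hr
  gcongr
  · exact (norm_nonneg _).trans (hHK φ)
  · exact hHK φ

lemma TailBound.abs_re_mul_pow_le {δ ρ M K : ℝ} {r N : ℕ} {χ : E → ℂ}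
    (h : TailBound δ ρ r M χ) {H : E → ℂ} (hHK : ∀ φ, ‖H φ‖ ≤ K)
    (hr : r ≤ N) {φ : E} (hφ : δ < ‖φ‖) :
    |(H φ * χ φ ^ N).re| ≤ K * ρ ^ (N - r) * ‖χ φ‖ ^ r := by
  refine (Complex.abs_re_le_norm _).trans ?_
  rw [norm_mul, norm_pow]
  have h1 : ‖χ φ‖ ^ N = ‖χ φ‖ ^ (N - r) * ‖χ φ‖ ^ r := by rw [← pow_add, Nat.sub_add_cancel hr]
  rw [h1, ← mul_assoc]
  have hK0 : 0 ≤ K := (norm_nonneg _).trans (hHK φ)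
  gcongr
  · exact hHK φ
  · exact h.norm_le φ hφ

/-- Integration of a pointwise comparison which holds near the origin up to a Gaussian error, the
two functions being separately small elsewhere. -/
lemma TailBound.abs_integral_sub_le {δ ρ M K c B B' : ℝ} {r N : ℕ} {χ : E → ℂ}
    (h : TailBound δ ρ r M χ) (hc : 0 < c) (hρ : 0 < ρ) (hK : 0 ≤ K) {H : E → ℂ}
    (hH : Measurable H)
    (hHK : ∀ φ, ‖H φ‖ ≤ K) (hr : r ≤ N) (hN : 0 < N) {g : E → ℝ} (hg : Measurable g)
    (h1 : ∀ φ, ‖φ‖ ≤ δ → |(H φ * χ φ ^ N).re - g φ| ≤ B * Real.exp (-c * (N * ‖φ‖ ^ 2)))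
    (h2 : ∀ φ, δ < ‖φ‖ → |g φ| ≤ B * Real.exp (-c * (N * ‖φ‖ ^ 2)))
    (hB' : ρ ^ (N - r) ≤ B' * (Real.sqrt N ^ Module.finrank ℝ E)⁻¹) :
    |(∫ φ, (H φ * χ φ ^ N).re) - ∫ φ, g φ| ≤
      (B * (∫ φ : E, Real.exp (-c * ‖φ‖ ^ 2)) + K * B' * M) *
        (Real.sqrt N ^ Module.finrank ℝ E)⁻¹ := by
  have hNpos : (0 : ℝ) < N := by exact_mod_cast hN
  have hG : Integrable (fun φ : E => Real.exp (-c * (N * ‖φ‖ ^ 2))) := by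
    have := integrable_exp_neg_mul_sq_norm (E := E) (b := c * N) (by positivity)
    refine this.congr (ae_of_all _ fun φ => ?_)
    simp only; congr 1; ring
  have hpt : ∀ φ, |(H φ * χ φ ^ N).re - g φ| ≤
      B * Real.exp (-c * (N * ‖φ‖ ^ 2)) + K * ρ ^ (N - r) * ‖χ φ‖ ^ r := by
    intro φ
    rcases le_or_gt ‖φ‖ δ with hφ | hφ
    · have : 0 ≤ K * ρ ^ (N - r) * ‖χ φ‖ ^ r := by positivity
      linarith [h1 φ hφ]
    · have := h.abs_re_mul_pow_le hHK hr hφ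
      exact (abs_sub _ _).trans (by linarith [h2 φ hφ])
  refine (abs_integral_sub_le_of_abs_sub_le (h.integrable_re_mul_pow hH hHK hr)
    hg.aestronglyMeasurable ((hG.const_mul B).add (h.integrable.const_mul _)) hpt).trans ?_
  rw [integral_add' (hG.const_mul B) (h.integrable.const_mul _), integral_const_mul,
    integral_const_mul, integral_exp_neg_mul_nat_mul_sq_norm _ hN]
  have hM : 0 ≤ M := le_trans (integral_nonneg fun φ => by positivity) h.integral_le
  have hS : 0 ≤ B' * (Real.sqrt N ^ Module.finrank ℝ E)⁻¹ := le_trans (by positivity) hB'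
  have hi0 : 0 ≤ ∫ φ, ‖χ φ‖ ^ r := integral_nonneg fun φ => by positivity
  have : K * ρ ^ (N - r) * ∫ φ, ‖χ φ‖ ^ r ≤
      K * (B' * (Real.sqrt N ^ Module.finrank ℝ E)⁻¹) * M := by
    gcongr
    exact h.integral_le
  linarith

/-- The Fourier integral with amplitude `H` equals a Gaussian integral, up to an error which,
measured in units of `∫ exp (-N q / 2)`, is of order `N⁻²` if `H` vanishes at the origin, and of
order `N⁻¹` if `H` is one at the origin. -/
theorem CubicExpansion.integral_bounds {c K : ℝ} (hc : 0 < c) (hK : 1 ≤ K) :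
    ∃ δ : ℝ, 0 < δ ∧ ∀ ρ : ℝ, 0 < ρ → ρ < 1 → ∀ (r : ℕ) (M : ℝ), ∃ C : ℝ, 0 ≤ C ∧
      ∀ (χ : E → ℂ) (q s : E → ℝ), CubicExpansion c K χ q s → Measurable q → Measurable s →
      TailBound δ ρ r M χ → ∀ N : ℕ, 0 < N → r ≤ N →
        (∀ (H : E → ℂ) (A a : E → ℝ), VanishingExpansion K H A a → Measurable H → Measurable A →
          Measurable a →
          |(∫ φ, (H φ * χ φ ^ N).re) -
              ∫ φ, Real.exp (-(N * q φ / 2)) * (A φ + N * a φ * s φ)| ≤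
            C / (N : ℝ) ^ 2 * (Real.sqrt N ^ Module.finrank ℝ E)⁻¹) ∧
        (∀ H : E → ℂ, Measurable H → (∀ φ, ‖H φ‖ ≤ K) → (∀ φ, ‖H φ - 1‖ ≤ K * ‖φ‖ ^ 2) →
          |(∫ φ, (H φ * χ φ ^ N).re) - ∫ φ, Real.exp (-(N * q φ / 2))| ≤
            C / N * (Real.sqrt N ^ Module.finrank ℝ E)⁻¹) := by
  obtain ⟨δ, C1, hδ, hC1, HP⟩ := CubicExpansion.pointwise_vanishing (E := E) hc hK
  refine ⟨δ, hδ, fun ρ hρ0 hρ1 r M => ?_⟩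
  obtain ⟨C2, hC2, HC2⟩ := exists_pow_le_mul_inv hρ0 hρ1 r (Module.finrank ℝ E)
  set Z8 := ∫ φ : E, Real.exp (-(c / 8) * ‖φ‖ ^ 2) with hZ8
  have hZ80 : 0 ≤ Z8 := integral_nonneg fun φ => (Real.exp_pos _).le
  refine ⟨C1 * Z8 + K * C2 * |M|, by positivity, fun χ q s hE hq hs hT N hN hr => ?_⟩
  have hNpos : (0 : ℝ) < N := by exact_mod_cast hN
  have hN1 : (1 : ℝ) ≤ N := by exact_mod_cast hN
  have hM : |M| = M := abs_of_nonneg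
    (le_trans (integral_nonneg fun φ => by positivity) hT.integral_le)
  rw [hM]
  refine ⟨fun H A a hV hH hA ha => ?_, fun H hH hHK hH1 => ?_⟩
  · have := hT.abs_integral_sub_le (c := c / 8) (B := C1 / (N : ℝ) ^ 2)
      (B' := C2 / (N : ℝ) ^ 2) (by positivity)
      hρ0 (by linarith) hH hV.norm_le hr hN
      (g := fun φ => Real.exp (-(N * q φ / 2)) * (A φ + N * a φ * s φ)) (by fun_prop)
      (fun φ hφ => ((HP χ q s hE φ N hN).1 H A a hV).1 hφ)
      (fun φ hφ => ((HP χ q s hE φ N hN).1 H A a hV).2 hφ) (HC2 N hN hr)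
    refine this.trans (le_of_eq ?_)
    rw [← hZ8]
    field_simp
  · have := hT.abs_integral_sub_le (c := c / 8) (B := C1 / N)
      (B' := C2 / N) (by positivity)
      hρ0 (by linarith) hH hHK hr hN
      (g := fun φ => Real.exp (-(N * q φ / 2))) (by fun_prop)
      (fun φ hφ => ((HP χ q s hE φ N hN).2 H (hH1 φ)).1 hφ)
      (fun φ hφ => ((HP χ q s hE φ N hN).2 H (hH1 φ)).2 hφ) ((HC2 N hN hr).trans ?_)
    · refine this.trans (le_of_eq ?_)
      rw [← hZ8]
      field_simp
    · gcongr
      exact le_self_pow₀ hN1 (by norm_num)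

/-- The scaling behaviour of the functions that enter the expansion. -/
structure Homogeneous (q s A a : E → ℝ) : Prop where
  q : ∀ (x : ℝ) φ, q (x • φ) = x ^ 2 * q φ
  s : ∀ (x : ℝ) φ, s (x • φ) = x ^ 3 * s φ
  A : ∀ (x : ℝ) φ, A (x • φ) = x ^ 2 * A φ
  a : ∀ (x : ℝ) φ, a (x • φ) = x * a φ

lemma Homogeneous.integral_eq {q s A a : E → ℝ} (h : Homogeneous q s A a) {N : ℕ} (hN : 0 < N) :
    ∫ φ, Real.exp (-(N * q φ / 2)) * (A φ + N * a φ * s φ) =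
      (Real.sqrt N ^ Module.finrank ℝ E)⁻¹ *
        ((∫ φ, Real.exp (-(q φ / 2)) * (A φ + a φ * s φ)) / N) := by
  have hNpos : (0 : ℝ) < N := by exact_mod_cast hN
  have h1 := integral_comp_sqrt_smul
    (fun φ => (Real.exp (-(q φ / 2)) * (A φ + a φ * s φ)) / N) hN
  rw [← integral_div, ← h1]
  congr 1; ext φ
  have h4 : Real.sqrt N * Real.sqrt N ^ 3 = N * N := by
    have := Real.mul_self_sqrt hNpos.le
    calc Real.sqrt N * Real.sqrt N ^ 3
        = (Real.sqrt N * Real.sqrt N) * (Real.sqrt N * Real.sqrt N) := by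
          ring
      _ = _ := by rw [this]
  rw [h.q, h.s, h.A, h.a, Real.sq_sqrt hNpos.le]
  have : Real.sqrt N * a φ * (Real.sqrt N ^ 3 * s φ) = N * N * (a φ * s φ) := by
    rw [← h4]; ring
  rw [this]
  field_simp

lemma Homogeneous.integral_exp_eq {q s A a : E → ℝ} (h : Homogeneous q s A a) {N : ℕ}
    (hN : 0 < N) :
    ∫ φ, Real.exp (-(N * q φ / 2)) =
      (Real.sqrt N ^ Module.finrank ℝ E)⁻¹ * ∫ φ, Real.exp (-(q φ / 2)) := by
  have hNpos : (0 : ℝ) < N := by exact_mod_cast hN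
  rw [← integral_comp_sqrt_smul (fun φ => Real.exp (-(q φ / 2))) hN]
  congr 1; ext φ
  rw [h.q, Real.sq_sqrt hNpos.le]

lemma integrable_exp_neg_div_two {c : ℝ} (hc : 0 < c) {q : E → ℝ} (hq : Measurable q)
    (hlo : ∀ φ, c * ‖φ‖ ^ 2 ≤ q φ) : Integrable (fun φ => Real.exp (-(q φ / 2))) := by
  refine (integrable_exp_neg_mul_sq_norm (E := E) (b := c / 2) (by positivity)).mono'
    (by fun_prop) (ae_of_all _ fun φ => ?_)
  rw [Real.norm_of_nonneg (Real.exp_pos _).le]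
  gcongr
  linarith [hlo φ]

/-- An error of order `N⁻¹` in the denominator is harmless when the numerator is of order `N⁻¹`. -/
lemma abs_div_sub_div_le {Z z L L0 C e₁ e₂ N : ℝ} (hz : 0 < z) (hZ : z ≤ Z) (hL : |L| ≤ L0)
    (hN : 0 < N) (he₁ : |e₁| ≤ C / N ^ 2) (he₂ : |e₂| ≤ C / N) (hNC : 2 * C ≤ z * N) :
    0 < Z + e₂ ∧ |(L / N + e₁) / (Z + e₂) - L / Z / N| ≤ 2 * (C + C * L0 / z) / z / N ^ 2 := by
  have hZ0 : 0 < Z := hz.trans_le hZ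
  have h1 : C / N ≤ z / 2 := by
    rw [div_le_div_iff₀ hN (by norm_num)]; linarith
  have h2 : z / 2 ≤ Z + e₂ := by
    have := (abs_le.1 he₂).1
    linarith
  have hpos : 0 < Z + e₂ := by linarith
  refine ⟨hpos, ?_⟩
  have hC : 0 ≤ C / N := (abs_nonneg _).trans he₂
  have hL0 : 0 ≤ L0 := (abs_nonneg _).trans hL
  have e : (L / N + e₁) / (Z + e₂) - L / Z / N = (e₁ - e₂ * L / (Z * N)) / (Z + e₂) := by
    field_simp; ring
  rw [e, abs_div, abs_of_pos hpos]
  have h3 : |e₁ - e₂ * L / (Z * N)| ≤ C / N ^ 2 + C / N * L0 / (z * N) := by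
    refine (abs_sub _ _).trans (add_le_add he₁ ?_)
    rw [abs_div, abs_mul, abs_of_pos (mul_pos hZ0 hN)]
    gcongr
  calc |e₁ - e₂ * L / (Z * N)| / (Z + e₂) ≤ (C / N ^ 2 + C / N * L0 / (z * N)) / (z / 2) := by
        have : 0 ≤ C / N ^ 2 := (abs_nonneg _).trans he₁
        gcongr
    _ = _ := by field_simp

/-- The ratio of two Fourier integrals of powers of `χ`, when the numerator has an amplitude that
vanishes at the origin: it is of order `1/n`, with leading coefficient the Gaussian average of
`A + a s`. The constants depend on `χ` and on the amplitudes only through the bounds that are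
assumed. -/
theorem CubicExpansion.ratio_bounds {c K : ℝ} (hc : 0 < c) (hK : 1 ≤ K) :
    ∃ δ : ℝ, 0 < δ ∧ ∀ ρ : ℝ, 0 < ρ → ρ < 1 → ∀ (r : ℕ) (M : ℝ) (m : ℕ), ∃ (C : ℝ) (N₀ : ℕ),
      ∀ (χ : E → ℂ) (q s : E → ℝ), CubicExpansion c K χ q s → Measurable q → Measurable s →
      TailBound δ ρ r M χ →
      ∀ (H H₁ : E → ℂ) (A a : E → ℝ), VanishingExpansion K H A a → Homogeneous q s A a →
      Measurable H → Measurable A → Measurable a → Measurable H₁ →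
      (∀ φ, ‖H₁ φ‖ ≤ K) → (∀ φ, ‖H₁ φ - 1‖ ≤ K * ‖φ‖ ^ 2) → ∀ L : ℝ,
      ∫ φ, Real.exp (-(q φ / 2)) * (A φ + a φ * s φ) = L * ∫ φ, Real.exp (-(q φ / 2)) →
      |L| ≤ C ∧ ∀ N : ℕ, N₀ ≤ N →
        0 < ∫ φ, (H₁ φ * χ φ ^ N).re ∧
        |(∫ φ, (H φ * χ φ ^ N).re) / (∫ φ, (H₁ φ * χ φ ^ N).re) - L / (m + N : ℕ)| ≤
          C / ((m + N : ℕ) : ℝ) ^ 2 := by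
  obtain ⟨δ, hδ, HB⟩ := CubicExpansion.integral_bounds (E := E) hc hK
  refine ⟨δ, hδ, fun ρ hρ0 hρ1 r M m => ?_⟩
  obtain ⟨C, hC, HC⟩ := HB ρ hρ0 hρ1 r M
  -- since `q ≤ K ‖φ‖²`, this is a lower bound for the Gaussian integral in the denominator
  set z := ∫ φ : E, Real.exp (-(K / 2) * ‖φ‖ ^ 2) with hz
  have hzpos : 0 < z :=
    integral_exp_pos (integrable_exp_neg_mul_sq_norm (E := E) (b := K / 2) (by positivity))
  obtain ⟨P, hP, HPP⟩ := exists_poly_mul_exp_neg_le (c := 2 * c) (by positivity)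
  set L0 := K ^ 2 * P * ∫ φ : E, Real.exp (-(c / 4) * ‖φ‖ ^ 2) with hL0
  have hL00 : 0 ≤ L0 := mul_nonneg (by positivity) (integral_nonneg fun φ => (Real.exp_pos _).le)
  set C' := 2 * (C + C * L0 / z) / z with hC'
  have hC'0 : 0 ≤ C' := by positivity
  -- the three summands bound the error at `N`, the passage from `L / N` to `L / (m + N)`, and `L`
  refine ⟨4 * C' + 4 * m * (L0 / z) + L0 / z, max (max 1 r) (max m (Nat.ceil (2 * C / z))), ?_⟩
  intro χ q s hE hq hs hT H H₁ A a hV hom hH hA ha hH₁ hH₁K hH₁1 L hL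
  have hZint := integrable_exp_neg_div_two hc hq hE.lower
  have hzZ : z ≤ ∫ φ, Real.exp (-(q φ / 2)) := by
    refine integral_mono (integrable_exp_neg_mul_sq_norm (by positivity)) hZint fun φ => ?_
    simp only
    gcongr
    linarith [hE.upper φ]
  set Z := ∫ φ, Real.exp (-(q φ / 2)) with hZ
  have hZpos : 0 < Z := hzpos.trans_le hzZ
  have hLint : |L * Z| ≤ L0 := by
    rw [← hL, hL0, ← integral_const_mul, ← Real.norm_eq_abs]
    have hint := (integrable_exp_neg_mul_sq_norm (E := E) (b := c / 4)
      (by positivity)).const_mul (K ^ 2 * P)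
    refine norm_integral_le_of_norm_le hint (ae_of_all _ fun φ => ?_)
    rw [Real.norm_eq_abs, abs_mul, abs_of_pos (Real.exp_pos _)]
    have h1 := HPP (‖φ‖ ^ 2) (by positivity)
    have h2 : Real.exp (-(q φ / 2)) ≤ Real.exp (-(2 * c / 4) * ‖φ‖ ^ 2) := by
      gcongr; linarith [hE.lower φ]
    have h3 : |A φ + a φ * s φ| ≤ K ^ 2 * (‖φ‖ ^ 2 + (‖φ‖ ^ 2) ^ 2) := by
      refine (abs_add_le _ _).trans ?_
      rw [abs_mul]
      have e1 := hV.quadratic φ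
      have e2 : |a φ| * |s φ| ≤ (K * ‖φ‖) * (K * ‖φ‖ ^ 3) := by
        gcongr
        · exact hV.linear φ
        · exact hE.cubic φ
      have e3 : K * ‖φ‖ ^ 2 ≤ K ^ 2 * ‖φ‖ ^ 2 := by
        gcongr; exact le_self_pow₀ hK (by norm_num)
      linarith
    calc Real.exp (-(q φ / 2)) * |A φ + a φ * s φ|
        ≤ Real.exp (-(2 * c / 4) * ‖φ‖ ^ 2) * (K ^ 2 * (‖φ‖ ^ 2 + (‖φ‖ ^ 2) ^ 2)) := by gcongr
      _ ≤ Real.exp (-(2 * c / 4) * ‖φ‖ ^ 2) * (K ^ 2 * (‖φ‖ ^ 2 + (‖φ‖ ^ 2) ^ 2 + (‖φ‖ ^ 2) ^ 3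
            + (‖φ‖ ^ 2) ^ 4 + (‖φ‖ ^ 2) ^ 5)) := by
          gcongr _ * (_ * ?_)
          have : 0 ≤ (‖φ‖ ^ 2) ^ 3 + (‖φ‖ ^ 2) ^ 4 + (‖φ‖ ^ 2) ^ 5 := by positivity
          linarith
      _ = K ^ 2 * ((‖φ‖ ^ 2 + (‖φ‖ ^ 2) ^ 2 + (‖φ‖ ^ 2) ^ 3
            + (‖φ‖ ^ 2) ^ 4 + (‖φ‖ ^ 2) ^ 5) * Real.exp (-(2 * c / 4) * ‖φ‖ ^ 2)) := by ring
      _ ≤ K ^ 2 * (P * Real.exp (-(2 * c / 8) * ‖φ‖ ^ 2)) := by gcongr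
      _ = K ^ 2 * P * Real.exp (-(c / 4) * ‖φ‖ ^ 2) := by
          rw [← mul_assoc]; congr 2; ring
  have hLbd : |L| ≤ L0 / z := by
    rw [le_div_iff₀ hzpos]
    rw [abs_mul, abs_of_pos hZpos] at hLint
    exact (mul_le_mul_of_nonneg_left hzZ (abs_nonneg _)).trans hLint
  have hLz0 : 0 ≤ L0 / z := by positivity
  refine ⟨by
    have : (0 : ℝ) ≤ 4 * m * (L0 / z) := by positivity
    linarith, fun N hN => ?_⟩
  have hN1 : 1 ≤ N := le_trans (by simp) hN
  have hNr : r ≤ N := le_trans (by simp) hN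
  have hNm : m ≤ N := le_trans (by simp) hN
  have hNC : Nat.ceil (2 * C / z) ≤ N := le_trans (by simp) hN
  have hNpos : (0 : ℝ) < N := by exact_mod_cast hN1
  have hNC' : 2 * C ≤ z * N := by
    have := Nat.ceil_le.1 hNC
    rw [div_le_iff₀ hzpos] at this
    linarith
  obtain ⟨hnum, hden⟩ := HC χ q s hE hq hs hT N hN1 hNr
  have hnum := hnum H A a hV hH hA ha
  have hden := hden H₁ hH₁ hH₁K hH₁1
  rw [hom.integral_eq hN1, hL] at hnum
  rw [hom.integral_exp_eq hN1] at hden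
  set S := (Real.sqrt N ^ Module.finrank ℝ E)⁻¹ with hS
  have hSpos : 0 < S := by positivity
  set num := ∫ φ, (H φ * χ φ ^ N).re
  set den := ∫ φ, (H₁ φ * χ φ ^ N).re
  have he₁ : |num / S - L * Z / N| ≤ C / (N : ℝ) ^ 2 := by
    have : num / S - L * Z / N = (num - S * (L * Z / N)) / S := by field_simp
    rw [this, abs_div, abs_of_pos hSpos, div_le_iff₀ hSpos]; exact hnum
  have he₂ : |den / S - Z| ≤ C / N := by
    have : den / S - Z = (den - S * Z) / S := by field_simp
    rw [this, abs_div, abs_of_pos hSpos, div_le_iff₀ hSpos]; exact hden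
  obtain ⟨hpos, hr⟩ := abs_div_sub_div_le hzpos hzZ hLint hNpos he₁ he₂ hNC'
  rw [add_sub_cancel] at hpos
  rw [add_sub_cancel, add_sub_cancel, div_div_div_cancel_right₀ hSpos.ne',
    mul_div_cancel_right₀ _ hZpos.ne'] at hr
  refine ⟨(div_pos_iff_of_pos_right hSpos).1 hpos, ?_⟩
  have hnpos : (0 : ℝ) < (m + N : ℕ) := by positivity
  have hn2 : ((m + N : ℕ) : ℝ) ≤ 2 * N := by
    push_cast
    have : (m : ℝ) ≤ N := by exact_mod_cast hNm
    linarith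
  have h1N : 1 / (N : ℝ) ≤ 2 / (m + N : ℕ) := by
    rw [div_le_div_iff₀ hNpos hnpos]; linarith
  have h1N2 : 1 / (N : ℝ) ^ 2 ≤ 4 / ((m + N : ℕ) : ℝ) ^ 2 := by
    have := pow_le_pow_left₀ (by positivity) h1N 2
    rw [div_pow, div_pow] at this
    linarith
  have hshift : |L / N - L / (m + N : ℕ)| ≤ (L0 / z) * m * (4 / ((m + N : ℕ) : ℝ) ^ 2) := by
    have e : L / N - L / (m + N : ℕ) = L * m * (1 / N * (1 / (m + N : ℕ))) := by
      push_cast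
      field_simp
      ring
    rw [e, abs_mul, abs_mul, abs_of_nonneg (by positivity : (0 : ℝ) ≤ m),
      abs_of_nonneg (by positivity : (0 : ℝ) ≤ 1 / N * (1 / (m + N : ℕ)))]
    gcongr
    calc 1 / (N : ℝ) * (1 / (m + N : ℕ)) ≤ 2 / (m + N : ℕ) * (2 / (m + N : ℕ)) := by
          gcongr; norm_num
      _ = _ := by ring
  have hC'' : C' / (N : ℝ) ^ 2 ≤ C' * (4 / ((m + N : ℕ) : ℝ) ^ 2) := by
    rw [div_eq_mul_one_div]; gcongr
  calc |num / den - L / (m + N : ℕ)|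
      = |(num / den - L / N) + (L / N - L / (m + N : ℕ))| := by congr 1; ring
    _ ≤ C' / (N : ℝ) ^ 2 + (L0 / z) * m * (4 / ((m + N : ℕ) : ℝ) ^ 2) :=
        (abs_add_le _ _).trans (add_le_add hr hshift)
    _ ≤ C' * (4 / ((m + N : ℕ) : ℝ) ^ 2) + (L0 / z) * m * (4 / ((m + N : ℕ) : ℝ) ^ 2) := by
        gcongr
    _ = (4 * C' + 4 * m * (L0 / z)) / ((m + N : ℕ) : ℝ) ^ 2 := by ring
    _ ≤ _ := by
        refine div_le_div_of_nonneg_right ?_ (by positivity)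
        linarith

end LaplaceRatio

/-! ### Gaussian moments -/

section GaussianMoments

variable {k : ℕ}

/-- The quadratic form of a matrix. -/
def quadForm (V : Matrix (Fin k) (Fin k) ℝ) (φ : EuclideanSpace ℝ (Fin k)) : ℝ :=
  ∑ i, ∑ j, V i j * φ i * φ j

lemma continuous_quadForm (V : Matrix (Fin k) (Fin k) ℝ) : Continuous (quadForm V) := by
  unfold quadForm; fun_prop

lemma coord_proj_apply (i : Fin k) (v : EuclideanSpace ℝ (Fin k)) :
    (EuclideanSpace.proj i : EuclideanSpace ℝ (Fin k) →L[ℝ] ℝ) v = v i := rfl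

lemma hasFDerivAt_coord (i : Fin k) (φ : EuclideanSpace ℝ (Fin k)) :
    HasFDerivAt (fun φ : EuclideanSpace ℝ (Fin k) => φ i)
      (EuclideanSpace.proj i : EuclideanSpace ℝ (Fin k) →L[ℝ] ℝ) φ :=
  (EuclideanSpace.proj i : EuclideanSpace ℝ (Fin k) →L[ℝ] ℝ).hasFDerivAt

/-- The derivative of `exp (-q / 2)`. Only its values in given directions occur in the integration
by parts. -/
lemma hasFDerivAt_gaussian {V : Matrix (Fin k) (Fin k) ℝ} (hV : V.IsSymm)
    (φ : EuclideanSpace ℝ (Fin k)) :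
    ∃ L : EuclideanSpace ℝ (Fin k) →L[ℝ] ℝ,
      HasFDerivAt (fun φ => Real.exp (-(quadForm V φ / 2))) L φ ∧
      ∀ v, L v = -(∑ i, ∑ j, V i j * v i * φ j) * Real.exp (-(quadForm V φ / 2)) := by
  have h1 : HasFDerivAt (quadForm V) (∑ i, ∑ j, ((V i j * φ i) •
      (EuclideanSpace.proj j : EuclideanSpace ℝ (Fin k) →L[ℝ] ℝ) + φ j •
        (V i j • (EuclideanSpace.proj i : EuclideanSpace ℝ (Fin k) →L[ℝ] ℝ)))) φ := by
    unfold quadForm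
    refine HasFDerivAt.fun_sum fun i _ => HasFDerivAt.fun_sum fun j _ => ?_
    exact ((hasFDerivAt_coord i φ).const_mul (V i j)).mul (hasFDerivAt_coord j φ)
  have h2 := (((h1.const_mul (1 / 2)).neg).exp).congr_of_eventuallyEq
    (f₁ := fun φ => Real.exp (-(quadForm V φ / 2))) (Eventually.of_forall fun φ => by
      simp only [one_div]; congr 2; ring)
  refine ⟨_, h2, fun v => ?_⟩
  have hsym : ∑ i, ∑ j, V i j * φ i * v j = ∑ i, ∑ j, V i j * v i * φ j := by
    rw [Finset.sum_comm]
    refine Finset.sum_congr rfl fun i _ => Finset.sum_congr rfl fun j _ => ?_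
    rw [hV.apply]; ring
  have hd : (∑ i, ∑ j, ((V i j * φ i) •
      (EuclideanSpace.proj j : EuclideanSpace ℝ (Fin k) →L[ℝ] ℝ) + φ j •
        (V i j • (EuclideanSpace.proj i : EuclideanSpace ℝ (Fin k) →L[ℝ] ℝ)))) v =
      2 * ∑ i, ∑ j, V i j * v i * φ j := by
    simp only [_root_.sum_apply, _root_.add_apply,
      _root_.smul_apply, coord_proj_apply, smul_eq_mul,
      Finset.sum_add_distrib]
    rw [hsym, two_mul]
    congr 1
    refine Finset.sum_congr rfl fun i _ => Finset.sum_congr rfl fun j _ => ?_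
    ring
  simp only [_root_.smul_apply, _root_.neg_apply, hd, smul_eq_mul]
  rw [Pi.neg_apply, show -(1 / 2 * quadForm V φ) = -(quadForm V φ / 2) by ring]
  ring

lemma integrable_mul_gaussian {c : ℝ} (hc : 0 < c) {V : Matrix (Fin k) (Fin k) ℝ}
    (hlo : ∀ φ, c * ‖φ‖ ^ 2 ≤ quadForm V φ) {f : EuclideanSpace ℝ (Fin k) → ℝ}
    (hf : Continuous f) (p : ℕ) (C : ℝ) (hfC : ∀ φ, |f φ| ≤ C * (1 + ‖φ‖ ^ 2) ^ p) :
    Integrable (fun φ => f φ * Real.exp (-(quadForm V φ / 2))) := by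
  obtain ⟨M, hM, H⟩ := exists_pow_le_mul_exp p (b := c / 4) (by positivity)
  have hC : 0 ≤ |C| := abs_nonneg _
  refine ((integrable_exp_neg_mul_sq_norm (E := EuclideanSpace ℝ (Fin k)) (b := c / 4)
    (by positivity)).const_mul (|C| * M * Real.exp (c / 4))).mono' ?_ (ae_of_all _ fun φ => ?_)
  · have := continuous_quadForm V
    exact (by fun_prop : Continuous _).aestronglyMeasurable
  rw [norm_mul, Real.norm_eq_abs, Real.norm_of_nonneg (Real.exp_pos _).le]
  have h1 : |f φ| ≤ |C| * (M * Real.exp (c / 4 * (1 + ‖φ‖ ^ 2))) :=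
    (hfC φ).trans (by
      gcongr
      · exact le_abs_self C
      · exact H _ (by positivity))
  have h2 : Real.exp (-(quadForm V φ / 2)) ≤ Real.exp (-(c / 2) * ‖φ‖ ^ 2) := by
    gcongr; linarith [hlo φ]
  calc |f φ| * Real.exp (-(quadForm V φ / 2))
      ≤ |C| * (M * Real.exp (c / 4 * (1 + ‖φ‖ ^ 2))) * Real.exp (-(c / 2) * ‖φ‖ ^ 2) := by gcongr
    _ = |C| * M * (Real.exp (c / 4 * (1 + ‖φ‖ ^ 2)) * Real.exp (-(c / 2) * ‖φ‖ ^ 2)) := by ring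
    _ = |C| * M * Real.exp (c / 4) * Real.exp (-(c / 4) * ‖φ‖ ^ 2) := by
        rw [mul_assoc (|C| * M), ← Real.exp_add, ← Real.exp_add]; congr 2; ring

lemma abs_coord_le (φ : EuclideanSpace ℝ (Fin k)) (i : Fin k) : |φ i| ≤ ‖φ‖ := by
  rw [← Real.norm_eq_abs]; exact PiLp.norm_apply_le φ i

lemma abs_coord_le_one_add (φ : EuclideanSpace ℝ (Fin k)) (i : Fin k) :
    |φ i| ≤ 1 + ‖φ‖ ^ 2 := by
  have := abs_coord_le φ i
  nlinarith [sq_nonneg (‖φ‖ - 1)]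

/-- Gaussian integration by parts, in the direction `D eᵢ` with `D = V⁻¹`. -/
lemma integral_coord_mul_gaussian {V D : Matrix (Fin k) (Fin k) ℝ} (hV : V.IsSymm)
    (hVD : V * D = 1) {f : EuclideanSpace ℝ (Fin k) → ℝ} (i : Fin k)
    {f' : EuclideanSpace ℝ (Fin k) → EuclideanSpace ℝ (Fin k) →L[ℝ] ℝ}
    (hf : ∀ φ, HasFDerivAt f (f' φ) φ)
    (h1 : Integrable fun φ => f φ * Real.exp (-(quadForm V φ / 2)))
    (h2 : Integrable fun φ => f φ * φ i * Real.exp (-(quadForm V φ / 2)))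
    (h3 : Integrable fun φ => f' φ (WithLp.toLp 2 fun j => D j i) *
      Real.exp (-(quadForm V φ / 2))) :
    ∫ φ, f φ * φ i * Real.exp (-(quadForm V φ / 2)) =
      ∫ φ, f' φ (WithLp.toLp 2 fun j => D j i) * Real.exp (-(quadForm V φ / 2)) := by
  set v : EuclideanSpace ℝ (Fin k) := WithLp.toLp 2 fun j => D j i with hv
  have hG : ∀ φ, fderiv ℝ (fun φ => Real.exp (-(quadForm V φ / 2))) φ v =
      -(φ i * Real.exp (-(quadForm V φ / 2))) := by
    intro φ
    obtain ⟨L, hL, hLv⟩ := hasFDerivAt_gaussian hV φ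
    rw [hL.fderiv, hLv]
    have : ∑ a, ∑ b, V a b * v a * φ b = φ i := by
      rw [Finset.sum_comm]
      have : ∀ b, ∑ a, V a b * v a * φ b = (1 : Matrix (Fin k) (Fin k) ℝ) b i * φ b := by
        intro b
        rw [← hVD, Matrix.mul_apply, Finset.sum_mul]
        refine Finset.sum_congr rfl fun a _ => ?_
        rw [hV.apply]
      simp_rw [this, Matrix.one_apply]
      simp
    rw [this]; ring
  have hG' : Differentiable ℝ (fun φ => Real.exp (-(quadForm V φ / 2))) := fun φ =>
    (hasFDerivAt_gaussian hV φ).choose_spec.1.differentiableAt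
  have key := integral_mul_fderiv_eq_neg_fderiv_mul_of_integrable
    (μ := (volume : Measure (EuclideanSpace ℝ (Fin k)))) (f := f)
    (g := fun φ => Real.exp (-(quadForm V φ / 2))) (v := v)
    (by simp_rw [(hf _).fderiv]; exact h3)
    (by
      simp_rw [hG]
      refine h2.neg.congr (ae_of_all _ fun φ => ?_)
      simp only [Pi.neg_apply]; ring)
    h1 (fun φ _ => (hf φ).differentiableAt) (fun φ _ => hG' φ)
  simp_rw [hG, (hf _).fderiv, mul_neg, integral_neg] at key
  rw [neg_inj] at key
  rw [← key]
  simp_rw [mul_assoc]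

lemma integral_coord_mul_coord_gaussian {c : ℝ} (hc : 0 < c) {V D : Matrix (Fin k) (Fin k) ℝ}
    (hV : V.IsSymm) (hVD : V * D = 1) (hlo : ∀ φ, c * ‖φ‖ ^ 2 ≤ quadForm V φ) (i j : Fin k) :
    ∫ φ : EuclideanSpace ℝ (Fin k), φ i * φ j * Real.exp (-(quadForm V φ / 2)) =
      D i j * ∫ φ, Real.exp (-(quadForm V φ / 2)) := by
  rw [integral_coord_mul_gaussian hV hVD j (hasFDerivAt_coord i), ← integral_const_mul]
  · simp
  · exact integrable_mul_gaussian hc hlo (by fun_prop) 1 1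
      fun φ => by simpa using abs_coord_le_one_add φ i
  · refine integrable_mul_gaussian hc hlo (by fun_prop) 2 1 fun φ => ?_
    rw [abs_mul, one_mul, pow_two]
    exact mul_le_mul (abs_coord_le_one_add φ i) (abs_coord_le_one_add φ j) (abs_nonneg _)
      (by positivity)
  · exact integrable_mul_gaussian hc hlo (by fun_prop) 0 |D i j| fun φ => by simp

lemma integrable_four_coord_gaussian {c : ℝ} (hc : 0 < c) {V : Matrix (Fin k) (Fin k) ℝ}
    (hlo : ∀ φ, c * ‖φ‖ ^ 2 ≤ quadForm V φ) (i j p l : Fin k) :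
    Integrable fun φ : EuclideanSpace ℝ (Fin k) =>
      φ i * φ j * φ p * φ l * Real.exp (-(quadForm V φ / 2)) := by
  refine integrable_mul_gaussian hc hlo (by fun_prop) 4 1 fun φ => ?_
  have h := abs_coord_le_one_add φ
  have h0 : 0 ≤ 1 + ‖φ‖ ^ 2 := by positivity
  simp only [abs_mul, one_mul]
  calc |φ i| * |φ j| * |φ p| * |φ l|
      ≤ (1 + ‖φ‖ ^ 2) * (1 + ‖φ‖ ^ 2) * (1 + ‖φ‖ ^ 2) * (1 + ‖φ‖ ^ 2) := by
        gcongr <;> exact h _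
    _ = _ := by ring

lemma integrable_two_coord_gaussian {c : ℝ} (hc : 0 < c) {V : Matrix (Fin k) (Fin k) ℝ}
    (hlo : ∀ φ, c * ‖φ‖ ^ 2 ≤ quadForm V φ) (i j : Fin k) :
    Integrable fun φ : EuclideanSpace ℝ (Fin k) =>
      φ i * φ j * Real.exp (-(quadForm V φ / 2)) := by
  refine integrable_mul_gaussian hc hlo (by fun_prop) 2 1 fun φ => ?_
  rw [abs_mul, one_mul, pow_two]
  exact mul_le_mul (abs_coord_le_one_add φ i) (abs_coord_le_one_add φ j) (abs_nonneg _)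
    (by positivity)

/-- Isserlis' formula for fourth moments. -/
lemma integral_four_coord_gaussian {c : ℝ} (hc : 0 < c) {V D : Matrix (Fin k) (Fin k) ℝ}
    (hV : V.IsSymm) (hVD : V * D = 1) (hlo : ∀ φ, c * ‖φ‖ ^ 2 ≤ quadForm V φ) (i j p l : Fin k) :
    ∫ φ : EuclideanSpace ℝ (Fin k), φ i * φ j * φ p * φ l * Real.exp (-(quadForm V φ / 2)) =
      (D i l * D j p + D j l * D i p + D p l * D i j) *
        ∫ φ, Real.exp (-(quadForm V φ / 2)) := by
  have hd : ∀ φ : EuclideanSpace ℝ (Fin k), HasFDerivAt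
      (fun φ : EuclideanSpace ℝ (Fin k) => φ i * φ j * φ p)
      ((φ i * φ j) • (EuclideanSpace.proj p : EuclideanSpace ℝ (Fin k) →L[ℝ] ℝ) +
        φ p • (φ i • (EuclideanSpace.proj j : EuclideanSpace ℝ (Fin k) →L[ℝ] ℝ) +
          φ j • (EuclideanSpace.proj i : EuclideanSpace ℝ (Fin k) →L[ℝ] ℝ))) φ := fun φ =>
    ((hasFDerivAt_coord i φ).mul (hasFDerivAt_coord j φ)).mul (hasFDerivAt_coord p φ)
  have e : ∀ φ : EuclideanSpace ℝ (Fin k),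
      (((φ i * φ j) • (EuclideanSpace.proj p : EuclideanSpace ℝ (Fin k) →L[ℝ] ℝ) +
        φ p • (φ i • (EuclideanSpace.proj j : EuclideanSpace ℝ (Fin k) →L[ℝ] ℝ) +
          φ j • (EuclideanSpace.proj i : EuclideanSpace ℝ (Fin k) →L[ℝ] ℝ)))
          (WithLp.toLp 2 fun j => D j l)) * Real.exp (-(quadForm V φ / 2)) =
      D p l * (φ i * φ j * Real.exp (-(quadForm V φ / 2))) +
        D j l * (φ i * φ p * Real.exp (-(quadForm V φ / 2))) +
        D i l * (φ j * φ p * Real.exp (-(quadForm V φ / 2))) := by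
    intro φ
    simp only [_root_.add_apply, _root_.smul_apply,
      coord_proj_apply, smul_eq_mul]
    ring
  have i1 := (integrable_two_coord_gaussian hc hlo i j).const_mul (D p l)
  have i2 := (integrable_two_coord_gaussian hc hlo i p).const_mul (D j l)
  have i3 := (integrable_two_coord_gaussian hc hlo j p).const_mul (D i l)
  rw [integral_coord_mul_gaussian hV hVD l hd]
  · simp_rw [e]
    rw [integral_add (by exact i1.add i2) i3, integral_add i1 i2]
    simp only [integral_const_mul, integral_coord_mul_coord_gaussian hc hV hVD hlo]
    ring
  · refine integrable_mul_gaussian hc hlo (by fun_prop) 3 1 fun φ => ?_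
    have h := abs_coord_le_one_add φ
    have h0 : 0 ≤ 1 + ‖φ‖ ^ 2 := by positivity
    simp only [abs_mul, one_mul]
    calc |φ i| * |φ j| * |φ p|
        ≤ (1 + ‖φ‖ ^ 2) * (1 + ‖φ‖ ^ 2) * (1 + ‖φ‖ ^ 2) := by
          gcongr <;> exact h _
      _ = _ := by ring
  · exact integrable_four_coord_gaussian hc hlo i j p l
  · simp_rw [e]
    exact (i1.add i2).add i3

/-- The Gaussian average that gives the coefficient of `1/n`. -/
lemma integral_quadratic_add_linear_mul_cubic_gaussian {c : ℝ} (hc : 0 < c)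
    {V D : Matrix (Fin k) (Fin k) ℝ} (hV : V.IsSymm) (hVD : V * D = 1)
    (hlo : ∀ φ, c * ‖φ‖ ^ 2 ≤ quadForm V φ)
    (A : Fin k → Fin k → ℝ) (a : Fin k → ℝ) (κ : Fin k → Fin k → Fin k → ℝ)
    (hκ₁ : ∀ i j p, κ i j p = κ j i p) (hκ₂ : ∀ i j p, κ i j p = κ i p j) :
    ∫ φ : EuclideanSpace ℝ (Fin k), Real.exp (-(quadForm V φ / 2)) *
        (-(∑ i, ∑ j, A i j * φ i * φ j) / 2 +
          (∑ l, a l * φ l) * ((∑ i, ∑ j, ∑ p, κ i j p * φ i * φ j * φ p) / 6)) =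
      (-(∑ i, ∑ j, A i j * D i j) / 2 +
        (∑ l, a l * ∑ i, ∑ j, ∑ p, κ i j p * D i j * D p l) / 2) *
        ∫ φ, Real.exp (-(quadForm V φ / 2)) := by
  set Z := ∫ φ, Real.exp (-(quadForm V φ / 2)) with hZ
  have e : ∀ φ : EuclideanSpace ℝ (Fin k), Real.exp (-(quadForm V φ / 2)) *
        (-(∑ i, ∑ j, A i j * φ i * φ j) / 2 +
          (∑ l, a l * φ l) * ((∑ i, ∑ j, ∑ p, κ i j p * φ i * φ j * φ p) / 6)) =
      (∑ i, ∑ j, -A i j / 2 * (φ i * φ j * Real.exp (-(quadForm V φ / 2)))) +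
        ∑ l, ∑ i, ∑ j, ∑ p, a l * κ i j p / 6 *
          (φ i * φ j * φ p * φ l * Real.exp (-(quadForm V φ / 2))) := by
    intro φ
    rw [mul_add]
    congr 1
    · rw [neg_div, mul_neg, Finset.sum_div, Finset.mul_sum, ← Finset.sum_neg_distrib]
      refine Finset.sum_congr rfl fun i _ => ?_
      rw [Finset.sum_div, Finset.mul_sum, ← Finset.sum_neg_distrib]
      exact Finset.sum_congr rfl fun j _ => by ring
    · rw [Finset.sum_mul, Finset.mul_sum]
      refine Finset.sum_congr rfl fun l _ => ?_
      simp only [Finset.sum_div, Finset.mul_sum]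
      refine Finset.sum_congr rfl fun i _ => Finset.sum_congr rfl fun j _ =>
        Finset.sum_congr rfl fun p _ => ?_
      ring
  simp_rw [e]
  have i2 : ∀ i j, Integrable fun φ : EuclideanSpace ℝ (Fin k) =>
      -A i j / 2 * (φ i * φ j * Real.exp (-(quadForm V φ / 2))) := fun i j =>
    (integrable_two_coord_gaussian hc hlo i j).const_mul _
  have i4 : ∀ l i j p, Integrable fun φ : EuclideanSpace ℝ (Fin k) =>
      a l * κ i j p / 6 * (φ i * φ j * φ p * φ l * Real.exp (-(quadForm V φ / 2))) :=
    fun l i j p => (integrable_four_coord_gaussian hc hlo i j p l).const_mul _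
  rw [integral_add (integrable_finsetSum _ fun i _ => integrable_finsetSum _ fun j _ => i2 i j)
    (integrable_finsetSum _ fun l _ => integrable_finsetSum _ fun i _ =>
      integrable_finsetSum _ fun j _ => integrable_finsetSum _ fun p _ => i4 l i j p)]
  rw [integral_finsetSum _ fun i _ => integrable_finsetSum _ fun j _ => i2 i j,
    integral_finsetSum _ fun l _ => integrable_finsetSum _ fun i _ =>
      integrable_finsetSum _ fun j _ => integrable_finsetSum _ fun p _ => i4 l i j p]
  rw [add_mul]
  congr 1
  · rw [neg_div, neg_mul, Finset.sum_div, Finset.sum_mul, ← Finset.sum_neg_distrib]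
    refine Finset.sum_congr rfl fun i _ => ?_
    rw [integral_finsetSum _ fun j _ => i2 i j, Finset.sum_div, Finset.sum_mul,
      ← Finset.sum_neg_distrib]
    refine Finset.sum_congr rfl fun j _ => ?_
    rw [integral_const_mul, integral_coord_mul_coord_gaussian hc hV hVD hlo]
    ring
  · rw [Finset.sum_div, Finset.sum_mul]
    refine Finset.sum_congr rfl fun l _ => ?_
    rw [integral_finsetSum _ fun i _ => integrable_finsetSum _ fun j _ =>
      integrable_finsetSum _ fun p _ => i4 l i j p]
    simp_rw [fun i => integral_finsetSum Finset.univ fun j (_ : j ∈ Finset.univ) =>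
      integrable_finsetSum Finset.univ fun p (_ : p ∈ Finset.univ) => i4 l i j p,
      fun i j => integral_finsetSum Finset.univ fun p (_ : p ∈ Finset.univ) => i4 l i j p,
      integral_const_mul, integral_four_coord_gaussian hc hV hVD hlo]
    -- the three pairings of Isserlis' formula contribute equally since `κ` is symmetric
    have p1 : ∑ i, ∑ j, ∑ p, κ i j p * (D i l * D j p) =
        ∑ i, ∑ j, ∑ p, κ i j p * D i j * D p l := by
      rw [Finset.sum_comm]
      have : ∀ j, ∑ i, ∑ p, κ i j p * (D i l * D j p) =
          ∑ p, ∑ i, κ i j p * (D i l * D j p) := fun j => Finset.sum_comm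
      simp_rw [this]
      refine Finset.sum_congr rfl fun i _ => Finset.sum_congr rfl fun j _ =>
        Finset.sum_congr rfl fun p _ => ?_
      rw [hκ₁ p i j, hκ₂ i p j]; ring
    have p2 : ∑ i, ∑ j, ∑ p, κ i j p * (D j l * D i p) =
        ∑ i, ∑ j, ∑ p, κ i j p * D i j * D p l := by
      refine Finset.sum_congr rfl fun i _ => ?_
      rw [Finset.sum_comm]
      refine Finset.sum_congr rfl fun j _ => Finset.sum_congr rfl fun p _ => ?_
      rw [hκ₂ i p j]; ring
    have p3 : ∑ i, ∑ j, ∑ p, κ i j p * (D p l * D i j) = ∑ i, ∑ j, ∑ p, κ i j p * D i j * D p l :=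
      Finset.sum_congr rfl fun i _ => Finset.sum_congr rfl fun j _ =>
        Finset.sum_congr rfl fun p _ => by ring
    have : ∑ i, ∑ j, ∑ p, a l * κ i j p / 6 *
        ((D i l * D j p + D j l * D i p + D p l * D i j) * Z) =
        a l / 6 * Z * ((∑ i, ∑ j, ∑ p, κ i j p * (D i l * D j p)) +
          (∑ i, ∑ j, ∑ p, κ i j p * (D j l * D i p)) +
          ∑ i, ∑ j, ∑ p, κ i j p * (D p l * D i j)) := by
      simp only [← Finset.sum_add_distrib, Finset.mul_sum]
      refine Finset.sum_congr rfl fun i _ => Finset.sum_congr rfl fun j _ =>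
        Finset.sum_congr rfl fun p _ => ?_
      ring
    rw [this, p1, p2, p3]
    ring

lemma abs_quadForm_le {W : Matrix (Fin k) (Fin k) ℝ} {ε : ℝ} (hW : ∀ i j, |W i j| ≤ ε)
    (φ : EuclideanSpace ℝ (Fin k)) : |quadForm W φ| ≤ ε * k ^ 2 * ‖φ‖ ^ 2 := by
  refine (Finset.abs_sum_le_sum_abs _ _).trans ?_
  have h1 : ∀ i, |∑ j, W i j * φ i * φ j| ≤ k * (ε * ‖φ‖ ^ 2) := by
    intro i
    refine (Finset.abs_sum_le_sum_abs _ _).trans ?_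
    have h2 : ∀ j ∈ (Finset.univ : Finset (Fin k)), |W i j * φ i * φ j| ≤ ε * ‖φ‖ ^ 2 := by
      intro j _
      rw [abs_mul, abs_mul, mul_assoc, pow_two]
      have := (abs_nonneg _).trans (hW i j)
      gcongr
      · exact hW i j
      · exact abs_coord_le φ i
      · exact abs_coord_le φ j
    refine (Finset.sum_le_sum h2).trans (by simp)
  refine (Finset.sum_le_sum fun i _ => h1 i).trans (le_of_eq ?_)
  simp; ring

lemma quadForm_smul (W : Matrix (Fin k) (Fin k) ℝ) (x : ℝ) (φ : EuclideanSpace ℝ (Fin k)) :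
    quadForm W (x • φ) = x ^ 2 * quadForm W φ := by
  simp only [quadForm, Finset.mul_sum, PiLp.smul_apply, smul_eq_mul]
  exact Finset.sum_congr rfl fun i _ => Finset.sum_congr rfl fun j _ => by ring

lemma exists_le_quadForm {W : Matrix (Fin k) (Fin k) ℝ}
    (hW : ∀ φ, φ ≠ 0 → 0 < quadForm W φ) :
    ∃ c : ℝ, 0 < c ∧ ∀ φ, c * ‖φ‖ ^ 2 ≤ quadForm W φ := by
  obtain ⟨c, hc, h⟩ : ∃ c : ℝ, 0 < c ∧ ∀ φ ∈ Metric.sphere (0 : EuclideanSpace ℝ (Fin k)) 1,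
      c ≤ quadForm W φ := by
    rcases (Metric.sphere (0 : EuclideanSpace ℝ (Fin k)) 1).eq_empty_or_nonempty with he | hne
    · exact ⟨1, one_pos, by simp [he]⟩
    · obtain ⟨φ₁, h1, h2⟩ := (isCompact_sphere _ _).exists_isMinOn hne
        (continuous_quadForm W).continuousOn
      refine ⟨_, hW φ₁ ?_, fun φ hφ => h2 hφ⟩
      rintro rfl
      simp at h1
  refine ⟨c, hc, fun φ => ?_⟩
  by_cases hφ : φ = 0
  · simp [hφ, quadForm]
  · have hn := norm_pos_iff.2 hφ
    have h1 := h (‖φ‖⁻¹ • φ) (by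
      rw [mem_sphere_zero_iff_norm, norm_smul, norm_inv, norm_norm, inv_mul_cancel₀ hn.ne'])
    rw [quadForm_smul, inv_pow, ← div_eq_inv_mul, le_div_iff₀ (by positivity)] at h1
    exact h1

end GaussianMoments

/-! ### The laws of the family as tilted measures -/

section ProductDensity

lemma lintegral_pi_prod {X : Type*} [MeasurableSpace X] (μ : Measure X) [SigmaFinite μ] {n : ℕ}
    (f : Fin n → X → ENNReal) (hf : ∀ i, Measurable (f i)) :
    ∫⁻ x, ∏ i, f i (x i) ∂(Measure.pi fun _ : Fin n => μ) = ∏ i, ∫⁻ x, f i x ∂μ := by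
  induction n with
  | zero => simp
  | succ n ih =>
    have h := measurePreserving_piFinSuccAbove (fun _ : Fin (n + 1) => μ) 0
    rw [← (h.symm _).lintegral_comp_emb (MeasurableEquiv.measurableEmbedding _)]
    simp_rw [MeasurableEquiv.piFinSuccAbove_symm_apply, Fin.insertNthEquiv,
      Fin.prod_univ_succ, Fin.insertNth_zero]
    simp only [Equiv.coe_fn_mk, Fin.cons_zero, Fin.cons_succ, cast_eq]
    rw [lintegral_prod_mul (f := f 0) (g := fun y : Fin n → X => ∏ i, f i.succ (y i))
      (hf 0).aemeasurable
      (Finset.measurable_prod _ fun i _ => (hf i.succ).comp (measurable_pi_apply i)).aemeasurable,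
      ih _ fun i => hf i.succ]

lemma pi_withDensity {X : Type*} [MeasurableSpace X] (μ : Measure X) [SigmaFinite μ] (n : ℕ)
    (f : X → ENNReal) (hf : Measurable f) [SigmaFinite (μ.withDensity f)] :
    Measure.pi (fun _ : Fin n => μ.withDensity f) =
      (Measure.pi fun _ : Fin n => μ).withDensity fun x => ∏ i, f (x i) := by
  refine Measure.pi_eq fun s hs => ?_
  rw [withDensity_apply _ (MeasurableSet.univ_pi hs),
    ← lintegral_indicator (MeasurableSet.univ_pi hs)]
  have : ∀ x : Fin n → X, (Set.univ.pi s).indicator (fun x => ∏ i, f (x i)) x =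
      ∏ i, (s i).indicator f (x i) := by
    intro x
    by_cases hx : x ∈ Set.univ.pi s
    · rw [Set.indicator_of_mem hx]
      exact Finset.prod_congr rfl fun i _ => (Set.indicator_of_mem (hx i trivial) f).symm
    · rw [Set.indicator_of_notMem hx]
      simp only [Set.mem_univ_pi, not_forall] at hx
      obtain ⟨i, hi⟩ := hx
      exact (Finset.prod_eq_zero (Finset.mem_univ i) (Set.indicator_of_notMem hi f)).symm
  simp_rw [this]
  rw [lintegral_pi_prod μ _ fun i => hf.indicator (hs i)]
  refine Finset.prod_congr rfl fun i _ => ?_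
  rw [withDensity_apply _ (hs i), lintegral_indicator (hs i)]

end ProductDensity

namespace ExpFamily

variable {Ω : Type*} [MeasurableSpace Ω] {k : ℕ} (F : ExpFamily Ω k)

/-- The carrier measure `c dν`. -/
def base₁ : Measure Ω := F.ν.withDensity fun x => ENNReal.ofReal (F.c x)

/-- The `n`-fold product of the carrier measure. -/
def base (n : ℕ) : Measure (Fin n → Ω) := Measure.pi fun _ => F.base₁

instance sigmaFinite_base₁ : SigmaFinite F.base₁ := by
  have := F.sigmaFinite
  exact SigmaFinite.withDensity_ofReal _

lemma measurable_stat (n : ℕ) : Measurable (F.stat n) :=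
  Finset.measurable_sum _ fun i _ => F.measurable_T.comp (measurable_pi_apply i)

lemma law₁_eq (θ : EuclideanSpace ℝ (Fin k)) :
    F.law₁ θ = F.base₁.withDensity fun x => ENNReal.ofReal (Real.exp (⟪θ, F.T x⟫ - F.kappa θ)) := by
  have h1 : Measurable fun x => ENNReal.ofReal (F.c x) := F.measurable_c.ennreal_ofReal
  have hT := F.measurable_T
  have h2 : Measurable fun x => ENNReal.ofReal (Real.exp (⟪θ, F.T x⟫ - F.kappa θ)) := by fun_prop
  rw [base₁, ← withDensity_mul _ h1 h2]
  unfold law₁ density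
  congr 1; ext x
  rw [ENNReal.ofReal_mul (F.c_nonneg x)]; rfl

instance sigmaFinite_law₁ (θ : EuclideanSpace ℝ (Fin k)) : SigmaFinite (F.law₁ θ) := by
  have := F.sigmaFinite
  exact SigmaFinite.withDensity_ofReal _

lemma law_eq (n : ℕ) (θ : EuclideanSpace ℝ (Fin k)) :
    F.law n θ = (F.base n).withDensity fun x =>
      ENNReal.ofReal (Real.exp (⟪θ, F.stat n x⟫ - n * F.kappa θ)) := by
  have hT := F.measurable_T
  have := F.sigmaFinite_law₁ θ
  rw [law₁_eq] at this
  unfold law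
  rw [law₁_eq, pi_withDensity _ _ _ (by fun_prop)]
  unfold base
  congr 1; ext x
  rw [← ENNReal.ofReal_prod_of_nonneg fun i _ => (Real.exp_pos _).le, ← Real.exp_sum]
  congr 2
  simp [stat, inner_sum, Finset.sum_sub_distrib]

lemma integrable_law_iff {n : ℕ} {θ : EuclideanSpace ℝ (Fin k)} {J : (Fin n → Ω) → ℝ} :
    Integrable J (F.law n θ) ↔
      Integrable (fun x => J x * Real.exp ⟪θ, F.stat n x⟫) (F.base n) := by
  have hS := F.measurable_stat n
  rw [law_eq, integrable_withDensity_iff_integrable_smul' (by fun_prop)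
    (ae_of_all _ fun _ => ENNReal.ofReal_lt_top)]
  have : (fun x => (ENNReal.ofReal (Real.exp (⟪θ, F.stat n x⟫ - n * F.kappa θ))).toReal • J x) =
      fun x => Real.exp (-(n * F.kappa θ)) * (J x * Real.exp ⟪θ, F.stat n x⟫) := by
    ext x
    rw [ENNReal.toReal_ofReal (Real.exp_pos _).le, sub_eq_neg_add, Real.exp_add, smul_eq_mul]
    ring
  rw [this, integrable_const_mul_iff (IsUnit.mk0 _ (Real.exp_pos _).ne')]

lemma integral_law {G : Type*} [NormedAddCommGroup G] [NormedSpace ℝ G] (n : ℕ)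
    (θ : EuclideanSpace ℝ (Fin k)) (J : (Fin n → Ω) → G) :
    ∫ x, J x ∂F.law n θ =
      ∫ x, Real.exp (⟪θ, F.stat n x⟫ - n * F.kappa θ) • J x ∂F.base n := by
  have hS := F.measurable_stat n
  rw [law_eq, integral_withDensity_eq_integral_toReal_smul (by fun_prop)
    (ae_of_all _ fun _ => ENNReal.ofReal_lt_top)]
  congr 1; ext x
  rw [ENNReal.toReal_ofReal (Real.exp_pos _).le]

lemma integrable_law₁_iff {θ : EuclideanSpace ℝ (Fin k)} {f : Ω → ℝ} :
    Integrable f (F.law₁ θ) ↔ Integrable (fun x => f x * Real.exp ⟪θ, F.T x⟫) F.base₁ := by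
  have hS := F.measurable_T
  rw [law₁_eq, integrable_withDensity_iff_integrable_smul' (by fun_prop)
    (ae_of_all _ fun _ => ENNReal.ofReal_lt_top)]
  have : (fun x => (ENNReal.ofReal (Real.exp (⟪θ, F.T x⟫ - F.kappa θ))).toReal • f x) =
      fun x => Real.exp (-F.kappa θ) * (f x * Real.exp ⟪θ, F.T x⟫) := by
    ext x
    rw [ENNReal.toReal_ofReal (Real.exp_pos _).le, sub_eq_neg_add, Real.exp_add, smul_eq_mul]
    ring
  rw [this, integrable_const_mul_iff (IsUnit.mk0 _ (Real.exp_pos _).ne')]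

lemma integral_law₁ {G : Type*} [NormedAddCommGroup G] [NormedSpace ℝ G]
    (θ : EuclideanSpace ℝ (Fin k)) (f : Ω → G) :
    ∫ x, f x ∂F.law₁ θ = ∫ x, Real.exp (⟪θ, F.T x⟫ - F.kappa θ) • f x ∂F.base₁ := by
  have hS := F.measurable_T
  rw [law₁_eq, integral_withDensity_eq_integral_toReal_smul (by fun_prop)
    (ae_of_all _ fun _ => ENNReal.ofReal_lt_top)]
  congr 1; ext x
  rw [ENNReal.toReal_ofReal (Real.exp_pos _).le]

lemma partition_eq (θ : EuclideanSpace ℝ (Fin k)) :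
    F.partition θ = ∫ x, Real.exp ⟪θ, F.T x⟫ ∂F.base₁ := by
  rw [base₁, integral_withDensity_eq_integral_toReal_smul F.measurable_c.ennreal_ofReal
    (ae_of_all _ fun _ => ENNReal.ofReal_lt_top)]
  unfold partition
  congr 1; ext x
  rw [ENNReal.toReal_ofReal (F.c_nonneg x), smul_eq_mul]

lemma integrable_exp_base₁ {θ : EuclideanSpace ℝ (Fin k)} (hθ : θ ∈ F.paramSpace) :
    Integrable (fun x => Real.exp ⟪θ, F.T x⟫) F.base₁ := by
  rw [base₁, integrable_withDensity_iff_integrable_smul' F.measurable_c.ennreal_ofReal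
    (ae_of_all _ fun _ => ENNReal.ofReal_lt_top)]
  refine hθ.1.congr (ae_of_all _ fun x => ?_)
  simp only
  rw [ENNReal.toReal_ofReal (F.c_nonneg x), smul_eq_mul]

lemma isProbabilityMeasure_law₁ {θ : EuclideanSpace ℝ (Fin k)} (hθ : θ ∈ F.paramSpace) :
    IsProbabilityMeasure (F.law₁ θ) := by
  have h1 : ∫ x, Real.exp (⟪θ, F.T x⟫ - F.kappa θ) ∂F.base₁ = 1 := by
    simp_rw [Real.exp_sub, integral_div, ← partition_eq]
    rw [kappa, Real.exp_log hθ.2, div_self hθ.2.ne']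
  have h2 : Integrable (fun x => Real.exp (⟪θ, F.T x⟫ - F.kappa θ)) F.base₁ := by
    simp_rw [Real.exp_sub]
    exact (F.integrable_exp_base₁ hθ).div_const _
  constructor
  rw [law₁_eq, withDensity_apply _ MeasurableSet.univ, Measure.restrict_univ,
    ← ofReal_integral_eq_lintegral_ofReal h2 (ae_of_all _ fun _ => (Real.exp_pos _).le), h1,
    ENNReal.ofReal_one]

lemma isProbabilityMeasure_law {θ : EuclideanSpace ℝ (Fin k)} (hθ : θ ∈ F.paramSpace) (n : ℕ) :
    IsProbabilityMeasure (F.law n θ) := by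
  have := F.isProbabilityMeasure_law₁ hθ
  unfold law; infer_instance

/-- Any two members of the family differ by a density which is a function of the sufficient
statistic. -/
lemma law_eq_withDensity_law (n : ℕ) (θ θ' : EuclideanSpace ℝ (Fin k)) :
    F.law n θ' = (F.law n θ).withDensity fun x => ENNReal.ofReal
      (Real.exp (⟪θ' - θ, F.stat n x⟫ - n * (F.kappa θ' - F.kappa θ))) := by
  have hS := F.measurable_stat n
  rw [law_eq, law_eq, ← withDensity_mul _ (by fun_prop) (by fun_prop)]
  congr 1; ext x
  rw [Pi.mul_apply, ← ENNReal.ofReal_mul (Real.exp_pos _).le, ← Real.exp_add]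
  congr 2
  rw [inner_sub_left]; ring

lemma law_absolutelyContinuous (n : ℕ) (θ θ' : EuclideanSpace ℝ (Fin k)) :
    F.law n θ' ≪ F.law n θ := by
  rw [F.law_eq_withDensity_law n θ θ']
  exact withDensity_absolutelyContinuous _ _

end ExpFamily

/-! ### Differentiation of exponential integrals -/

section ExponentialIntegrals

variable {k : ℕ} {X : Type*} [MeasurableSpace X]

/-- `‖v‖` is exponentially dominated by the coordinates of `v`. -/
lemma exp_mul_norm_le {ε : ℝ} (hε : 0 ≤ ε) (v : EuclideanSpace ℝ (Fin k)) :
    Real.exp (ε * ‖v‖) ≤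
      1 + ∑ i, (Real.exp (ε * k * v i) + Real.exp (-(ε * k * v i))) := by
  have hnn : ∀ i ∈ (Finset.univ : Finset (Fin k)),
      0 ≤ Real.exp (ε * k * v i) + Real.exp (-(ε * k * v i)) := fun i _ => by positivity
  rcases isEmpty_or_nonempty (Fin k) with hk | hk
  · have : v = 0 := Subsingleton.elim _ _
    simp [this]
  obtain ⟨i, -, hi⟩ := Finset.exists_max_image (Finset.univ : Finset (Fin k)) (fun i => |v i|)
    Finset.univ_nonempty
  have h1 : ‖v‖ ≤ k * |v i| := by
    have : ‖v‖ ≤ ∑ j, |v j| := by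
      rw [EuclideanSpace.norm_eq, Real.sqrt_le_left (Finset.sum_nonneg fun _ _ => abs_nonneg _)]
      simp only [Real.norm_eq_abs]
      exact Finset.sum_sq_le_sq_sum_of_nonneg fun _ _ => abs_nonneg _
    refine this.trans ?_
    calc ∑ j, |v j| ≤ ∑ j : Fin k, |v i| := Finset.sum_le_sum fun j _ => hi j (Finset.mem_univ j)
      _ = k * |v i| := by simp
  have h2 : Real.exp (ε * ‖v‖) ≤ Real.exp (ε * k * v i) + Real.exp (-(ε * k * v i)) := by
    have h3 : ε * ‖v‖ ≤ |ε * k * v i| := by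
      rw [abs_mul, abs_of_nonneg (by positivity : (0 : ℝ) ≤ ε * k), mul_assoc]
      gcongr
    refine (Real.exp_le_exp.2 h3).trans ?_
    exact Real.exp_abs_le _
  have h3 := Finset.single_le_sum hnn (Finset.mem_univ i)
  linarith

/-- The functions `g` with `∫ |g| exp ⟪θ, S⟫ dρ < ∞` for all `θ ∈ U`. -/
structure ExpIntegrable (ρ : Measure X) (S : X → EuclideanSpace ℝ (Fin k))
    (U : Set (EuclideanSpace ℝ (Fin k))) (g : X → ℝ) : Prop where
  measurable : Measurable g
  integrable : ∀ θ ∈ U, Integrable (fun x => g x * Real.exp ⟪θ, S x⟫) ρ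

/-- The Laplace transform of `g dρ` along `S`. -/
def laplace (ρ : Measure X) (S : X → EuclideanSpace ℝ (Fin k)) (g : X → ℝ)
    (θ : EuclideanSpace ℝ (Fin k)) : ℝ :=
  ∫ x, g x * Real.exp ⟪θ, S x⟫ ∂ρ

variable {ρ : Measure X} {S : X → EuclideanSpace ℝ (Fin k)} {U : Set (EuclideanSpace ℝ (Fin k))}
  {g : X → ℝ}

/-- On an open set of parameters the integrability of `g exp ⟪θ, S⟫` leaves room for a factor
`exp (ε ‖S‖)`. -/
lemma ExpIntegrable.exists_exp_norm (hS : Measurable S) (hU : IsOpen U)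
    (hg : ExpIntegrable ρ S U g) {θ : EuclideanSpace ℝ (Fin k)} (hθ : θ ∈ U) :
    ∃ ε : ℝ, 0 < ε ∧
      Integrable (fun x => |g x| * Real.exp (⟪θ, S x⟫ + ε * ‖S x‖)) ρ := by
  obtain ⟨δ, hδ, hball⟩ := Metric.isOpen_iff.1 hU θ hθ
  set ε := δ / (k + 1) with hε
  have hεpos : 0 < ε := by positivity
  have hεk : ε * k < δ := by
    rw [hε, div_mul_eq_mul_div, div_lt_iff₀ (by positivity)]
    nlinarith
  have hm := hg.measurable
  have hmem : ∀ (i : Fin k) (s : ℝ), |s| = 1 →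
      Integrable (fun x => |g x| * Real.exp (⟪θ, S x⟫ + s * (ε * k * S x i))) ρ := by
    intro i s hs
    have hin : θ + (s * (ε * k)) • EuclideanSpace.single i (1 : ℝ) ∈ U := by
      apply hball
      rw [mem_ball_iff_norm, add_sub_cancel_left, norm_smul, PiLp.norm_single,
        Real.norm_eq_abs, abs_mul, hs, abs_of_nonneg (by positivity)]
      simpa using hεk
    refine (hg.integrable _ hin).abs.congr (ae_of_all _ fun x => ?_)
    simp only
    rw [abs_mul, abs_of_pos (Real.exp_pos _), inner_add_left, real_inner_smul_left,
      EuclideanSpace.inner_single_left]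
    simp [mul_assoc]
  refine ⟨ε, hεpos, ?_⟩
  have hbase := (hg.integrable θ hθ).abs
  refine (hbase.add (integrable_finsetSum Finset.univ fun i _ =>
    ((hmem i 1 (by simp)).add (hmem i (-1) (by simp))))).mono' (by fun_prop)
    (ae_of_all _ fun x => ?_)
  rw [Real.norm_of_nonneg (by positivity), Real.exp_add]
  simp only [Pi.add_apply, abs_mul, abs_of_pos (Real.exp_pos _), Real.exp_add, ← mul_add]
  rw [← Finset.mul_sum, ← Finset.mul_sum]
  have := exp_mul_norm_le hεpos.le (S x)
  have h0 : 0 ≤ |g x| * Real.exp ⟪θ, S x⟫ := by positivity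
  calc |g x| * (Real.exp ⟪θ, S x⟫ * Real.exp (ε * ‖S x‖))
      = |g x| * Real.exp ⟪θ, S x⟫ * Real.exp (ε * ‖S x‖) := by ring
    _ ≤ |g x| * Real.exp ⟪θ, S x⟫ *
        (1 + ∑ i, (Real.exp (ε * k * S x i) + Real.exp (-(ε * k * S x i)))) := by gcongr
    _ = _ := by simp only [one_mul, neg_mul]; ring

lemma pow_le_exp_mul {ε : ℝ} (hε : 0 < ε) (p : ℕ) :
    ∃ M : ℝ, 0 < M ∧ ∀ x : ℝ, 0 ≤ x → (1 + x) ^ p ≤ M * Real.exp (ε * x) := by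
  obtain ⟨M, hM, H⟩ := exists_pow_le_mul_exp p hε
  refine ⟨M * Real.exp ε, by positivity, fun x hx => (H _ (by positivity)).trans (le_of_eq ?_)⟩
  rw [mul_assoc, ← Real.exp_add]; congr 2; ring

lemma ExpIntegrable.mul_of_le (hS : Measurable S) (hU : IsOpen U)
    (hg : ExpIntegrable ρ S U g) {h : X → ℝ} (hh : Measurable h) (C : ℝ) (p : ℕ)
    (hle : ∀ x, |h x| ≤ C * (1 + ‖S x‖) ^ p) : ExpIntegrable ρ S U fun x => g x * h x := by
  have hm := hg.measurable
  refine ⟨by fun_prop, fun θ hθ => ?_⟩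
  obtain ⟨ε, hε, hint⟩ := hg.exists_exp_norm hS hU hθ
  obtain ⟨M, hM, H⟩ := pow_le_exp_mul hε p
  refine (hint.const_mul (|C| * M)).mono' (by fun_prop) (ae_of_all _ fun x => ?_)
  rw [Real.norm_eq_abs, abs_mul, abs_mul, abs_of_pos (Real.exp_pos _)]
  have h1 : |h x| ≤ |C| * (M * Real.exp (ε * ‖S x‖)) :=
    (hle x).trans (by
      gcongr
      · exact le_abs_self C
      · exact H _ (norm_nonneg _))
  calc |g x| * |h x| * Real.exp ⟪θ, S x⟫
      ≤ |g x| * (|C| * (M * Real.exp (ε * ‖S x‖))) * Real.exp ⟪θ, S x⟫ := by gcongr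
    _ = |C| * M * (|g x| * Real.exp (⟪θ, S x⟫ + ε * ‖S x‖)) := by rw [Real.exp_add]; ring

lemma ExpIntegrable.of_le (hg : ExpIntegrable ρ S U g) (hS : Measurable S) {h : X → ℝ}
    (hh : Measurable h) (hle : ∀ᵐ x ∂ρ, |h x| ≤ g x) : ExpIntegrable ρ S U h := by
  refine ⟨hh, fun θ hθ => (hg.integrable θ hθ).mono' (by fun_prop) ?_⟩
  filter_upwards [hle] with x hx
  rw [Real.norm_eq_abs, abs_mul, abs_of_pos (Real.exp_pos _)]
  gcongr

lemma ExpIntegrable.mul_coord (hS : Measurable S) (hU : IsOpen U) (hg : ExpIntegrable ρ S U g)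
    (i : Fin k) : ExpIntegrable ρ S U fun x => g x * S x i :=
  hg.mul_of_le hS hU (by fun_prop) 1 1 fun x => by
    have := abs_coord_le (S x) i
    simp only [one_mul, pow_one]; linarith

/-- Differentiation under the integral sign. -/
lemma ExpIntegrable.hasFDerivAt (hS : Measurable S) (hU : IsOpen U)
    (hg : ExpIntegrable ρ S U g) {θ : EuclideanSpace ℝ (Fin k)} (hθ : θ ∈ U) :
    HasFDerivAt (laplace ρ S g)
      (∑ i, laplace ρ S (fun x => g x * S x i) θ •
        (EuclideanSpace.proj i : EuclideanSpace ℝ (Fin k) →L[ℝ] ℝ)) θ := by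
  obtain ⟨ε, hε, hint⟩ := hg.exists_exp_norm hS hU hθ
  obtain ⟨M, hM, H⟩ := pow_le_exp_mul (half_pos hε) 1
  have hm := hg.measurable
  set F' : EuclideanSpace ℝ (Fin k) → X → (EuclideanSpace ℝ (Fin k) →L[ℝ] ℝ) :=
    fun θ' x => (g x * Real.exp ⟪θ', S x⟫) • innerSL ℝ (S x) with hF'
  have hinner : Measurable fun x => innerSL ℝ (S x) :=
    (innerSL ℝ : EuclideanSpace ℝ (Fin k) →L[ℝ] _).continuous.measurable.comp hS
  have hbound : ∀ x, ∀ θ' ∈ Metric.ball θ (ε / 2),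
      ‖F' θ' x‖ ≤ M * (|g x| * Real.exp (⟪θ, S x⟫ + ε * ‖S x‖)) := by
    intro x θ' hθ'
    rw [hF', norm_smul, innerSL_apply_norm, Real.norm_eq_abs, abs_mul,
      abs_of_pos (Real.exp_pos _)]
    have h1 : ⟪θ', S x⟫ ≤ ⟪θ, S x⟫ + ε / 2 * ‖S x‖ := by
      have h2 : ⟪θ', S x⟫ = ⟪θ, S x⟫ + ⟪θ' - θ, S x⟫ := by rw [inner_sub_left]; ring
      rw [h2]
      have h3 := real_inner_le_norm (θ' - θ) (S x)
      have h4 : ‖θ' - θ‖ * ‖S x‖ ≤ ε / 2 * ‖S x‖ := by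
        gcongr; exact (mem_ball_iff_norm.1 hθ').le
      linarith
    have h5 : ‖S x‖ ≤ M * Real.exp (ε / 2 * ‖S x‖) := by
      have := H _ (norm_nonneg (S x))
      rw [pow_one] at this; linarith
    calc |g x| * Real.exp ⟪θ', S x⟫ * ‖S x‖
        ≤ |g x| * Real.exp (⟪θ, S x⟫ + ε / 2 * ‖S x‖) * (M * Real.exp (ε / 2 * ‖S x‖)) := by gcongr
      _ = M * (|g x| * (Real.exp (⟪θ, S x⟫ + ε / 2 * ‖S x‖) * Real.exp (ε / 2 * ‖S x‖))) := by ring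
      _ = M * (|g x| * Real.exp (⟪θ, S x⟫ + ε * ‖S x‖)) := by
          rw [← Real.exp_add]; congr 3; ring
  have hF'int : Integrable (F' θ) ρ :=
    (hint.const_mul M).mono' (by
      rw [hF']
      exact ((hm.mul (by fun_prop)).smul hinner).aestronglyMeasurable)
      (ae_of_all _ fun x => hbound x θ (Metric.mem_ball_self (half_pos hε)))
  have key := hasFDerivAt_integral_of_dominated_of_fderiv_le (𝕜 := ℝ) (μ := ρ)
    (F := fun θ x => g x * Real.exp ⟪θ, S x⟫) (F' := F') (x₀ := θ)
    (s := Metric.ball θ (ε / 2)) (bound := fun x => M * (|g x| * Real.exp (⟪θ, S x⟫ + ε * ‖S x‖)))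
    (Metric.ball_mem_nhds _ (half_pos hε))
    (Eventually.of_forall fun θ' => (by fun_prop : Measurable _).aestronglyMeasurable)
    (hg.integrable θ hθ) hF'int.1
    (ae_of_all _ hbound) (hint.const_mul M)
    (ae_of_all _ fun x θ' _ => by
      have h1 : HasFDerivAt (fun θ' : EuclideanSpace ℝ (Fin k) => ⟪θ', S x⟫)
          (innerSL ℝ (S x)) θ' := by
        have := (innerSL ℝ (S x)).hasFDerivAt (x := θ')
        refine this.congr_of_eventuallyEq (Eventually.of_forall fun y => ?_)
        simp [real_inner_comm]
      have h2 := (h1.exp).const_mul (g x)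
      rwa [smul_smul] at h2)
  refine key.congr_fderiv (ContinuousLinearMap.ext fun v => ?_)
  symm
  rw [ContinuousLinearMap.integral_apply hF'int]
  simp only [_root_.sum_apply, _root_.smul_apply, coord_proj_apply, smul_eq_mul, hF',
    innerSL_apply_apply]
  unfold laplace
  simp_rw [← integral_mul_const]
  rw [← integral_finsetSum]
  · congr 1; ext x
    rw [PiLp.inner_apply (S x) v, Finset.mul_sum]
    refine Finset.sum_congr rfl fun i _ => ?_
    simp; ring
  · intro i _
    exact ((hg.mul_coord hS hU i).integrable θ hθ).mul_const _

lemma ExpIntegrable.pderiv_laplace (hS : Measurable S) (hU : IsOpen U)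
    (hg : ExpIntegrable ρ S U g) {θ : EuclideanSpace ℝ (Fin k)} (hθ : θ ∈ U) (i : Fin k) :
    pderiv i (laplace ρ S g) θ = laplace ρ S (fun x => g x * S x i) θ := by
  rw [pderiv, (hg.hasFDerivAt hS hU hθ).fderiv]
  simp only [_root_.sum_apply, _root_.smul_apply, coord_proj_apply, smul_eq_mul]
  simp

lemma ExpIntegrable.contDiffOn (hS : Measurable S) (hU : IsOpen U) (n : ℕ)
    (hg : ExpIntegrable ρ S U g) : ContDiffOn ℝ n (laplace ρ S g) U := by
  induction n generalizing g with
  | zero =>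
    exact contDiffOn_zero.2 fun θ hθ =>
      (hg.hasFDerivAt hS hU hθ).continuousAt.continuousWithinAt
  | succ n ih =>
    push_cast
    rw [contDiffOn_succ_iff_fderiv_of_isOpen hU]
    refine ⟨fun θ hθ => (hg.hasFDerivAt hS hU hθ).differentiableAt.differentiableWithinAt,
      by simp, ?_⟩
    refine ContDiffOn.congr ?_ fun θ hθ => (hg.hasFDerivAt hS hU hθ).fderiv
    exact ContDiffOn.sum fun i _ => (ih (hg.mul_coord hS hU i)).smul contDiffOn_const

end ExponentialIntegrals

/-! ### Derivatives of the cumulant function and of expectations -/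

section PartialDerivatives

variable {k : ℕ} {f g : EuclideanSpace ℝ (Fin k) → ℝ} {θ : EuclideanSpace ℝ (Fin k)}

lemma gradient_apply (f : EuclideanSpace ℝ (Fin k) → ℝ) (θ : EuclideanSpace ℝ (Fin k))
    (i : Fin k) : (gradient f θ) i = pderiv i f θ := by
  have h := InnerProductSpace.toDual_symm_apply (𝕜 := ℝ) (x := EuclideanSpace.single i (1 : ℝ))
    (y := fderiv ℝ f θ)
  rw [pderiv, ← h, EuclideanSpace.inner_single_right]
  simp [gradient]

lemma pderiv_congr (h : f =ᶠ[𝓝 θ] g) (i : Fin k) : pderiv i f θ = pderiv i g θ := by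
  rw [pderiv, pderiv, h.fderiv_eq]

lemma pderiv_sub (hf : DifferentiableAt ℝ f θ) (hg : DifferentiableAt ℝ g θ) (i : Fin k) :
    pderiv i (fun x => f x - g x) θ = pderiv i f θ - pderiv i g θ := by
  rw [pderiv, fderiv_fun_sub hf hg]; rfl

lemma pderiv_mul (hf : DifferentiableAt ℝ f θ) (hg : DifferentiableAt ℝ g θ) (i : Fin k) :
    pderiv i (fun x => f x * g x) θ = pderiv i f θ * g θ + f θ * pderiv i g θ := by
  rw [pderiv, fderiv_fun_mul hf hg]
  simp [pderiv]; ring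

lemma pderiv_const_mul (c : ℝ) (hf : DifferentiableAt ℝ f θ) (i : Fin k) :
    pderiv i (fun x => c * f x) θ = c * pderiv i f θ := by
  rw [pderiv, fderiv_const_mul hf]; rfl

lemma pderiv_exp_neg_mul (a : ℝ) (hf : DifferentiableAt ℝ f θ) (hg : DifferentiableAt ℝ g θ)
    (i : Fin k) :
    pderiv i (fun x => Real.exp (-(a * f x)) * g x) θ =
      Real.exp (-(a * f θ)) * pderiv i g θ -
        a * pderiv i f θ * (Real.exp (-(a * f θ)) * g θ) := by
  have h : HasFDerivAt (fun x => Real.exp (-(a * f x)))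
      (Real.exp (-(a * f θ)) • -(a • fderiv ℝ f θ)) θ :=
    ((hf.hasFDerivAt.const_mul a).neg).exp
  rw [pderiv_mul h.differentiableAt hg]
  rw [show pderiv i (fun x => Real.exp (-(a * f x))) θ =
    Real.exp (-(a * f θ)) * -(a * pderiv i f θ) by rw [pderiv, h.fderiv]; rfl]
  ring

end PartialDerivatives

namespace ExpFamily

variable {Ω : Type*} [MeasurableSpace Ω] {k : ℕ} (F : ExpFamily Ω k)

/-- Integrability of a function of one observation under all parameters in the interior of the
natural parameter space. -/
abbrev ExpInt₁ (f : Ω → ℝ) : Prop := ExpIntegrable F.base₁ F.T (interior F.paramSpace) f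

/-- Integrability of a function of `n` observations under all parameters in the interior of the
natural parameter space. -/
abbrev ExpInt {n : ℕ} (J : (Fin n → Ω) → ℝ) : Prop :=
  ExpIntegrable (F.base n) (F.stat n) (interior F.paramSpace) J

/-- The expectation of a function of one observation. -/
def mean₁ (f : Ω → ℝ) (θ : EuclideanSpace ℝ (Fin k)) : ℝ := ∫ x, f x ∂F.law₁ θ

variable {F} {θ : EuclideanSpace ℝ (Fin k)} {f : Ω → ℝ} {m : ℕ} {J : (Fin m → Ω) → ℝ}

lemma ExpInt₁.integrable (hf : F.ExpInt₁ f) (hθ : θ ∈ interior F.paramSpace) :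
    Integrable f (F.law₁ θ) := F.integrable_law₁_iff.2 (ExpIntegrable.integrable hf θ hθ)

lemma ExpInt.integrable (hJ : F.ExpInt J) (hθ : θ ∈ interior F.paramSpace) :
    Integrable J (F.law m θ) := F.integrable_law_iff.2 (ExpIntegrable.integrable hJ θ hθ)

lemma expInt_of_integrable (hJm : Measurable J)
    (hJ : ∀ θ ∈ interior F.paramSpace, Integrable J (F.law m θ)) : F.ExpInt J :=
  ⟨hJm, fun θ hθ => F.integrable_law_iff.1 (hJ θ hθ)⟩

lemma expInt₁_one : F.ExpInt₁ fun _ => 1 :=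
  ⟨measurable_const, fun θ hθ => by
    simpa using F.integrable_exp_base₁ (interior_subset hθ)⟩

lemma expInt_one : F.ExpInt fun _ : Fin m → Ω => 1 :=
  expInt_of_integrable measurable_const fun θ hθ => by
    have := F.isProbabilityMeasure_law (interior_subset hθ) m
    exact integrable_const _

lemma ExpInt₁.mul_coord (hf : F.ExpInt₁ f) (i : Fin k) : F.ExpInt₁ fun x => f x * F.T x i :=
  ExpIntegrable.mul_coord F.measurable_T isOpen_interior hf i

lemma ExpInt.mul_coord (hJ : F.ExpInt J) (i : Fin k) : F.ExpInt fun x => J x * F.stat m x i :=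
  ExpIntegrable.mul_coord (F.measurable_stat m) isOpen_interior hJ i

lemma ae_law_iff_ae_base {p : (Fin m → Ω) → Prop} :
    (∀ᵐ x ∂F.law m θ, p x) ↔ ∀ᵐ x ∂F.base m, p x := by
  have hS := F.measurable_stat m
  rw [law_eq, ae_withDensity_iff (by fun_prop)]
  simp [Real.exp_pos]

lemma mean₁_eq (f : Ω → ℝ) (θ : EuclideanSpace ℝ (Fin k)) :
    F.mean₁ f θ = Real.exp (-(1 * F.kappa θ)) * laplace F.base₁ F.T f θ := by
  rw [mean₁, integral_law₁, laplace, ← integral_const_mul]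
  congr 1; ext x
  rw [smul_eq_mul, sub_eq_neg_add, Real.exp_add, one_mul]; ring

lemma mean_eq (J : (Fin m → Ω) → ℝ) (θ : EuclideanSpace ℝ (Fin k)) :
    F.mean J θ = Real.exp (-(m * F.kappa θ)) * laplace (F.base m) (F.stat m) J θ := by
  rw [mean, integral_law, laplace, ← integral_const_mul]
  congr 1; ext x
  rw [smul_eq_mul, sub_eq_neg_add, Real.exp_add]; ring

lemma kappa_eq : F.kappa = fun θ => Real.log (laplace F.base₁ F.T (fun _ => 1) θ) := by
  ext θ
  simp [kappa, partition_eq, laplace]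

lemma laplace_one_pos (hθ : θ ∈ interior F.paramSpace) :
    0 < laplace F.base₁ F.T (fun _ => 1) θ := by
  have := (interior_subset hθ).2
  rw [partition_eq] at this
  simpa [laplace] using this

lemma contDiffOn_kappa (n : ℕ) : ContDiffOn ℝ n F.kappa (interior F.paramSpace) := by
  rw [kappa_eq]
  exact (ExpIntegrable.contDiffOn F.measurable_T isOpen_interior n expInt₁_one).log
    fun θ hθ => (laplace_one_pos hθ).ne'

lemma ExpInt₁.contDiffOn (hf : F.ExpInt₁ f) (n : ℕ) :
    ContDiffOn ℝ n (F.mean₁ f) (interior F.paramSpace) := by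
  rw [show F.mean₁ f = _ from funext (mean₁_eq f)]
  exact (contDiffOn_const.mul (contDiffOn_kappa n)).neg.exp.mul
    (ExpIntegrable.contDiffOn F.measurable_T isOpen_interior n hf)

lemma ExpInt.contDiffOn (hJ : F.ExpInt J) (n : ℕ) :
    ContDiffOn ℝ n (F.mean J) (interior F.paramSpace) := by
  rw [show F.mean J = _ from funext (mean_eq J)]
  exact (contDiffOn_const.mul (contDiffOn_kappa n)).neg.exp.mul
    (ExpIntegrable.contDiffOn (F.measurable_stat m) isOpen_interior n hJ)

lemma differentiableAt_kappa (hθ : θ ∈ interior F.paramSpace) : DifferentiableAt ℝ F.kappa θ :=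
  ((contDiffOn_kappa 1).contDiffAt (isOpen_interior.mem_nhds hθ)).differentiableAt (by simp)

lemma ExpInt₁.differentiableAt (hf : F.ExpInt₁ f) (hθ : θ ∈ interior F.paramSpace) :
    DifferentiableAt ℝ (F.mean₁ f) θ :=
  ((hf.contDiffOn 1).contDiffAt (isOpen_interior.mem_nhds hθ)).differentiableAt (by simp)

lemma ExpInt.differentiableAt (hJ : F.ExpInt J) (hθ : θ ∈ interior F.paramSpace) :
    DifferentiableAt ℝ (F.mean J) θ :=
  ((hJ.contDiffOn 1).contDiffAt (isOpen_interior.mem_nhds hθ)).differentiableAt (by simp)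

lemma pderiv_kappa (hθ : θ ∈ interior F.paramSpace) (i : Fin k) :
    pderiv i F.kappa θ = F.mean₁ (fun x => F.T x i) θ := by
  have h := (ExpIntegrable.hasFDerivAt F.measurable_T isOpen_interior expInt₁_one hθ)
  have h2 : fderiv ℝ F.kappa θ = (laplace F.base₁ F.T (fun _ => 1) θ)⁻¹ •
      fderiv ℝ (laplace F.base₁ F.T (fun _ => 1)) θ := by
    rw [kappa_eq, fderiv.log h.differentiableAt (laplace_one_pos hθ).ne']
  rw [pderiv, h2, mean₁_eq]
  change (laplace F.base₁ F.T (fun _ => 1) θ)⁻¹ * pderiv i (laplace F.base₁ F.T (fun _ => 1)) θ = _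
  rw [ExpIntegrable.pderiv_laplace F.measurable_T isOpen_interior expInt₁_one hθ, one_mul,
    Real.exp_neg, kappa_eq, Real.exp_log (laplace_one_pos hθ)]
  simp

lemma mu_apply (hθ : θ ∈ interior F.paramSpace) (i : Fin k) :
    F.mu θ i = F.mean₁ (fun x => F.T x i) θ := by
  rw [mu, gradient_apply, pderiv_kappa hθ]

lemma ExpInt₁.pderiv (hf : F.ExpInt₁ f) (hθ : θ ∈ interior F.paramSpace) (i : Fin k) :
    _root_.pderiv i (F.mean₁ f) θ =
      F.mean₁ (fun x => f x * F.T x i) θ - F.mu θ i * F.mean₁ f θ := by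
  rw [show F.mean₁ f = _ from funext (mean₁_eq f), pderiv_exp_neg_mul 1
    (differentiableAt_kappa hθ)
    (ExpIntegrable.hasFDerivAt F.measurable_T isOpen_interior hf hθ).differentiableAt,
    ExpIntegrable.pderiv_laplace F.measurable_T isOpen_interior hf hθ, mean₁_eq, mu_apply hθ,
    pderiv_kappa hθ]
  simp only [one_mul]

lemma ExpInt.pderiv (hJ : F.ExpInt J) (hθ : θ ∈ interior F.paramSpace) (i : Fin k) :
    _root_.pderiv i (F.mean J) θ =
      F.mean (fun x => J x * F.stat m x i) θ - m * F.mu θ i * F.mean J θ := by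
  rw [show F.mean J = _ from funext (mean_eq J), pderiv_exp_neg_mul m
    (differentiableAt_kappa hθ)
    (ExpIntegrable.hasFDerivAt (F.measurable_stat m) isOpen_interior hJ hθ).differentiableAt,
    ExpIntegrable.pderiv_laplace (F.measurable_stat m) isOpen_interior hJ hθ, mean_eq, mu_apply hθ,
    pderiv_kappa hθ]

lemma expInt₁_coord (i : Fin k) : F.ExpInt₁ fun x => F.T x i := by
  simpa using expInt₁_one.mul_coord i

lemma mu_apply_eventuallyEq (hθ : θ ∈ interior F.paramSpace) (i : Fin k) :
    _root_.pderiv i F.kappa =ᶠ[𝓝 θ] F.mean₁ (fun x => F.T x i) := by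
  filter_upwards [isOpen_interior.mem_nhds hθ] with θ' h using pderiv_kappa h i

lemma V_apply (hθ : θ ∈ interior F.paramSpace) (i j : Fin k) :
    F.V θ i j = F.mean₁ (fun x => F.T x j * F.T x i) θ - F.mu θ i * F.mu θ j := by
  rw [V, hessian, Matrix.of_apply, pderiv_congr (mu_apply_eventuallyEq hθ j),
    (expInt₁_coord j).pderiv hθ, mu_apply hθ j]

lemma V_eq_pderiv (F : ExpFamily Ω k) (θ : EuclideanSpace ℝ (Fin k)) (i j : Fin k) :
    F.V θ i j = _root_.pderiv i (_root_.pderiv j F.kappa) θ := rfl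

lemma kappa₃_apply (hθ : θ ∈ interior F.paramSpace) (i j l : Fin k) :
    F.kappa₃ θ i j l = F.mean₁ (fun x => F.T x l * F.T x j * F.T x i) θ
      - F.mu θ i * F.mean₁ (fun x => F.T x l * F.T x j) θ
      - F.V θ i j * F.mu θ l - F.mu θ j * F.V θ i l := by
  have h : _root_.pderiv j (_root_.pderiv l F.kappa) =ᶠ[𝓝 θ] fun θ' =>
      F.mean₁ (fun x => F.T x l * F.T x j) θ' -
        F.mean₁ (fun x => F.T x j) θ' * F.mean₁ (fun x => F.T x l) θ' := by
    filter_upwards [isOpen_interior.mem_nhds hθ] with θ' h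
    rw [← V_eq_pderiv, V_apply h, mu_apply h, mu_apply h]
  have h1 := (expInt₁_coord (F := F) l).mul_coord j
  have hj := (expInt₁_coord (F := F) j).differentiableAt hθ
  have hl := (expInt₁_coord (F := F) l).differentiableAt hθ
  rw [kappa₃, pderiv_congr h, pderiv_sub (h1.differentiableAt hθ) (hj.fun_mul hl), pderiv_mul hj hl,
    h1.pderiv hθ, ← pderiv_congr (mu_apply_eventuallyEq hθ j),
    ← pderiv_congr (mu_apply_eventuallyEq hθ l), ← V_eq_pderiv, ← V_eq_pderiv,
    ← mu_apply hθ, ← mu_apply hθ]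
  ring

end ExpFamily

/-! ### Cumulants as central moments -/

section Sums

variable {k : ℕ} {X : Type*} [MeasurableSpace X] {ρ : Measure X}

lemma sum_coord_eq_inner (φ v : EuclideanSpace ℝ (Fin k)) : ⟪φ, v⟫ = ∑ i, φ i * v i := by
  rw [PiLp.inner_apply]; simp [mul_comm]

lemma integral_mul_inner {f : X → ℝ} {Y : X → EuclideanSpace ℝ (Fin k)}
    (h : ∀ i, Integrable (fun x => f x * Y x i) ρ) (φ : EuclideanSpace ℝ (Fin k)) :
    ∫ x, f x * ⟪φ, Y x⟫ ∂ρ = ∑ i, (∫ x, f x * Y x i ∂ρ) * φ i := by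
  have h1 : ∀ x, f x * ⟪φ, Y x⟫ = ∑ i, f x * Y x i * φ i := fun x => by
    rw [sum_coord_eq_inner, Finset.mul_sum]
    exact Finset.sum_congr rfl fun i _ => by ring
  simp_rw [h1]
  rw [integral_finsetSum _ fun i _ => (h i).mul_const _]
  simp_rw [integral_mul_const]

lemma integral_mul_inner_sq {f : X → ℝ} {Y : X → EuclideanSpace ℝ (Fin k)}
    (h : ∀ i j, Integrable (fun x => f x * Y x i * Y x j) ρ) (φ : EuclideanSpace ℝ (Fin k)) :
    ∫ x, f x * ⟪φ, Y x⟫ ^ 2 ∂ρ = ∑ i, ∑ j, (∫ x, f x * Y x i * Y x j ∂ρ) * φ i * φ j := by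
  have h1 : ∀ x, f x * ⟪φ, Y x⟫ ^ 2 = ∑ i, ∑ j, f x * Y x i * Y x j * φ i * φ j := fun x => by
    rw [sum_coord_eq_inner, pow_two, Finset.sum_mul_sum]
    simp_rw [Finset.mul_sum]
    exact Finset.sum_congr rfl fun i _ => Finset.sum_congr rfl fun j _ => by ring
  simp_rw [h1]
  rw [integral_finsetSum _ fun i _ => integrable_finsetSum _ fun j _ =>
    ((h i j).mul_const _).mul_const _]
  refine Finset.sum_congr rfl fun i _ => ?_
  rw [integral_finsetSum _ fun j _ => ((h i j).mul_const _).mul_const _]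
  simp_rw [integral_mul_const]

lemma integral_mul_inner_cube {f : X → ℝ} {Y : X → EuclideanSpace ℝ (Fin k)}
    (h : ∀ i j l, Integrable (fun x => f x * Y x i * Y x j * Y x l) ρ)
    (φ : EuclideanSpace ℝ (Fin k)) :
    ∫ x, f x * ⟪φ, Y x⟫ ^ 3 ∂ρ =
      ∑ i, ∑ j, ∑ l, (∫ x, f x * Y x i * Y x j * Y x l ∂ρ) * φ i * φ j * φ l := by
  have h1 : ∀ x, f x * ⟪φ, Y x⟫ ^ 3 =
      ∑ i, ∑ j, ∑ l, f x * Y x i * Y x j * Y x l * φ i * φ j * φ l := fun x => by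
    rw [sum_coord_eq_inner, pow_three, Finset.sum_mul_sum, Finset.sum_mul_sum]
    simp_rw [Finset.mul_sum]
    exact Finset.sum_congr rfl fun i _ => Finset.sum_congr rfl fun j _ =>
      Finset.sum_congr rfl fun l _ => by ring
  simp_rw [h1]
  have h2 : ∀ i j l, Integrable (fun x => f x * Y x i * Y x j * Y x l * φ i * φ j * φ l) ρ :=
    fun i j l => (((h i j l).mul_const _).mul_const _).mul_const _
  rw [integral_finsetSum _ fun i _ => integrable_finsetSum _ fun j _ => integrable_finsetSum _
    fun l _ => h2 i j l]
  refine Finset.sum_congr rfl fun i _ => ?_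
  rw [integral_finsetSum _ fun j _ => integrable_finsetSum _ fun l _ => h2 i j l]
  refine Finset.sum_congr rfl fun j _ => ?_
  rw [integral_finsetSum _ fun l _ => h2 i j l]
  simp_rw [integral_mul_const]

/-- A sum over all triples of indices, sorted by the coincidences among the indices. -/
lemma sum_triples_eq (g : Fin k → Fin k → Fin k → ℝ) :
    ∑ i, ∑ j, ∑ p, g i j p =
      (∑ i, g i i i) +
      (∑ i, ∑ j, if i ≠ j then g i i j + g i j i + g j i i else 0) +
      (∑ i, ∑ j, ∑ p, if i < j ∧ j < p then
        g i j p + g j i p + g i p j + g p i j + g j p i + g p j i else 0) := by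
  have e0 : ∑ i, g i i i = ∑ i, ∑ j, ∑ p, if i = j ∧ j = p then g i j p else 0 := by
    refine Finset.sum_congr rfl fun i _ => ?_
    rw [Finset.sum_eq_single i (fun j _ h => by simp [h.symm]) (by simp),
      Finset.sum_eq_single i (fun p _ h => by simp [h.symm]) (by simp)]
    simp
  have e1 : ∑ i, ∑ j, (if i ≠ j then g i i j else 0) =
      ∑ i, ∑ j, ∑ p, if i = j ∧ j ≠ p then g i j p else 0 := by
    refine Finset.sum_congr rfl fun i _ => ?_
    symm
    rw [Finset.sum_eq_single i (fun j _ h => by simp [h.symm]) (by simp)]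
    simp
  have e2 : ∑ i, ∑ j, (if i ≠ j then g i j i else 0) =
      ∑ i, ∑ j, ∑ p, if i = p ∧ i ≠ j then g i j p else 0 := by
    refine Finset.sum_congr rfl fun i _ => Finset.sum_congr rfl fun j _ => ?_
    rw [Finset.sum_eq_single i (fun j _ h => by simp [h.symm]) (by simp)]
    simp
  have e3 : ∑ i, ∑ j, (if i ≠ j then g j i i else 0) =
      ∑ i, ∑ j, ∑ p, if j = p ∧ i ≠ j then g i j p else 0 := by
    rw [Finset.sum_comm]
    refine Finset.sum_congr rfl fun i _ => Finset.sum_congr rfl fun j _ => ?_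
    rw [Finset.sum_eq_single j (fun p _ h => by simp [h.symm]) (by simp)]
    simp [eq_comm]
  have s12 : ∀ f : Fin k → Fin k → Fin k → ℝ,
      ∑ i, ∑ j, ∑ p, f j i p = ∑ i, ∑ j, ∑ p, f i j p := fun f => Finset.sum_comm
  have s23 : ∀ f : Fin k → Fin k → Fin k → ℝ,
      ∑ i, ∑ j, ∑ p, f i p j = ∑ i, ∑ j, ∑ p, f i j p := fun f =>
    Finset.sum_congr rfl fun i _ => Finset.sum_comm
  have t1 := s12 fun i j p => if j < i ∧ i < p then g i j p else 0
  have t2 := s23 fun i j p => if i < p ∧ p < j then g i j p else 0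
  have t3' : ∑ i, ∑ j, ∑ p, (if i < j ∧ j < p then g p i j else 0) =
      ∑ i, ∑ j, ∑ p, if j < p ∧ p < i then g i j p else 0 := by
    rw [← s23 fun i j p => if j < p ∧ p < i then g i j p else 0,
      ← s12 fun i j p => if p < j ∧ j < i then g i p j else 0,
      ← s23 fun i j p => if p < i ∧ i < j then g j p i else 0]
    exact s12 fun i j p => if j < i ∧ i < p then g p j i else 0
  have t4 : ∑ i, ∑ j, ∑ p, (if i < j ∧ j < p then g j p i else 0) =
      ∑ i, ∑ j, ∑ p, if p < i ∧ i < j then g i j p else 0 := by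
    rw [← s23 fun i j p => if p < i ∧ i < j then g i j p else 0,
      ← s12 fun i j p => if j < i ∧ i < p then g i p j else 0]
  have t5 : ∑ i, ∑ j, ∑ p, (if i < j ∧ j < p then g p j i else 0) =
      ∑ i, ∑ j, ∑ p, if p < j ∧ j < i then g i j p else 0 := by
    rw [← s12 fun i j p => if p < j ∧ j < i then g i j p else 0,
      ← s23 fun i j p => if p < i ∧ i < j then g j i p else 0,
      ← s12 fun i j p => if j < i ∧ i < p then g p i j else 0]
  have r1 : (∑ i, ∑ j, if i ≠ j then g i i j + g i j i + g j i i else 0) =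
      (∑ i, ∑ j, if i ≠ j then g i i j else 0) + (∑ i, ∑ j, if i ≠ j then g i j i else 0) +
        ∑ i, ∑ j, if i ≠ j then g j i i else 0 := by
    simp only [← Finset.sum_add_distrib]
    exact Finset.sum_congr rfl fun i _ => Finset.sum_congr rfl fun j _ => by split_ifs <;> simp
  have r2 : (∑ i, ∑ j, ∑ p, if i < j ∧ j < p then
        g i j p + g j i p + g i p j + g p i j + g j p i + g p j i else 0) =
      (∑ i, ∑ j, ∑ p, if i < j ∧ j < p then g i j p else 0) +
      (∑ i, ∑ j, ∑ p, if i < j ∧ j < p then g j i p else 0) +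
      (∑ i, ∑ j, ∑ p, if i < j ∧ j < p then g i p j else 0) +
      (∑ i, ∑ j, ∑ p, if i < j ∧ j < p then g p i j else 0) +
      (∑ i, ∑ j, ∑ p, if i < j ∧ j < p then g j p i else 0) +
      ∑ i, ∑ j, ∑ p, if i < j ∧ j < p then g p j i else 0 := by
    simp only [← Finset.sum_add_distrib]
    exact Finset.sum_congr rfl fun i _ => Finset.sum_congr rfl fun j _ =>
      Finset.sum_congr rfl fun p _ => by split_ifs <;> simp
  rw [r1, r2, e0, e1, e2, e3, t1, t2, t3', t4, t5]
  simp only [← Finset.sum_add_distrib]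
  refine Finset.sum_congr rfl fun i _ => Finset.sum_congr rfl fun j _ =>
    Finset.sum_congr rfl fun p _ => ?_
  rcases lt_trichotomy i j with h1 | h1 | h1 <;> rcases lt_trichotomy j p with h2 | h2 | h2 <;>
    rcases lt_trichotomy i p with h3 | h3 | h3 <;> first | (exfalso; order) | skip
  all_goals
    try subst h1
    try subst h2
    try subst h3
    simp [*, ne_of_lt, ne_of_gt, not_lt_of_gt]

end Sums

namespace ExpFamily

variable {Ω : Type*} [MeasurableSpace Ω] {k : ℕ} {F : ExpFamily Ω k}
  {θ : EuclideanSpace ℝ (Fin k)} {f : Ω → ℝ} {m : ℕ} {J : (Fin m → Ω) → ℝ}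

lemma B_eq (m : ℕ) (θ : EuclideanSpace ℝ (Fin k)) (x : Fin m → Ω) :
    F.B m θ x = F.stat m x - (m : ℝ) • F.mu θ := by
  simp [B, stat, Finset.sum_sub_distrib, ← Nat.cast_smul_eq_nsmul ℝ]

lemma B_apply (m : ℕ) (θ : EuclideanSpace ℝ (Fin k)) (x : Fin m → Ω) (i : Fin k) :
    F.B m θ x i = F.stat m x i - m * F.mu θ i := by
  rw [B_eq]; simp

lemma measurable_B (F : ExpFamily Ω k) (m : ℕ) (θ : EuclideanSpace ℝ (Fin k)) :
    Measurable (F.B m θ) := by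
  have := F.measurable_stat m
  rw [show F.B m θ = _ from funext (B_eq m θ)]
  fun_prop

lemma ExpInt.mul_of_le (hJ : F.ExpInt J) {h : (Fin m → Ω) → ℝ} (hh : Measurable h) (C : ℝ) (p : ℕ)
    (hle : ∀ x, |h x| ≤ C * (1 + ‖F.stat m x‖) ^ p) : F.ExpInt fun x => J x * h x :=
  ExpIntegrable.mul_of_le (F.measurable_stat m) isOpen_interior hJ hh C p hle

lemma ExpInt₁.mul_of_le (hf : F.ExpInt₁ f) {h : Ω → ℝ} (hh : Measurable h) (C : ℝ) (p : ℕ)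
    (hle : ∀ x, |h x| ≤ C * (1 + ‖F.T x‖) ^ p) : F.ExpInt₁ fun x => f x * h x :=
  ExpIntegrable.mul_of_le F.measurable_T isOpen_interior hf hh C p hle

lemma ExpInt.mul_coord_sub (hJ : F.ExpInt J) (i : Fin k) (c : ℝ) :
    F.ExpInt fun x => J x * (F.stat m x i - c) := by
  have := F.measurable_stat m
  refine hJ.mul_of_le (by fun_prop) (1 + |c|) 1 fun x => ?_
  have h1 := abs_coord_le (F.stat m x) i
  have h2 := abs_sub (F.stat m x i) c
  nlinarith [norm_nonneg (F.stat m x), abs_nonneg c]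

lemma ExpInt₁.mul_coord_sub (hf : F.ExpInt₁ f) (i : Fin k) (c : ℝ) :
    F.ExpInt₁ fun x => f x * (F.T x i - c) := by
  have := F.measurable_T
  refine hf.mul_of_le (by fun_prop) (1 + |c|) 1 fun x => ?_
  have h1 := abs_coord_le (F.T x) i
  have h2 := abs_sub (F.T x i) c
  nlinarith [norm_nonneg (F.T x), abs_nonneg c]

lemma ExpInt.mul_B (hJ : F.ExpInt J) (θ : EuclideanSpace ℝ (Fin k)) (i : Fin k) :
    F.ExpInt fun x => J x * F.B m θ x i := by
  simp_rw [B_apply]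
  exact hJ.mul_coord_sub i _

lemma mean₁_mul_sub (hf : F.ExpInt₁ f) (hθ : θ ∈ interior F.paramSpace) (i : Fin k) (c : ℝ) :
    F.mean₁ (fun x => f x * (F.T x i - c)) θ =
      F.mean₁ (fun x => f x * F.T x i) θ - c * F.mean₁ f θ := by
  unfold mean₁
  rw [← integral_const_mul, ← integral_sub ((hf.mul_coord i).integrable hθ)
    ((hf.integrable hθ).const_mul c)]
  congr 1; ext x; ring

lemma mean_mul_sub (hJ : F.ExpInt J) (hθ : θ ∈ interior F.paramSpace) (i : Fin k) (c : ℝ) :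
    F.mean (fun x => J x * (F.stat m x i - c)) θ =
      F.mean (fun x => J x * F.stat m x i) θ - c * F.mean J θ := by
  unfold mean
  rw [← integral_const_mul, ← integral_sub ((hJ.mul_coord i).integrable hθ)
    ((hJ.integrable hθ).const_mul c)]
  congr 1; ext x; ring

lemma mean₁_coord_sub (hθ : θ ∈ interior F.paramSpace) (i : Fin k) :
    F.mean₁ (fun x => F.T x i - F.mu θ i) θ = 0 := by
  have h := mean₁_mul_sub expInt₁_one hθ i (F.mu θ i)
  have := F.isProbabilityMeasure_law₁ (interior_subset hθ)
  simp only [one_mul] at h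
  rw [h, mu_apply hθ]
  simp [mean₁]

lemma V_eq_central (hθ : θ ∈ interior F.paramSpace) (i j : Fin k) :
    F.V θ i j = F.mean₁ (fun x => (F.T x i - F.mu θ i) * (F.T x j - F.mu θ j)) θ := by
  have h1 := (expInt₁_one (F := F)).mul_coord_sub i (F.mu θ i)
  have h2 := mean₁_mul_sub h1 hθ j (F.mu θ j)
  have h3 := mean₁_mul_sub (expInt₁_coord j) hθ i (F.mu θ i)
  simp only [one_mul] at h2
  rw [h2, mean₁_coord_sub hθ, V_apply hθ]
  simp_rw [mul_comm _ (F.T _ j)]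
  rw [h3, ← mu_apply hθ]; ring

lemma V_isSymm (hθ : θ ∈ interior F.paramSpace) : (F.V θ).IsSymm := by
  ext i j
  rw [Matrix.transpose_apply, V_eq_central hθ, V_eq_central hθ]
  simp_rw [mul_comm]

lemma kappa₃_eq_central (hθ : θ ∈ interior F.paramSpace) (i j l : Fin k) :
    F.kappa₃ θ i j l = F.mean₁ (fun x =>
      (F.T x i - F.mu θ i) * (F.T x j - F.mu θ j) * (F.T x l - F.mu θ l)) θ := by
  have h1 := (expInt₁_one (F := F)).mul_coord_sub i (F.mu θ i)
  simp only [one_mul] at h1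
  have h2 := mean₁_mul_sub (h1.mul_coord_sub j (F.mu θ j)) hθ l (F.mu θ l)
  have h3 := mean₁_mul_sub ((expInt₁_coord l).mul_coord_sub i (F.mu θ i)) hθ j (F.mu θ j)
  have h4 := mean₁_mul_sub ((expInt₁_coord l).mul_coord j) hθ i (F.mu θ i)
  have h5 := mean₁_mul_sub (expInt₁_coord l) hθ i (F.mu θ i)
  have e1 : (fun x => (F.T x i - F.mu θ i) * (F.T x j - F.mu θ j) * F.T x l) =
      fun x => F.T x l * (F.T x i - F.mu θ i) * (F.T x j - F.mu θ j) := by ext x; ring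
  have e2 : (fun x => F.T x l * (F.T x i - F.mu θ i) * F.T x j) =
      fun x => F.T x l * F.T x j * (F.T x i - F.mu θ i) := by ext x; ring
  have v1 := V_apply hθ j l
  have v2 := V_apply hθ i l
  rw [h2, e1, h3, e2, h4, h5, ← V_eq_central hθ, kappa₃_apply hθ, ← mu_apply hθ]
  rw [eq_sub_iff_add_eq] at v1 v2
  rw [← v1, ← v2]; ring

lemma kappa₃_swap_left (hθ : θ ∈ interior F.paramSpace) (i j l : Fin k) :
    F.kappa₃ θ j i l = F.kappa₃ θ i j l := by
  rw [kappa₃_eq_central hθ, kappa₃_eq_central hθ]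
  congr 1; ext x; ring

lemma kappa₃_swap_right (hθ : θ ∈ interior F.paramSpace) (i j l : Fin k) :
    F.kappa₃ θ i l j = F.kappa₃ θ i j l := by
  rw [kappa₃_eq_central hθ, kappa₃_eq_central hθ]
  congr 1; ext x; ring

lemma D_isSymm (hθ : θ ∈ interior F.paramSpace) : (F.D θ).IsSymm := by
  rw [Matrix.IsSymm, D, Matrix.transpose_nonsing_inv, (V_isSymm hθ)]

/-- The closed form of the coefficients `a_{1,1;l}`, without distinguishing coincidences. -/
lemma a₁₁_eq (hθ : θ ∈ interior F.paramSpace) (l : Fin k) :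
    F.a₁₁ θ l = (∑ i, ∑ j, ∑ p, F.kappa₃ θ i j p * F.D θ i j * F.D θ p l) / 2 := by
  have hD : ∀ i j, F.D θ j i = F.D θ i j := fun i j => (D_isSymm hθ).apply i j
  rw [sum_triples_eq, a₁₁, add_div, add_div]
  simp_rw [Finset.sum_div]
  congr 1
  · congr 1
    refine Finset.sum_congr rfl fun i _ => Finset.sum_congr rfl fun j _ => ?_
    split_ifs
    · rw [hD i j, kappa₃_swap_right hθ i i j, kappa₃_swap_left hθ i j i,
        kappa₃_swap_right hθ i i j]; ring
    · simp
  · refine Finset.sum_congr rfl fun i _ => Finset.sum_congr rfl fun j _ =>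
      Finset.sum_congr rfl fun p _ => ?_
    split_ifs
    · rw [hD i j, hD i p, hD j p, kappa₃_swap_left hθ i j p, kappa₃_swap_right hθ i j p,
        kappa₃_swap_right hθ p i j, kappa₃_swap_left hθ i p j, kappa₃_swap_right hθ j i p,
        kappa₃_swap_right hθ i j p, kappa₃_swap_left hθ i j p]
      ring
    · simp

lemma pderiv_mean (hJ : F.ExpInt J) (hθ : θ ∈ interior F.paramSpace) (i : Fin k) :
    pderiv i (F.mean J) θ = F.mean (fun x => J x * F.B m θ x i) θ := by
  simp_rw [B_apply]
  rw [hJ.pderiv hθ, mean_mul_sub hJ hθ]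

/-- Differentiating `E_θ J` twice gives the second moments of `B_m`, centred by `m V`, the
derivative of the centring `m μ(θ)`. -/
lemma hessian_mean (hJ : F.ExpInt J) (hθ : θ ∈ interior F.paramSpace) (i j : Fin k) :
    hessian (F.mean J) θ i j =
      F.mean (fun x => J x * F.B m θ x i * F.B m θ x j) θ - m * F.V θ i j * F.mean J θ := by
  have h1 : pderiv j (F.mean J) =ᶠ[𝓝 θ] fun θ' => F.mean (fun x => J x * F.stat m x j) θ' -
      m * (pderiv j F.kappa θ' * F.mean J θ') := by
    filter_upwards [isOpen_interior.mem_nhds hθ] with θ' h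
    rw [hJ.pderiv h, mu_apply h, pderiv_kappa h, mul_assoc]
  have hk : DifferentiableAt ℝ (pderiv j F.kappa) θ :=
    ((expInt₁_coord j).differentiableAt hθ).congr_of_eventuallyEq (mu_apply_eventuallyEq hθ j)
  have hJd := hJ.differentiableAt hθ
  rw [hessian, Matrix.of_apply, pderiv_congr h1, pderiv_sub ((hJ.mul_coord j).differentiableAt hθ)
    ((hk.fun_mul hJd).const_mul _), pderiv_const_mul _ (hk.fun_mul hJd), pderiv_mul hk hJd,
    (hJ.mul_coord j).pderiv hθ, hJ.pderiv hθ, ← V_eq_pderiv, pderiv_kappa hθ, ← mu_apply hθ]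
  simp_rw [B_apply]
  rw [mean_mul_sub (hJ.mul_coord_sub i _) hθ]
  have e : (fun x => J x * (F.stat m x i - m * F.mu θ i) * F.stat m x j) =
    fun x => J x * F.stat m x j * (F.stat m x i - m * F.mu θ i) := by ext x; ring
  rw [e, mean_mul_sub (hJ.mul_coord j) hθ, mean_mul_sub hJ hθ]
  ring

end ExpFamily

/-! ### The correction term -/

namespace ExpFamily

variable {Ω : Type*} [MeasurableSpace Ω] {k : ℕ} {F : ExpFamily Ω k}
  {θ : EuclideanSpace ℝ (Fin k)} {m : ℕ} {J : (Fin m → Ω) → ℝ}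

lemma ExpInt.of_abs_le {Jbar : (Fin m → Ω) → ℝ} (hJbar : F.ExpInt Jbar) (hJ : Measurable J)
    (hle : ∀ᵐ x ∂F.law m θ, |J x| ≤ Jbar x) : F.ExpInt J :=
  ExpIntegrable.of_le hJbar (F.measurable_stat m) hJ (ae_law_iff_ae_base.1 hle)

lemma mean_const (hθ : θ ∈ interior F.paramSpace) (c : ℝ) :
    F.mean (fun _ : Fin m → Ω => c) θ = c := by
  have := F.isProbabilityMeasure_law (interior_subset hθ) m
  simp [mean]

lemma mean_B (hθ : θ ∈ interior F.paramSpace) (i : Fin k) :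
    F.mean (fun x : Fin m → Ω => F.B m θ x i) θ = 0 := by
  have h := pderiv_mean (expInt_one (F := F) (m := m)) hθ i
  simp only [one_mul] at h
  have h2 : F.mean (fun _ : Fin m → Ω => (1 : ℝ)) =ᶠ[𝓝 θ] fun _ => 1 := by
    filter_upwards [isOpen_interior.mem_nhds hθ] with θ' h using mean_const h 1
  rw [← h, pderiv_congr h2]
  simp [pderiv]

lemma mean_B_mul_B (hθ : θ ∈ interior F.paramSpace) (i j : Fin k) :
    F.mean (fun x : Fin m → Ω => F.B m θ x i * F.B m θ x j) θ = m * F.V θ i j := by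
  have h := hessian_mean (expInt_one (F := F) (m := m)) hθ i j
  simp only [one_mul, mean_const hθ, mul_one] at h
  have h2 : pderiv j (F.mean (fun _ : Fin m → Ω => (1 : ℝ))) =ᶠ[𝓝 θ] fun _ => 0 := by
    filter_upwards [isOpen_interior.mem_nhds hθ] with θ' h
    have h2 : F.mean (fun _ : Fin m → Ω => (1 : ℝ)) =ᶠ[𝓝 θ'] fun _ => 1 := by
      filter_upwards [isOpen_interior.mem_nhds h] with θ' h using mean_const h 1
    rw [pderiv_congr h2]
    simp [pderiv]
  rw [hessian, Matrix.of_apply, pderiv_congr h2] at h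
  simp only [pderiv, fderiv_fun_const, Pi.zero_apply, _root_.zero_apply] at h
  linarith

lemma Q_eq (θ : EuclideanSpace ℝ (Fin k)) (x : Fin m → Ω) :
    F.Q m θ x = ∑ i, ∑ j, F.D θ i j * (F.B m θ x i * F.B m θ x j) := by
  simp only [Q, dotProduct, Matrix.mulVec, D, Finset.mul_sum]
  exact Finset.sum_congr rfl fun i _ => Finset.sum_congr rfl fun j _ => by ring

lemma mul_Q_eq (θ : EuclideanSpace ℝ (Fin k)) (x : Fin m → Ω) :
    J x * F.Q m θ x = ∑ i, ∑ j, F.D θ i j * (J x * F.B m θ x i * F.B m θ x j) := by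
  rw [Q_eq]
  simp only [Finset.mul_sum]
  exact Finset.sum_congr rfl fun i _ => Finset.sum_congr rfl fun j _ => by ring

lemma mul_psi₁₁_eq (θ : EuclideanSpace ℝ (Fin k)) (x : Fin m → Ω) :
    J x * F.psi₁₁ θ (F.B m θ x) = -∑ l, F.a₁₁ θ l * (J x * F.B m θ x l) := by
  simp only [psi₁₁, mul_neg, Finset.mul_sum]
  congr 1
  exact Finset.sum_congr rfl fun i _ => by ring

lemma integrable_mul_Q (hJ : F.ExpInt J) (hθ : θ ∈ interior F.paramSpace) :
    Integrable (fun x => J x * F.Q m θ x) (F.law m θ) := by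
  simp_rw [mul_Q_eq]
  exact integrable_finsetSum _ fun i _ => integrable_finsetSum _ fun j _ =>
    (((hJ.mul_B θ i).mul_B θ j).integrable hθ).const_mul _

lemma integrable_mul_psi₁₁ (hJ : F.ExpInt J) (hθ : θ ∈ interior F.paramSpace) :
    Integrable (fun x => J x * F.psi₁₁ θ (F.B m θ x)) (F.law m θ) := by
  simp_rw [mul_psi₁₁_eq]
  exact (integrable_finsetSum _ fun l _ => ((hJ.mul_B θ l).integrable hθ).const_mul _).neg

lemma integral_mul_Q (hJ : F.ExpInt J) (hθ : θ ∈ interior F.paramSpace) :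
    ∫ x, J x * F.Q m θ x ∂F.law m θ =
      ∑ i, ∑ j, F.D θ i j * F.mean (fun x => J x * F.B m θ x i * F.B m θ x j) θ := by
  simp_rw [mul_Q_eq]
  have h := fun i j => (((hJ.mul_B θ i).mul_B θ j).integrable hθ).const_mul (F.D θ i j)
  rw [integral_finsetSum _ fun i _ => integrable_finsetSum _ fun j _ => h i j]
  refine Finset.sum_congr rfl fun i _ => ?_
  rw [integral_finsetSum _ fun j _ => h i j]
  simp_rw [integral_const_mul, mean]

lemma integral_mul_psi₁₁ (hJ : F.ExpInt J) (hθ : θ ∈ interior F.paramSpace) :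
    ∫ x, J x * F.psi₁₁ θ (F.B m θ x) ∂F.law m θ =
      -∑ l, F.a₁₁ θ l * F.mean (fun x => J x * F.B m θ x l) θ := by
  simp_rw [mul_psi₁₁_eq]
  rw [integral_neg, integral_finsetSum _ fun l _ =>
    ((hJ.mul_B θ l).integrable hθ).const_mul (F.a₁₁ θ l)]
  simp_rw [integral_const_mul, mean]

lemma R_eq_sums (hJ : F.ExpInt J) (hθ : θ ∈ interior F.paramSpace) :
    F.R J θ = m * k / 2 * F.mean J θ
      - 1 / 2 * (∑ i, ∑ j, F.D θ i j * F.mean (fun x => J x * F.B m θ x i * F.B m θ x j) θ)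
      + ∑ l, F.a₁₁ θ l * F.mean (fun x => J x * F.B m θ x l) θ := by
  rw [R, integral_mul_Q hJ hθ, integral_mul_psi₁₁ hJ hθ]; ring

lemma sum_D_mul_V (hθ : θ ∈ interior F.paramSpace) (hV : IsUnit (F.V θ).det) :
    ∑ i, ∑ j, F.D θ i j * F.V θ i j = k := by
  have h : F.D θ * F.V θ = 1 := Matrix.nonsing_inv_mul _ hV
  have h2 : (F.D θ * F.V θ).trace = k := by rw [h]; simp
  rw [← h2, Matrix.trace]
  simp only [Matrix.diag_apply, Matrix.mul_apply]
  refine Finset.sum_congr rfl fun i _ => Finset.sum_congr rfl fun j _ => ?_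
  rw [(V_isSymm hθ).apply]

/-- The correction term in terms of the derivatives of the expectation. -/
lemma R_eq_trace (hJ : F.ExpInt J) (hθ : θ ∈ interior F.paramSpace) (hV : IsUnit (F.V θ).det) :
    F.R J θ = - (1 / 2) * ((F.V θ)⁻¹ * hessian (F.mean J) θ).trace
      - F.psi₁₁ θ (gradient (F.mean J) θ) := by
  have h1 : ((F.V θ)⁻¹ * hessian (F.mean J) θ).trace =
      (∑ i, ∑ j, F.D θ i j * F.mean (fun x => J x * F.B m θ x i * F.B m θ x j) θ) -
        m * k * F.mean J θ := by
    rw [← sum_D_mul_V hθ hV, Matrix.trace]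
    simp only [Matrix.diag_apply, Matrix.mul_apply, Finset.mul_sum, Finset.sum_mul]
    simp only [← Finset.sum_sub_distrib]
    refine Finset.sum_congr rfl fun i _ => Finset.sum_congr rfl fun j _ => ?_
    have e : (fun x => J x * F.B m θ x j * F.B m θ x i) =
      fun x => J x * F.B m θ x i * F.B m θ x j := by ext x; ring
    rw [hessian_mean hJ hθ, (V_isSymm hθ).apply, e, D]; ring
  rw [R_eq_sums hJ hθ, h1, psi₁₁]
  simp_rw [gradient_apply, pderiv_mean hJ hθ]
  ring

lemma mean_sub_mul (c : ℝ) {h : (Fin m → Ω) → ℝ}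
    (h1 : Integrable (fun x => J x * h x) (F.law m θ)) (h2 : Integrable h (F.law m θ)) :
    F.mean (fun x => (J x - c) * h x) θ = F.mean (fun x => J x * h x) θ - c * F.mean h θ := by
  unfold mean
  rw [← integral_const_mul, ← integral_sub h1 (h2.const_mul _)]
  congr 1; ext x; ring

/-- The correction term as the Gaussian average computed in
`integral_quadratic_add_linear_mul_cubic_gaussian`. -/
lemma R_eq_gaussian (hJ : F.ExpInt J) (hθ : θ ∈ interior F.paramSpace)
    (hV : IsUnit (F.V θ).det) :
    F.R J θ =
      -(∑ i, ∑ j, F.mean (fun x => (J x - F.mean J θ) * F.B m θ x i * F.B m θ x j) θ *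
        F.D θ i j) / 2 +
      (∑ l, F.mean (fun x => (J x - F.mean J θ) * F.B m θ x l) θ *
        ∑ i, ∑ j, ∑ p, F.kappa₃ θ i j p * F.D θ i j * F.D θ p l) / 2 := by
  have h1 : ∀ i j, F.mean (fun x => (J x - F.mean J θ) * F.B m θ x i * F.B m θ x j) θ =
      F.mean (fun x => J x * F.B m θ x i * F.B m θ x j) θ - F.mean J θ * (m * F.V θ i j) := by
    intro i j
    have h1 := ((expInt_one (F := F) (m := m)).mul_B θ i).mul_B θ j
    rw [← mean_B_mul_B hθ]
    simp only [one_mul] at h1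
    have h2 := h1.integrable hθ
    have h3 := ((hJ.mul_B θ i).mul_B θ j).integrable hθ
    simp only [mul_assoc] at h3 ⊢
    exact mean_sub_mul _ h3 h2
  have h2 : ∀ l, F.mean (fun x => (J x - F.mean J θ) * F.B m θ x l) θ =
      F.mean (fun x => J x * F.B m θ x l) θ := by
    intro l
    have h1 := (expInt_one (F := F) (m := m)).mul_B θ l
    simp only [one_mul] at h1
    have h2 := h1.integrable hθ
    have h3 := mean_B (F := F) (m := m) hθ l
    rw [mean_sub_mul _ ((hJ.mul_B θ l).integrable hθ) h2, h3, mul_zero, sub_zero]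
  have h3 : ∑ i, ∑ j, (F.mean (fun x => J x * F.B m θ x i * F.B m θ x j) θ -
      F.mean J θ * (m * F.V θ i j)) * F.D θ i j =
      (∑ i, ∑ j, F.D θ i j * F.mean (fun x => J x * F.B m θ x i * F.B m θ x j) θ) -
        m * k * F.mean J θ := by
    rw [← sum_D_mul_V hθ hV]
    simp only [Finset.mul_sum, Finset.sum_mul, ← Finset.sum_sub_distrib]
    exact Finset.sum_congr rfl fun i _ => Finset.sum_congr rfl fun j _ => by ring
  simp_rw [h1, h2]
  rw [h3, R_eq_sums hJ hθ, Finset.sum_div]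
  have h4 : ∀ l, F.a₁₁ θ l * F.mean (fun x => J x * F.B m θ x l) θ =
      F.mean (fun x => J x * F.B m θ x l) θ *
        (∑ i, ∑ j, ∑ p, F.kappa₃ θ i j p * F.D θ i j * F.D θ p l) / 2 := fun l => by
    rw [a₁₁_eq hθ]; ring
  simp_rw [h4]
  ring

end ExpFamily

/-! ### Expansions of characteristic functions at the origin -/

section TaylorBounds

lemma abs_cos_sub_le (x : ℝ) : |Real.cos x - 1 + x ^ 2 / 2| ≤ |x| ^ 4 := by
  have h0 := Real.one_sub_sq_div_two_le_cos (x := x)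
  rw [abs_of_nonneg (by linarith), ← sq_abs x]
  rcases le_total |x| 1 with h | h
  · have := abs_le.1 (Real.cos_bound h)
    rw [← sq_abs x] at this
    nlinarith [pow_nonneg (abs_nonneg x) 4]
  · have h1 := Real.cos_le_one x
    have h2 : |x| ^ 2 ≤ |x| ^ 4 := pow_le_pow_right₀ h (by norm_num)
    nlinarith [sq_nonneg |x|]

lemma abs_sin_sub_self_le (x : ℝ) : |Real.sin x - x| ≤ |x| ^ 3 := by
  rw [abs_sub_comm]
  have := Real.abs_sub_sin_le x
  have := pow_nonneg (abs_nonneg x) 3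
  linarith

lemma abs_sin_sub_self_le_sq (x : ℝ) : |Real.sin x - x| ≤ 2 * |x| ^ 2 := by
  rcases le_total |x| 1 with h | h
  · have h1 := abs_sin_sub_self_le x
    have h2 : |x| ^ 3 ≤ |x| ^ 2 := pow_le_pow_of_le_one (abs_nonneg x) h (by norm_num)
    nlinarith [sq_nonneg |x|]
  · have h1 := abs_sub (Real.sin x) x
    have h2 := Real.abs_sin_le_one x
    nlinarith

lemma abs_sin_sub_cubic_le (x : ℝ) : |Real.sin x - x + x ^ 3 / 6| ≤ |x| ^ 5 := by
  rcases le_total |x| 1 with h | h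
  · have h1 := Real.sin_bound h
    rw [show Real.sin x - x + x ^ 3 / 6 = Real.sin x - (x - x ^ 3 / 6) by ring]
    have h2 := pow_nonneg (abs_nonneg x) 5
    linarith
  · have h1 := Real.abs_sub_sin_le x
    rw [abs_sub_comm] at h1
    have h2 := abs_add_le (Real.sin x - x) (x ^ 3 / 6)
    rw [abs_div, abs_pow, abs_of_pos (by norm_num : (0 : ℝ) < 6)] at h2
    have h3 : |x| ^ 3 ≤ |x| ^ 5 := pow_le_pow_right₀ h (by norm_num)
    have := pow_nonneg (abs_nonneg x) 3
    linarith

end TaylorBounds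

section FourierExpansion

lemma ofReal_mul_exp_mul_I (y t : ℝ) :
    (y : ℂ) * Complex.exp ((t : ℝ) * Complex.I) =
      ((y * Real.cos t : ℝ) : ℂ) + ((y * Real.sin t : ℝ) : ℂ) * Complex.I := by
  rw [Complex.exp_mul_I]; push_cast; ring

variable {X : Type*} [MeasurableSpace X] {P : Measure X}
  {E : Type*} [NormedAddCommGroup E] [InnerProductSpace ℝ E]
  {f : X → ℝ} {Y : X → E} {p q : ℕ}

/-- The Fourier transform `φ ↦ E[f e^{i⟨φ, Y⟩}]`. -/
def fourierMean (P : Measure X) (f : X → ℝ) (Y : X → E) (φ : E) : ℂ :=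
  ∫ x, (f x : ℂ) * Complex.exp ((⟪φ, Y x⟫ : ℝ) * Complex.I) ∂P

lemma norm_fourierMean_le (φ : E) : ‖fourierMean P f Y φ‖ ≤ ∫ x, |f x| ∂P := by
  refine (norm_integral_le_integral_norm _).trans (le_of_eq ?_)
  congr 1; ext x
  rw [norm_mul, Complex.norm_exp_ofReal_mul_I, mul_one, Complex.norm_real, Real.norm_eq_abs]

lemma norm_fourierMean_one_le_one [IsProbabilityMeasure P] (φ : E) :
    ‖fourierMean P (fun _ => 1) Y φ‖ ≤ 1 := by
  simpa using norm_fourierMean_le (P := P) (f := fun _ => 1) (Y := Y) φ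

lemma abs_mul_inner_pow_le {X : Type*} {f : X → ℝ} {Y : X → E} (hpq : p ≤ q) (φ : E) (x : X) :
    |f x| * |⟪φ, Y x⟫| ^ p ≤ ‖φ‖ ^ p * (|f x| * (1 + ‖Y x‖) ^ q) := by
  have h1 : |⟪φ, Y x⟫| ^ p ≤ (‖φ‖ * ‖Y x‖) ^ p :=
    pow_le_pow_left₀ (abs_nonneg _) (abs_real_inner_le_norm _ _) _
  have h2 : ‖Y x‖ ^ p ≤ (1 + ‖Y x‖) ^ q :=
    (pow_le_pow_left₀ (norm_nonneg _) (by linarith) p).trans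
      (pow_le_pow_right₀ (by linarith [norm_nonneg (Y x)]) hpq)
  calc |f x| * |⟪φ, Y x⟫| ^ p ≤ |f x| * (‖φ‖ ^ p * ‖Y x‖ ^ p) := by rw [← mul_pow]; gcongr
    _ ≤ |f x| * (‖φ‖ ^ p * (1 + ‖Y x‖) ^ q) := by gcongr
    _ = _ := by ring

lemma abs_integral_le_of_inner_pow {w : X → ℝ} (C : ℝ) (hC : 0 ≤ C)
    (hint : Integrable (fun x => |f x| * (1 + ‖Y x‖) ^ q) P) (hpq : p ≤ q) (φ : E)
    (hw : ∀ x, |w x| ≤ C * (|f x| * |⟪φ, Y x⟫| ^ p)) :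
    |∫ x, w x ∂P| ≤ (C * ∫ x, |f x| * (1 + ‖Y x‖) ^ q ∂P) * ‖φ‖ ^ p := by
  have := norm_integral_le_of_norm_le (f := w) (hint.const_mul (C * ‖φ‖ ^ p))
    (ae_of_all _ fun x => by
      rw [Real.norm_eq_abs, mul_assoc]
      exact (hw x).trans (mul_le_mul_of_nonneg_left (abs_mul_inner_pow_le hpq φ x) hC))
  rw [Real.norm_eq_abs, integral_const_mul] at this
  linarith

variable [MeasurableSpace E] [BorelSpace E] [SecondCountableTopology E]

lemma integrable_fourierMean (hY : Measurable Y) (hfi : Integrable f P) (φ : E) :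
    Integrable (fun x => (f x : ℂ) * Complex.exp ((⟪φ, Y x⟫ : ℝ) * Complex.I)) P := by
  refine hfi.ofReal.mul_bdd (c := 1) (by fun_prop) (ae_of_all _ fun x => ?_)
  rw [Complex.norm_exp_ofReal_mul_I]

lemma fourierMean_re (hY : Measurable Y) (hfi : Integrable f P) (φ : E) :
    (fourierMean P f Y φ).re = ∫ x, f x * Real.cos ⟪φ, Y x⟫ ∂P := by
  rw [fourierMean, ← RCLike.re_eq_complex_re, ← integral_re (integrable_fourierMean hY hfi φ)]
  congr 1; ext x
  rw [ofReal_mul_exp_mul_I]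
  simp only [RCLike.re_eq_complex_re, Complex.add_re, Complex.ofReal_re, Complex.re_ofReal_mul,
    Complex.I_re, mul_zero, add_zero]

lemma fourierMean_im (hY : Measurable Y) (hfi : Integrable f P) (φ : E) :
    (fourierMean P f Y φ).im = ∫ x, f x * Real.sin ⟪φ, Y x⟫ ∂P := by
  rw [fourierMean, ← RCLike.im_eq_complex_im, ← integral_im (integrable_fourierMean hY hfi φ)]
  congr 1; ext x
  rw [ofReal_mul_exp_mul_I]
  simp only [RCLike.im_eq_complex_im, Complex.add_im, Complex.ofReal_im, Complex.im_ofReal_mul,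
    Complex.I_im, mul_one, zero_add]

lemma continuous_fourierMean (hY : Measurable Y) (hfi : Integrable f P) :
    Continuous (fourierMean P f Y) := by
  refine continuous_of_dominated (bound := fun x => |f x|)
    (fun φ => (integrable_fourierMean hY hfi φ).1) (fun φ => ae_of_all _ fun x => ?_) hfi.abs
    (ae_of_all _ fun x => by fun_prop)
  rw [norm_mul, Complex.norm_exp_ofReal_mul_I, mul_one, Complex.norm_real, Real.norm_eq_abs]

lemma integrable_mul_inner_pow (hY : Measurable Y) (hf : Measurable f)
    (hint : Integrable (fun x => |f x| * (1 + ‖Y x‖) ^ q) P) (hpq : p ≤ q) (φ : E) :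
    Integrable (fun x => f x * ⟪φ, Y x⟫ ^ p) P := by
  refine (hint.const_mul (‖φ‖ ^ p)).mono' (by fun_prop) (ae_of_all _ fun x => ?_)
  rw [Real.norm_eq_abs, abs_mul, abs_pow]
  exact abs_mul_inner_pow_le hpq φ x

lemma integrable_of_one_add_pow (hf : Measurable f) (hY : Measurable Y)
    (hint : Integrable (fun x => |f x| * (1 + ‖Y x‖) ^ q) P) : Integrable f P := by
  have h := integrable_mul_inner_pow hY hf hint (Nat.zero_le q) 0
  simpa using h

/-- The Fourier transform of a centred function `f` along `Y`: the real part of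
`E[f e^{i⟨φ, Y⟩}]` is `E[f cos ⟨φ, Y⟩]`, and the imaginary part `E[f sin ⟨φ, Y⟩]`. -/
lemma vanishingExpansion_fourierMean {K : ℝ} (hf : Measurable f) (hY : Measurable Y)
    (hint : Integrable (fun x => |f x| * (1 + ‖Y x‖) ^ 4) P)
    (hK : ∫ x, |f x| * (1 + ‖Y x‖) ^ 4 ∂P ≤ K) (h0 : ∫ x, f x ∂P = 0) :
    VanishingExpansion K (fourierMean P f Y) (fun φ => -(∫ x, f x * ⟪φ, Y x⟫ ^ 2 ∂P) / 2)
      (fun φ => ∫ x, f x * ⟪φ, Y x⟫ ∂P) := by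
  have hfi := integrable_of_one_add_pow hf hY hint
  have hK' : ∀ p : ℕ, ∀ φ : E, (1 * ∫ x, |f x| * (1 + ‖Y x‖) ^ 4 ∂P) * ‖φ‖ ^ p ≤ K * ‖φ‖ ^ p :=
    fun p φ => by rw [one_mul]; gcongr
  have i1 := fun φ => integrable_mul_inner_pow hY hf hint (p := 1) (by norm_num) φ
  have i2 := fun φ => integrable_mul_inner_pow hY hf hint (p := 2) (by norm_num) φ
  have ic : ∀ φ, Integrable (fun x => f x * Real.cos ⟪φ, Y x⟫) P := fun φ =>
    hfi.mul_bdd (c := 1) (by fun_prop) (ae_of_all _ fun x => Real.abs_cos_le_one _)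
  have is : ∀ φ, Integrable (fun x => f x * Real.sin ⟪φ, Y x⟫) P := fun φ =>
    hfi.mul_bdd (c := 1) (by fun_prop) (ae_of_all _ fun x => Real.abs_sin_le_one _)
  simp only [pow_one] at i1
  refine ⟨fun φ => ?_, fun φ => ?_, fun φ => ?_, fun φ => ?_, fun φ => ?_⟩
  · refine (norm_fourierMean_le φ).trans (le_trans ?_ hK)
    refine integral_mono hfi.abs hint fun x => ?_
    exact le_mul_of_one_le_right (abs_nonneg _) (one_le_pow₀ (by linarith [norm_nonneg (Y x)]))
  · have e : (fourierMean P f Y φ).re - -(∫ x, f x * ⟪φ, Y x⟫ ^ 2 ∂P) / 2 =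
        ∫ x, (f x * Real.cos ⟪φ, Y x⟫ - f x) + f x * ⟪φ, Y x⟫ ^ 2 / 2 ∂P := by
      rw [integral_add (by exact (ic φ).sub hfi) ((i2 φ).div_const 2), integral_sub (ic φ) hfi, h0,
        integral_div, fourierMean_re hY hfi]
      ring
    rw [e]
    refine (abs_integral_le_of_inner_pow 1 zero_le_one hint (p := 4) le_rfl φ fun x => ?_).trans
      (hK' 4 φ)
    rw [one_mul, show f x * Real.cos ⟪φ, Y x⟫ - f x + f x * ⟪φ, Y x⟫ ^ 2 / 2 =
      f x * (Real.cos ⟪φ, Y x⟫ - 1 + ⟪φ, Y x⟫ ^ 2 / 2) by ring, abs_mul]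
    gcongr
    exact abs_cos_sub_le _
  · rw [fourierMean_im hY hfi, ← integral_sub (is φ) (i1 φ)]
    refine (abs_integral_le_of_inner_pow 1 zero_le_one hint (p := 3) (by norm_num) φ
      fun x => ?_).trans (hK' 3 φ)
    rw [one_mul, ← mul_sub, abs_mul]
    gcongr
    exact abs_sin_sub_self_le _
  · have e : -(∫ x, f x * ⟪φ, Y x⟫ ^ 2 ∂P) / 2 = ∫ x, -(f x * ⟪φ, Y x⟫ ^ 2) / 2 ∂P := by
      rw [integral_div, integral_neg]
    rw [e]
    refine (abs_integral_le_of_inner_pow 1 zero_le_one hint (p := 2) (by norm_num) φ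
      fun x => ?_).trans (hK' 2 φ)
    rw [one_mul, abs_div, abs_neg, abs_mul, abs_pow, abs_two]
    have : 0 ≤ |f x| * |⟪φ, Y x⟫| ^ 2 := by positivity
    linarith
  · refine (abs_integral_le_of_inner_pow 1 zero_le_one hint (p := 1) (by norm_num) φ
      fun x => ?_).trans ((hK' 1 φ).trans (by rw [pow_one]))
    rw [one_mul, abs_mul, pow_one]

/-- A characteristic function of a centred vector with five moments has a third order expansion. -/
lemma cubicExpansion_fourierMean [IsProbabilityMeasure P] {c K : ℝ} (hY : Measurable Y)
    (hint : Integrable (fun x => (1 + ‖Y x‖) ^ 5) P) (hK : ∫ x, (1 + ‖Y x‖) ^ 5 ∂P ≤ K)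
    (h0 : ∀ φ, ∫ x, ⟪φ, Y x⟫ ∂P = 0) (hlow : ∀ φ, c * ‖φ‖ ^ 2 ≤ ∫ x, ⟪φ, Y x⟫ ^ 2 ∂P) :
    CubicExpansion c K (fourierMean P (fun _ => 1) Y) (fun φ => ∫ x, ⟪φ, Y x⟫ ^ 2 ∂P)
      (fun φ => (∫ x, ⟪φ, Y x⟫ ^ 3 ∂P) / 6) := by
  have hint' : Integrable (fun x => |(1 : ℝ)| * (1 + ‖Y x‖) ^ 5) P := by simpa using hint
  have hfi : Integrable (fun _ : X => (1 : ℝ)) P := integrable_const _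
  have hf : Measurable fun _ : X => (1 : ℝ) := measurable_const
  have hK' : ∀ p : ℕ, ∀ φ : E, (1 * ∫ x, |(1 : ℝ)| * (1 + ‖Y x‖) ^ 5 ∂P) * ‖φ‖ ^ p ≤
      K * ‖φ‖ ^ p := fun p φ => by rw [one_mul]; simp only [abs_one, one_mul]; gcongr
  have i1 := fun φ => integrable_mul_inner_pow hY hf hint' (p := 1) (by norm_num) φ
  have i2 := fun φ => integrable_mul_inner_pow hY hf hint' (p := 2) (by norm_num) φ
  have i3 := fun φ => integrable_mul_inner_pow hY hf hint' (p := 3) (by norm_num) φ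
  have ic : ∀ φ, Integrable (fun x => Real.cos ⟪φ, Y x⟫) P := fun φ =>
    Integrable.of_bound (by fun_prop) 1 (ae_of_all _ fun x => Real.abs_cos_le_one _)
  have is : ∀ φ, Integrable (fun x => Real.sin ⟪φ, Y x⟫) P := fun φ =>
    Integrable.of_bound (by fun_prop) 1 (ae_of_all _ fun x => Real.abs_sin_le_one _)
  simp only [pow_one, one_mul] at i1 i2 i3
  refine ⟨fun φ => ?_, fun φ => ?_, hlow, fun φ => ?_, fun φ => ?_⟩
  · have e : (fourierMean P (fun _ => 1) Y φ).re - 1 + (∫ x, ⟪φ, Y x⟫ ^ 2 ∂P) / 2 =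
        ∫ x, (Real.cos ⟪φ, Y x⟫ - 1) + ⟪φ, Y x⟫ ^ 2 / 2 ∂P := by
      rw [integral_add (by exact (ic φ).sub hfi) ((i2 φ).div_const 2), integral_sub (ic φ) hfi,
        integral_div, fourierMean_re hY hfi]
      simp
    rw [e]
    refine (abs_integral_le_of_inner_pow 1 zero_le_one hint' (p := 4) (by norm_num) φ
      fun x => ?_).trans (hK' 4 φ)
    simpa using abs_cos_sub_le _
  · have e : (fourierMean P (fun _ => 1) Y φ).im + (∫ x, ⟪φ, Y x⟫ ^ 3 ∂P) / 6 =
        ∫ x, (Real.sin ⟪φ, Y x⟫ - ⟪φ, Y x⟫) + ⟪φ, Y x⟫ ^ 3 / 6 ∂P := by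
      rw [integral_add (by exact (is φ).sub (i1 φ)) ((i3 φ).div_const 6),
        integral_sub (is φ) (i1 φ),
        integral_div, fourierMean_im hY hfi, h0]
      simp
    rw [e]
    refine (abs_integral_le_of_inner_pow 1 zero_le_one hint' (p := 5) le_rfl φ
      fun x => ?_).trans (hK' 5 φ)
    simpa using abs_sin_sub_cubic_le _
  · refine (le_abs_self _).trans ((abs_integral_le_of_inner_pow 1 zero_le_one hint' (p := 2)
      (by norm_num) φ fun x => ?_).trans (hK' 2 φ))
    simp
  · have e : (∫ x, ⟪φ, Y x⟫ ^ 3 ∂P) / 6 = ∫ x, ⟪φ, Y x⟫ ^ 3 / 6 ∂P := by rw [integral_div]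
    rw [e]
    refine (abs_integral_le_of_inner_pow 1 zero_le_one hint' (p := 3) (by norm_num) φ
      fun x => ?_).trans (hK' 3 φ)
    rw [abs_div, abs_pow, abs_of_pos (by norm_num : (0 : ℝ) < 6), abs_one, one_mul, one_mul]
    have : 0 ≤ |⟪φ, Y x⟫| ^ 3 := by positivity
    linarith

lemma norm_fourierMean_one_sub_one_le [IsProbabilityMeasure P] {K : ℝ} (hY : Measurable Y)
    (hint : Integrable (fun x => (1 + ‖Y x‖) ^ 5) P) (hK : 3 * ∫ x, (1 + ‖Y x‖) ^ 5 ∂P ≤ K)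
    (h0 : ∀ φ, ∫ x, ⟪φ, Y x⟫ ∂P = 0) (φ : E) :
    ‖fourierMean P (fun _ => 1) Y φ - 1‖ ≤ K * ‖φ‖ ^ 2 := by
  have hint' : Integrable (fun x => |(1 : ℝ)| * (1 + ‖Y x‖) ^ 5) P := by simpa using hint
  have hfi : Integrable (fun _ : X => (1 : ℝ)) P := integrable_const _
  have i1 := integrable_mul_inner_pow hY measurable_const hint' (p := 1) (by norm_num) φ
  have ic : Integrable (fun x => Real.cos ⟪φ, Y x⟫) P :=
    Integrable.of_bound (by fun_prop) 1 (ae_of_all _ fun x => Real.abs_cos_le_one _)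
  have is : Integrable (fun x => Real.sin ⟪φ, Y x⟫) P :=
    Integrable.of_bound (by fun_prop) 1 (ae_of_all _ fun x => Real.abs_sin_le_one _)
  simp only [pow_one, one_mul] at i1
  refine (Complex.norm_le_abs_re_add_abs_im _).trans ?_
  have e1 : (fourierMean P (fun _ => 1) Y φ - 1).re = ∫ x, Real.cos ⟪φ, Y x⟫ - 1 ∂P := by
    rw [integral_sub ic hfi, Complex.sub_re, fourierMean_re hY hfi]; simp
  have e2 : (fourierMean P (fun _ => 1) Y φ - 1).im = ∫ x, Real.sin ⟪φ, Y x⟫ - ⟪φ, Y x⟫ ∂P := by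
    rw [integral_sub is i1, Complex.sub_im, fourierMean_im hY hfi, h0]; simp
  have b1 := abs_integral_le_of_inner_pow 1 zero_le_one hint' (p := 2) (by norm_num) φ
    (w := fun x => Real.cos ⟪φ, Y x⟫ - 1) fun x => by
      have h1 := Real.one_sub_sq_div_two_le_cos (x := ⟪φ, Y x⟫)
      have h2 := Real.cos_le_one ⟪φ, Y x⟫
      rw [abs_of_nonpos (by linarith), abs_one, one_mul, one_mul, sq_abs]
      nlinarith [sq_nonneg ⟪φ, Y x⟫]
  have b2 := abs_integral_le_of_inner_pow 2 zero_le_two hint' (p := 2) (by norm_num) φ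
    (w := fun x => Real.sin ⟪φ, Y x⟫ - ⟪φ, Y x⟫) fun x => by
      simpa using abs_sin_sub_self_le_sq _
  rw [e1, e2]
  simp only [abs_one, one_mul] at b1 b2
  have : (3 * ∫ x, (1 + ‖Y x‖) ^ 5 ∂P) * ‖φ‖ ^ 2 ≤ K * ‖φ‖ ^ 2 := by gcongr
  linarith

end FourierExpansion

lemma norm_pow_sub_one_le {z : ℂ} (hz : ‖z‖ ≤ 1) (m : ℕ) : ‖z ^ m - 1‖ ≤ m * ‖z - 1‖ := by
  induction m with
  | zero => simp
  | succ m ih =>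
    rw [show z ^ (m + 1) - 1 = z ^ m * (z - 1) + (z ^ m - 1) by ring]
    refine (norm_add_le _ _).trans ?_
    rw [norm_mul, norm_pow]
    have : ‖z‖ ^ m * ‖z - 1‖ ≤ 1 * ‖z - 1‖ := by
      gcongr; exact pow_le_one₀ (norm_nonneg _) hz
    push_cast; linarith

/-! ### Bounds on characteristic functions away from the origin -/

section NonLattice

variable {X : Type*} [MeasurableSpace X] {P : Measure X}
  {E : Type*} [NormedAddCommGroup E] [InnerProductSpace ℝ E] {Y : X → E}

lemma fourierMean_one_pi [SigmaFinite P] (n : ℕ) (φ : E) :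
    fourierMean (Measure.pi fun _ : Fin n => P) (fun _ => 1) (fun x => ∑ i, Y (x i)) φ =
      fourierMean P (fun _ => 1) Y φ ^ n := by
  have h := integral_fintype_prod_eq_pow (ι := Fin n) (μ := P)
    (fun x => ((1 : ℝ) : ℂ) * Complex.exp ((⟪φ, Y x⟫ : ℝ) * Complex.I))
  rw [Fintype.card_fin] at h
  rw [fourierMean, fourierMean, ← h]
  congr 1; ext x
  simp only [Complex.ofReal_one, one_mul]
  rw [← Complex.exp_sum, inner_sum, Complex.ofReal_sum, Finset.sum_mul]

lemma fourierMean_sub_const (f : X → ℝ) (v : E) (φ : E) :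
    fourierMean P f (fun x => Y x - v) φ =
      Complex.exp ((-⟪φ, v⟫ : ℝ) * Complex.I) * fourierMean P f Y φ := by
  rw [fourierMean, fourierMean, ← integral_const_mul]
  congr 1; ext x
  rw [inner_sub_right, mul_left_comm, ← Complex.exp_add]
  congr 2; push_cast; ring

lemma norm_fourierMean_sub_const (f : X → ℝ) (v : E) (φ : E) :
    ‖fourierMean P f (fun x => Y x - v) φ‖ = ‖fourierMean P f Y φ‖ := by
  rw [fourierMean_sub_const, norm_mul, Complex.norm_exp_ofReal_mul_I, one_mul]

/-- If a characteristic function has modulus one at `φ`, then `⟨φ, Y⟩` is a lattice variable, and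
the modulus is one at all multiples of `φ`. -/
lemma norm_fourierMean_nsmul_eq_one [IsProbabilityMeasure P] {φ : E}
    (h : 1 ≤ ‖fourierMean P (fun _ => 1) Y φ‖) (j : ℕ) :
    ‖fourierMean P (fun _ => 1) Y (j • φ)‖ = 1 := by
  have h1 := ae_eq_const_or_norm_integral_lt_of_norm_le_const (μ := P) (C := 1)
    (f := fun x => ((1 : ℝ) : ℂ) * Complex.exp ((⟪φ, Y x⟫ : ℝ) * Complex.I))
    (ae_of_all _ fun x => by rw [norm_mul, Complex.norm_exp_ofReal_mul_I]; simp)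
  rcases h1 with h1 | h1
  · set z := ⨍ x, ((1 : ℝ) : ℂ) * Complex.exp ((⟪φ, Y x⟫ : ℝ) * Complex.I) ∂P with hz
    have hz1 : ‖z‖ = 1 := by
      obtain ⟨x, hx⟩ := h1.exists
      rw [Function.const_apply] at hx
      rw [← hx, norm_mul, Complex.norm_exp_ofReal_mul_I]; simp
    have h2 : fourierMean P (fun _ => 1) Y (j • φ) = z ^ j := by
      rw [fourierMean]
      have h3 : (fun x => ((1 : ℝ) : ℂ) * Complex.exp ((⟪j • φ, Y x⟫ : ℝ) * Complex.I)) =ᵐ[P]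
          fun _ => z ^ j := by
        filter_upwards [h1] with x hx
        rw [Function.const_apply] at hx
        rw [← hx, Complex.ofReal_one, one_mul, one_mul, ← Complex.exp_nat_mul,
          ← Nat.cast_smul_eq_nsmul ℝ, real_inner_smul_left]
        congr 1; push_cast; ring
      rw [integral_congr_ae h3]; simp
    rw [h2, norm_pow, hz1, one_pow]
  · rw [probReal_univ, one_mul] at h1
    exact absurd h1 (not_lt.2 h)

variable [FiniteDimensional ℝ E] [MeasurableSpace E] [BorelSpace E]

lemma charFun_map_eq_fourierMean (hY : Measurable Y) (φ : E) :
    charFun (P.map Y) φ = fourierMean P (fun _ => 1) Y φ := by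
  rw [charFun_apply, integral_map hY.aemeasurable (by fun_prop), fourierMean]
  simp [real_inner_comm]

/-- A characteristic function some power of which vanishes at infinity is bounded away from one
outside each neighbourhood of the origin. -/
lemma exists_norm_fourierMean_le [IsProbabilityMeasure P] (hY : Measurable Y) {r : ℕ}
    (h0 : Tendsto (fun φ => fourierMean P (fun _ => 1) Y φ ^ r) (cocompact E) (𝓝 0)) {δ : ℝ}
    (hδ : 0 < δ) :
    ∃ ρ : ℝ, 0 < ρ ∧ ρ < 1 ∧ ∀ φ, δ ≤ ‖φ‖ → ‖fourierMean P (fun _ => 1) Y φ‖ ≤ ρ := by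
  set χ := fourierMean P (fun _ => 1) Y with hχ
  have hcont : Continuous χ := continuous_fourierMean hY (integrable_const _)
  have hle : ∀ φ, ‖χ φ‖ ≤ 1 := fun φ => norm_fourierMean_one_le_one φ
  have hlt : ∀ φ, φ ≠ 0 → ‖χ φ‖ < 1 := by
    intro φ hφ
    by_contra hcon
    have h1 : Tendsto (fun j : ℕ => j • φ) atTop (cocompact E) := by
      rw [← Metric.cobounded_eq_cocompact, ← tendsto_norm_atTop_iff_cobounded]
      have h2 : (fun j : ℕ => ‖j • φ‖) = fun j : ℕ => (j : ℝ) * ‖φ‖ := by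
        ext j; rw [← Nat.cast_smul_eq_nsmul ℝ, norm_smul]; simp
      rw [h2]
      exact tendsto_natCast_atTop_atTop.atTop_mul_const (norm_pos_iff.2 hφ)
    have h2 := (h0.comp h1).norm
    simp only [Function.comp_def, norm_pow, norm_zero] at h2
    simp_rw [hχ, norm_fourierMean_nsmul_eq_one (not_lt.1 hcon), one_pow] at h2
    exact one_ne_zero (tendsto_nhds_unique tendsto_const_nhds h2)
  have hev : ∀ᶠ φ in cocompact E, ‖χ φ ^ r‖ < 1 / 2 := by
    have := h0.norm
    rw [norm_zero] at this
    exact this.eventually_lt_const (by norm_num)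
  obtain ⟨T, hT, hTsub⟩ := mem_cocompact.1 hev
  have hS : IsCompact (T ∩ {φ | δ ≤ ‖φ‖}) :=
    hT.inter_right (isClosed_le continuous_const continuous_norm)
  obtain ⟨ρ₁, h1, h2⟩ : ∃ ρ₁ : ℝ, ρ₁ < 1 ∧ ∀ φ ∈ T ∩ {φ | δ ≤ ‖φ‖}, ‖χ φ‖ ≤ ρ₁ := by
    rcases (T ∩ {φ | δ ≤ ‖φ‖}).eq_empty_or_nonempty with he | hne
    · exact ⟨0, one_pos, by simp [he]⟩
    · obtain ⟨φ₁, h1, h2⟩ := hS.exists_isMaxOn hne hcont.norm.continuousOn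
      refine ⟨_, hlt φ₁ ?_, fun φ hφ => h2 hφ⟩
      rintro rfl
      have := h1.2
      simp only [Set.mem_ofPred_eq, norm_zero] at this
      linarith
  -- by Bernoulli's inequality, `‖χ‖ ^ r < 1 / 2` forces `‖χ‖ ≤ 1 - 1 / (2 (r + 1))`
  have hr : (0 : ℝ) < 1 / (2 * (r + 1)) := by positivity
  refine ⟨max (1 / 2) (max ρ₁ (1 - 1 / (2 * (r + 1)))), by positivity,
    max_lt (by norm_num) (max_lt h1 (by linarith)), fun φ hφ => ?_⟩
  by_cases hφT : φ ∈ T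
  · exact (h2 φ ⟨hφT, hφ⟩).trans ((le_max_left _ _).trans (le_max_right _ _))
  · refine le_trans ?_ ((le_max_right _ _).trans (le_max_right _ _))
    have h3 : ‖χ φ ^ r‖ < 1 / 2 := hTsub hφT
    rw [norm_pow] at h3
    have h4 := one_add_mul_sub_le_pow (a := ‖χ φ‖) (by linarith [norm_nonneg (χ φ)]) r
    have h5 : (r : ℝ) * (1 - ‖χ φ‖) ≤ (r + 1) * (1 - ‖χ φ‖) := by nlinarith [hle φ]
    rw [le_sub_comm, div_le_iff₀ (by positivity)]
    nlinarith

end NonLattice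

namespace ExpFamily

variable {Ω : Type*} [MeasurableSpace Ω] {k : ℕ} {F : ExpFamily Ω k}
  {θ : EuclideanSpace ℝ (Fin k)}

variable (F) in
/-- The characteristic function of `T_1 - μ(θ)`. -/
def centredChar (θ φ : EuclideanSpace ℝ (Fin k)) : ℂ :=
  fourierMean (F.law₁ θ) (fun _ => 1) (fun x => F.T x - F.mu θ) φ

lemma fourierMean_law_B (m : ℕ) (θ φ : EuclideanSpace ℝ (Fin k)) :
    fourierMean (F.law m θ) (fun _ => 1) (F.B m θ) φ = F.centredChar θ φ ^ m :=
  fourierMean_one_pi (P := F.law₁ θ) (Y := fun x => F.T x - F.mu θ) m φ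

lemma charFun_map_stat (n : ℕ) (θ φ : EuclideanSpace ℝ (Fin k)) :
    charFun ((F.law n θ).map (F.stat n)) φ = fourierMean (F.law₁ θ) (fun _ => 1) F.T φ ^ n := by
  rw [charFun_map_eq_fourierMean (F.measurable_stat n)]
  exact fourierMean_one_pi (P := F.law₁ θ) (Y := F.T) n φ

lemma norm_centredChar (θ φ : EuclideanSpace ℝ (Fin k)) :
    ‖F.centredChar θ φ‖ = ‖fourierMean (F.law₁ θ) (fun _ => 1) F.T φ‖ :=
  norm_fourierMean_sub_const _ _ _

lemma norm_charFun_map_stat (n : ℕ) (θ φ : EuclideanSpace ℝ (Fin k)) :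
    ‖charFun ((F.law n θ).map (F.stat n)) φ‖ = ‖F.centredChar θ φ‖ ^ n := by
  rw [charFun_map_stat, norm_pow, norm_centredChar]

lemma continuous_centredChar (hθ : θ ∈ interior F.paramSpace) : Continuous (F.centredChar θ) := by
  have := F.isProbabilityMeasure_law₁ (interior_subset hθ)
  exact continuous_fourierMean (F.measurable_T.sub_const _) (integrable_const _)

lemma norm_centredChar_le_one (hθ : θ ∈ interior F.paramSpace) (φ : EuclideanSpace ℝ (Fin k)) :
    ‖F.centredChar θ φ‖ ≤ 1 := by
  have := F.isProbabilityMeasure_law₁ (interior_subset hθ)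
  exact norm_fourierMean_one_le_one φ

/-- Condition D near one parameter. -/
lemma ConditionD.eventually (hD : F.ConditionD) (hθ : θ ∈ interior F.paramSpace) :
    ∃ (r : ℕ) (M : ℝ), 0 < r ∧ ∀ᶠ θ' in 𝓝 θ,
      Integrable (fun φ => ‖F.centredChar θ' φ‖ ^ r) volume ∧
        ∫ φ, ‖F.centredChar θ' φ‖ ^ r ≤ M := by
  obtain ⟨K, hK, hKsub, hKc⟩ := local_compact_nhds (isOpen_interior.mem_nhds hθ)
  obtain ⟨r, hr, h1, M, h2⟩ := hD K hKc hKsub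
  refine ⟨r, M, hr, ?_⟩
  filter_upwards [hK] with θ' hθ'
  simp_rw [← norm_charFun_map_stat]
  exact ⟨(h1 θ' hθ').norm, h2 θ' hθ'⟩

/-- The laws of one observation depend continuously on the parameter in total variation. -/
lemma tendsto_integral_abs_density_sub (hθ : θ ∈ interior F.paramSpace) :
    Tendsto (fun θ' => ∫ x, |Real.exp (⟪θ', F.T x⟫ - F.kappa θ') -
      Real.exp (⟪θ, F.T x⟫ - F.kappa θ)| ∂F.base₁) (𝓝 θ) (𝓝 0) := by
  have hT := F.measurable_T
  obtain ⟨ε, hε, hint⟩ := ExpIntegrable.exists_exp_norm F.measurable_T isOpen_interior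
    (expInt₁_one (F := F)) hθ
  have hk := (differentiableAt_kappa hθ).continuousAt
  have hb : ∀ᶠ θ' in 𝓝 θ, |F.kappa θ' - F.kappa θ| < 1 := by
    have := (Metric.tendsto_nhds.1 hk.tendsto) 1 one_pos
    simpa [Real.dist_eq] using this
  have h0 : ∫ x, |Real.exp (⟪θ, F.T x⟫ - F.kappa θ) -
      Real.exp (⟪θ, F.T x⟫ - F.kappa θ)| ∂F.base₁ = 0 := by simp
  rw [← h0]
  refine tendsto_integral_filter_of_dominated_convergence
    (fun x => 2 * Real.exp (1 - F.kappa θ) * (|(1 : ℝ)| * Real.exp (⟪θ, F.T x⟫ + ε * ‖F.T x‖)))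
    (Eventually.of_forall fun θ' => (by fun_prop : Measurable _).aestronglyMeasurable) ?_
    (hint.const_mul _) (ae_of_all _ fun x => ?_)
  · filter_upwards [hb, Metric.ball_mem_nhds θ hε] with θ' h1 h2
    refine ae_of_all _ fun x => ?_
    have h3 := abs_lt.1 h1
    have h4 : ⟪θ', F.T x⟫ ≤ ⟪θ, F.T x⟫ + ε * ‖F.T x‖ := by
      have h5 : ⟪θ', F.T x⟫ = ⟪θ, F.T x⟫ + ⟪θ' - θ, F.T x⟫ := by rw [inner_sub_left]; ring
      have h6 := real_inner_le_norm (θ' - θ) (F.T x)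
      have h7 : ‖θ' - θ‖ * ‖F.T x‖ ≤ ε * ‖F.T x‖ := by
        gcongr; exact (mem_ball_iff_norm.1 h2).le
      linarith
    have h5 : 0 ≤ ε * ‖F.T x‖ := by positivity
    have e1 : Real.exp (⟪θ', F.T x⟫ - F.kappa θ') ≤
        Real.exp (1 - F.kappa θ + (⟪θ, F.T x⟫ + ε * ‖F.T x‖)) := Real.exp_le_exp.2 (by linarith)
    have e2 : Real.exp (⟪θ, F.T x⟫ - F.kappa θ) ≤
        Real.exp (1 - F.kappa θ + (⟪θ, F.T x⟫ + ε * ‖F.T x‖)) := Real.exp_le_exp.2 (by linarith)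
    rw [Real.norm_eq_abs, abs_abs, abs_one, one_mul, mul_assoc, ← Real.exp_add]
    refine (abs_sub _ _).trans ?_
    rw [abs_of_pos (Real.exp_pos _), abs_of_pos (Real.exp_pos _)]
    linarith
  · have hin : ContinuousAt (fun θ' : EuclideanSpace ℝ (Fin k) => ⟪θ', F.T x⟫) θ := by fun_prop
    exact (((hin.sub hk).rexp).sub continuousAt_const).abs

lemma norm_fourierMean_law₁_sub_le {θ' : EuclideanSpace ℝ (Fin k)}
    (hθ : θ ∈ interior F.paramSpace)
    (hθ' : θ' ∈ interior F.paramSpace) (φ : EuclideanSpace ℝ (Fin k)) :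
    ‖fourierMean (F.law₁ θ') (fun _ => 1) F.T φ - fourierMean (F.law₁ θ) (fun _ => 1) F.T φ‖ ≤
      ∫ x, |Real.exp (⟪θ', F.T x⟫ - F.kappa θ') - Real.exp (⟪θ, F.T x⟫ - F.kappa θ)| ∂F.base₁ := by
  have hT := F.measurable_T
  have hi : ∀ θ'' ∈ interior F.paramSpace, Integrable (fun x =>
      Real.exp (⟪θ'', F.T x⟫ - F.kappa θ'') •
        (((1 : ℝ) : ℂ) * Complex.exp ((⟪φ, F.T x⟫ : ℝ) * Complex.I))) F.base₁ := by
    intro θ'' h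
    have h1 : Integrable (fun x => Real.exp (⟪θ'', F.T x⟫ - F.kappa θ'')) F.base₁ := by
      simp_rw [Real.exp_sub]
      exact (F.integrable_exp_base₁ (interior_subset h)).div_const _
    refine h1.mono (by fun_prop) (ae_of_all _ fun x => ?_)
    rw [norm_smul, norm_mul, Complex.norm_exp_ofReal_mul_I]; simp
  rw [fourierMean, fourierMean, integral_law₁, integral_law₁, ← integral_sub (hi _ hθ') (hi _ hθ)]
  refine (norm_integral_le_integral_norm _).trans (le_of_eq ?_)
  congr 1; ext x
  rw [← sub_smul, norm_smul, norm_mul, Complex.norm_exp_ofReal_mul_I]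
  simp

/-- Condition D makes the law of `T_r` absolutely continuous, so that the Riemann–Lebesgue lemma
applies to it. -/
lemma tendsto_fourierMean_pow (hD : F.ConditionD) (hθ : θ ∈ interior F.paramSpace) :
    ∃ r : ℕ, Tendsto (fun φ => fourierMean (F.law₁ θ) (fun _ => 1) F.T φ ^ r)
      (cocompact (EuclideanSpace ℝ (Fin k))) (𝓝 0) := by
  obtain ⟨r, -, h1, -⟩ := hD {θ} isCompact_singleton (by simpa using hθ)
  refine ⟨r, ?_⟩
  simp_rw [← charFun_map_stat]
  have := F.isProbabilityMeasure_law (interior_subset hθ) r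
  exact tendsto_charFun_cocompact (h1 θ rfl)

/-- The characteristic functions are bounded away from one outside a neighbourhood of the origin,
locally uniformly in the parameter, because the bound at one parameter persists under a small
change of the law in total variation. -/
lemma eventually_tailBound (hD : F.ConditionD) (hθ : θ ∈ interior F.paramSpace) {δ : ℝ}
    (hδ : 0 < δ) :
    ∃ (ρ : ℝ) (r : ℕ) (M : ℝ), 0 < ρ ∧ ρ < 1 ∧
      ∀ᶠ θ' in 𝓝 θ, TailBound δ ρ r M (F.centredChar θ') := by
  have := F.isProbabilityMeasure_law₁ (interior_subset hθ)
  obtain ⟨r₀, hr₀⟩ := tendsto_fourierMean_pow hD hθ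
  obtain ⟨ρ, hρ0, hρ1, hρ⟩ := exists_norm_fourierMean_le F.measurable_T hr₀ hδ
  obtain ⟨r, M, -, hrM⟩ := hD.eventually hθ
  refine ⟨(1 + ρ) / 2, r, M, by linarith, by linarith, ?_⟩
  have hTV := (tendsto_integral_abs_density_sub hθ).eventually_lt_const
    (show (0 : ℝ) < (1 - ρ) / 2 by linarith)
  filter_upwards [hrM, hTV, isOpen_interior.mem_nhds hθ] with θ' h1 h2 h3
  refine ⟨(continuous_centredChar h3).measurable, norm_centredChar_le_one h3, fun φ hφ => ?_,
    h1.1, h1.2⟩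
  rw [norm_centredChar]
  have h4 := norm_fourierMean_law₁_sub_le hθ h3 φ
  have h5 := norm_sub_norm_le (fourierMean (F.law₁ θ') (fun _ => 1) F.T φ)
    (fourierMean (F.law₁ θ) (fun _ => 1) F.T φ)
  have h6 := hρ φ hφ.le
  linarith

end ExpFamily

/-! ### Locally uniform expansion of the Fourier integrals of the family -/

namespace ExpFamily

variable {Ω : Type*} [MeasurableSpace Ω] {k : ℕ} {F : ExpFamily Ω k}
  {θ : EuclideanSpace ℝ (Fin k)} {m : ℕ} {J Jbar : (Fin m → Ω) → ℝ}

lemma quadForm_V (hθ : θ ∈ interior F.paramSpace) (φ : EuclideanSpace ℝ (Fin k)) :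
    quadForm (F.V θ) φ = ∫ x, ⟪φ, F.T x - F.mu θ⟫ ^ 2 ∂F.law₁ θ := by
  have h1 : ∀ i j, Integrable (fun x => (1 : ℝ) * (F.T x - F.mu θ) i * (F.T x - F.mu θ) j)
      (F.law₁ θ) := fun i j => by
    simpa using (((expInt₁_one (F := F)).mul_coord_sub i (F.mu θ i)).mul_coord_sub j
      (F.mu θ j)).integrable hθ
  have h2 := integral_mul_inner_sq h1 φ
  simp only [one_mul] at h2
  rw [h2, quadForm]
  refine Finset.sum_congr rfl fun i _ => Finset.sum_congr rfl fun j _ => ?_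
  rw [V_eq_central hθ]; rfl

lemma cubicForm_kappa₃ (hθ : θ ∈ interior F.paramSpace) (φ : EuclideanSpace ℝ (Fin k)) :
    ∫ x, ⟪φ, F.T x - F.mu θ⟫ ^ 3 ∂F.law₁ θ =
      ∑ i, ∑ j, ∑ l, F.kappa₃ θ i j l * φ i * φ j * φ l := by
  have h1 : ∀ i j l, Integrable (fun x => (1 : ℝ) * (F.T x - F.mu θ) i * (F.T x - F.mu θ) j *
      (F.T x - F.mu θ) l) (F.law₁ θ) := fun i j l => by
    simpa using ((((expInt₁_one (F := F)).mul_coord_sub i (F.mu θ i)).mul_coord_sub j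
      (F.mu θ j)).mul_coord_sub l (F.mu θ l)).integrable hθ
  have h2 := integral_mul_inner_cube h1 φ
  simp only [one_mul] at h2
  rw [h2]
  refine Finset.sum_congr rfl fun i _ => Finset.sum_congr rfl fun j _ =>
    Finset.sum_congr rfl fun l _ => ?_
  rw [kappa₃_eq_central hθ]; rfl

lemma integral_inner_T_sub (hθ : θ ∈ interior F.paramSpace) (φ : EuclideanSpace ℝ (Fin k)) :
    ∫ x, ⟪φ, F.T x - F.mu θ⟫ ∂F.law₁ θ = 0 := by
  have h1 : ∀ i, Integrable (fun x => (1 : ℝ) * (F.T x - F.mu θ) i) (F.law₁ θ) := fun i => by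
    simpa using ((expInt₁_one (F := F)).mul_coord_sub i (F.mu θ i)).integrable hθ
  have h2 := integral_mul_inner h1 φ
  simp only [one_mul] at h2
  rw [h2]
  refine Finset.sum_eq_zero fun i _ => ?_
  have := mean₁_coord_sub hθ i
  rw [mean₁] at this
  simp only [PiLp.sub_apply]
  rw [this, zero_mul]

/-- Condition D excludes that `T` is concentrated on a hyperplane. -/
lemma quadForm_V_pos (hD : F.ConditionD) (hθ : θ ∈ interior F.paramSpace)
    {φ : EuclideanSpace ℝ (Fin k)} (hφ : φ ≠ 0) : 0 < quadForm (F.V θ) φ := by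
  have := F.isProbabilityMeasure_law₁ (interior_subset hθ)
  rw [quadForm_V hθ]
  refine lt_of_le_of_ne (integral_nonneg fun x => sq_nonneg _) fun h0 => ?_
  obtain ⟨ρ, r, M, -, hρ, hev⟩ := eventually_tailBound hD hθ (half_pos (norm_pos_iff.2 hφ))
  have h1 := hev.self_of_nhds.norm_le φ (half_lt_self (norm_pos_iff.2 hφ))
  have hint : Integrable (fun x => ⟪φ, F.T x - F.mu θ⟫ ^ 2) (F.law₁ θ) := by
    have h2 : ∀ i j, Integrable (fun x => φ i * φ j *
        ((F.T x i - F.mu θ i) * (F.T x j - F.mu θ j))) (F.law₁ θ) := fun i j => by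
      refine Integrable.const_mul ?_ _
      simpa using (((expInt₁_one (F := F)).mul_coord_sub i (F.mu θ i)).mul_coord_sub j
        (F.mu θ j)).integrable hθ
    refine (integrable_finsetSum Finset.univ fun i _ => integrable_finsetSum Finset.univ
      fun j _ => h2 i j).congr (ae_of_all _ fun x => ?_)
    simp only
    rw [sum_coord_eq_inner, pow_two, Finset.sum_mul_sum]
    exact Finset.sum_congr rfl fun i _ => Finset.sum_congr rfl fun j _ => by
      simp only [PiLp.sub_apply]; ring
  have h2 := (integral_eq_zero_iff_of_nonneg (fun x => sq_nonneg _) hint).1 h0.symm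
  have h3 : F.centredChar θ φ = 1 := by
    rw [centredChar, fourierMean]
    have h4 : (fun x => ((1 : ℝ) : ℂ) * Complex.exp ((⟪φ, F.T x - F.mu θ⟫ : ℝ) * Complex.I))
        =ᵐ[F.law₁ θ] fun _ => 1 := by
      filter_upwards [h2] with x hx
      have : ⟪φ, F.T x - F.mu θ⟫ = 0 := by simpa using hx
      rw [this]; simp
    rw [integral_congr_ae h4]; simp
  rw [h3, norm_one] at h1
  linarith

lemma isUnit_det_V (hD : F.ConditionD) (hθ : θ ∈ interior F.paramSpace) :
    IsUnit (F.V θ).det := by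
  rw [isUnit_iff_ne_zero]
  intro h
  obtain ⟨v, hv, hVv⟩ := Matrix.exists_mulVec_eq_zero_iff.2 h
  have h1 := quadForm_V_pos hD hθ (φ := WithLp.toLp 2 v) (by simpa using hv)
  have h2 : quadForm (F.V θ) (WithLp.toLp 2 v) = v ⬝ᵥ (F.V θ *ᵥ v) := by
    simp only [quadForm, dotProduct, Matrix.mulVec, Finset.mul_sum]
    exact Finset.sum_congr rfl fun i _ => Finset.sum_congr rfl fun j _ => by ring
  rw [h2, hVv, dotProduct_zero] at h1
  exact lt_irrefl _ h1

lemma continuousAt_V (hθ : θ ∈ interior F.paramSpace) (i j : Fin k) :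
    ContinuousAt (fun θ' => F.V θ' i j) θ := by
  have h : (fun θ' => F.V θ' i j) =ᶠ[𝓝 θ] fun θ' => F.mean₁ (fun x => F.T x j * F.T x i) θ' -
      F.mean₁ (fun x => F.T x i) θ' * F.mean₁ (fun x => F.T x j) θ' := by
    filter_upwards [isOpen_interior.mem_nhds hθ] with θ' h
    rw [V_apply h, mu_apply h, mu_apply h]
  refine ContinuousAt.congr ?_ h.symm
  exact (((expInt₁_coord j).mul_coord i).differentiableAt hθ).continuousAt.sub
    (((expInt₁_coord i).differentiableAt hθ).continuousAt.mul
      ((expInt₁_coord j).differentiableAt hθ).continuousAt)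

/-- The smallest eigenvalue of the covariance matrix is bounded away from zero locally. -/
lemma eventually_le_quadForm_V (hD : F.ConditionD) (hθ : θ ∈ interior F.paramSpace) :
    ∃ c : ℝ, 0 < c ∧ ∀ᶠ θ' in 𝓝 θ, ∀ φ, c * ‖φ‖ ^ 2 ≤ quadForm (F.V θ') φ := by
  obtain ⟨c, hc, h⟩ := exists_le_quadForm fun φ => quadForm_V_pos hD hθ (φ := φ)
  refine ⟨c / 2, half_pos hc, ?_⟩
  have hε : 0 < c / (2 * (k ^ 2 + 1)) := by positivity
  have hev : ∀ᶠ θ' in 𝓝 θ, ∀ i j, |F.V θ' i j - F.V θ i j| ≤ c / (2 * (k ^ 2 + 1)) := by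
    refine eventually_all.2 fun i => eventually_all.2 fun j => ?_
    filter_upwards [Metric.tendsto_nhds.1 (continuousAt_V hθ i j).tendsto _ hε] with θ' h
    exact (Real.dist_eq _ _ ▸ h).le
  filter_upwards [hev] with θ' h1 φ
  have h2 := abs_quadForm_le (W := F.V θ' - F.V θ) h1 φ
  have h3 : quadForm (F.V θ' - F.V θ) φ = quadForm (F.V θ') φ - quadForm (F.V θ) φ := by
    simp only [quadForm, Matrix.sub_apply, sub_mul, Finset.sum_sub_distrib]
  have h4 : c / (2 * ((k : ℝ) ^ 2 + 1)) * k ^ 2 ≤ c / 2 := by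
    rw [div_mul_eq_mul_div, div_le_div_iff₀ (by positivity) two_pos]
    nlinarith
  have h5 : c / (2 * ((k : ℝ) ^ 2 + 1)) * k ^ 2 * ‖φ‖ ^ 2 ≤ c / 2 * ‖φ‖ ^ 2 := by gcongr
  have h6 := (abs_le.1 h2).1
  have h7 := h φ
  linarith

lemma eventually_norm_mu_le (hθ : θ ∈ interior F.paramSpace) :
    ∃ M : ℝ, 0 ≤ M ∧ ∀ᶠ θ' in 𝓝 θ, ‖F.mu θ'‖ ≤ M := by
  have h1 : ContDiffAt ℝ 2 F.kappa θ :=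
    (contDiffOn_kappa 2).contDiffAt (isOpen_interior.mem_nhds hθ)
  have h2 : ContinuousAt (fderiv ℝ F.kappa) θ :=
    (h1.fderiv_right (m := 1) (by norm_num)).continuousAt
  refine ⟨‖fderiv ℝ F.kappa θ‖ + 1, by positivity, ?_⟩
  filter_upwards [h2.norm.eventually_lt_const (lt_add_one _)] with θ' h
  rw [mu, gradient, LinearIsometryEquiv.norm_map]
  exact h.le

lemma one_add_norm_T_sub_le (θ : EuclideanSpace ℝ (Fin k)) (x : Ω) :
    1 + ‖F.T x - F.mu θ‖ ≤ (1 + ‖F.mu θ‖) * (1 + ‖F.T x‖) := by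
  have h := norm_sub_le (F.T x) (F.mu θ)
  nlinarith [norm_nonneg (F.T x), norm_nonneg (F.mu θ)]

lemma one_add_norm_B_le (θ : EuclideanSpace ℝ (Fin k)) (x : Fin m → Ω) :
    1 + ‖F.B m θ x‖ ≤ (1 + m * ‖F.mu θ‖) * (1 + ‖F.stat m x‖) := by
  have h := norm_sub_le (F.stat m x) ((m : ℝ) • F.mu θ)
  rw [B_eq]
  rw [norm_smul, Real.norm_natCast] at h
  have : 0 ≤ m * ‖F.mu θ‖ := by positivity
  nlinarith [norm_nonneg (F.stat m x)]

lemma integrable_one_add_norm_pow (hθ : θ ∈ interior F.paramSpace) :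
    Integrable (fun x => (1 + ‖F.T x - F.mu θ‖) ^ 5) (F.law₁ θ) := by
  have hT := F.measurable_T
  have h := (expInt₁_one (F := F)).mul_of_le (h := fun x => (1 + ‖F.T x - F.mu θ‖) ^ 5)
    (by fun_prop) ((1 + ‖F.mu θ‖) ^ 5) 5 fun x => by
      rw [abs_of_nonneg (by positivity), ← mul_pow]
      gcongr
      exact one_add_norm_T_sub_le θ x
  simpa using h.integrable hθ

lemma ExpInt.mul_one_add_norm_B (hJ : F.ExpInt J) (θ : EuclideanSpace ℝ (Fin k)) :
    F.ExpInt fun x => J x * (1 + ‖F.B m θ x‖) ^ 4 := by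
  have hB := F.measurable_B m θ
  refine hJ.mul_of_le (by fun_prop) ((1 + m * ‖F.mu θ‖) ^ 4) 4 fun x => ?_
  rw [abs_of_nonneg (by positivity), ← mul_pow]
  gcongr
  exact one_add_norm_B_le θ x

/-- Local bound on the moments of one observation: the centring `μ(θ')` is locally bounded, and the
uncentred moments are continuous in `θ'`. -/
lemma eventually_moment₁_le (hθ : θ ∈ interior F.paramSpace) :
    ∃ K : ℝ, ∀ᶠ θ' in 𝓝 θ, ∫ x, (1 + ‖F.T x - F.mu θ'‖) ^ 5 ∂F.law₁ θ' ≤ K := by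
  have hT := F.measurable_T
  obtain ⟨M, hM, hMev⟩ := eventually_norm_mu_le hθ
  have h := (expInt₁_one (F := F)).mul_of_le (h := fun x => (1 + ‖F.T x‖) ^ 5)
    (by fun_prop) 1 5 fun x => by rw [abs_of_nonneg (by positivity), one_mul]
  simp only [one_mul] at h
  have hc := (h.differentiableAt hθ).continuousAt.eventually_lt_const (lt_add_one _)
  refine ⟨(1 + M) ^ 5 * (F.mean₁ (fun x => (1 + ‖F.T x‖) ^ 5) θ + 1), ?_⟩
  filter_upwards [hMev, hc, isOpen_interior.mem_nhds hθ] with θ' h1 h2 h3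
  calc ∫ x, (1 + ‖F.T x - F.mu θ'‖) ^ 5 ∂F.law₁ θ'
      ≤ ∫ x, (1 + M) ^ 5 * (1 + ‖F.T x‖) ^ 5 ∂F.law₁ θ' := by
        refine integral_mono (integrable_one_add_norm_pow h3) ((h.integrable h3).const_mul _)
          fun x => ?_
        simp only
        rw [← mul_pow]
        gcongr
        exact (one_add_norm_T_sub_le θ' x).trans (by gcongr)
    _ = (1 + M) ^ 5 * F.mean₁ (fun x => (1 + ‖F.T x‖) ^ 5) θ' := by rw [integral_const_mul, mean₁]
    _ ≤ _ := by gcongr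

lemma eventually_moment_le (hJ : F.ExpInt Jbar) (h0 : ∀ x, 0 ≤ Jbar x)
    (hθ : θ ∈ interior F.paramSpace) :
    ∃ K : ℝ, ∀ᶠ θ' in 𝓝 θ,
      ∫ x, (Jbar x + F.mean Jbar θ') * (1 + ‖F.B m θ' x‖) ^ 4 ∂F.law m θ' ≤ K := by
  have hS := F.measurable_stat m
  obtain ⟨M, hM, hMev⟩ := eventually_norm_mu_le hθ
  have h1 := hJ.mul_of_le (h := fun x => (1 + ‖F.stat m x‖) ^ 4)
    (by fun_prop) 1 4 fun x => by rw [abs_of_nonneg (by positivity), one_mul]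
  have h2 := (expInt_one (F := F) (m := m)).mul_of_le (h := fun x => (1 + ‖F.stat m x‖) ^ 4)
    (by fun_prop) 1 4 fun x => by rw [abs_of_nonneg (by positivity), one_mul]
  simp only [one_mul] at h2
  have c0 := (hJ.differentiableAt hθ).continuousAt.eventually_lt_const (lt_add_one _)
  have c1 := (h1.differentiableAt hθ).continuousAt.eventually_lt_const (lt_add_one _)
  have c2 := (h2.differentiableAt hθ).continuousAt.eventually_lt_const (lt_add_one _)
  refine ⟨(1 + m * M) ^ 4 * ((F.mean (fun x => Jbar x * (1 + ‖F.stat m x‖) ^ 4) θ + 1) +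
    (F.mean Jbar θ + 1) * (F.mean (fun x => (1 + ‖F.stat m x‖) ^ 4) θ + 1)), ?_⟩
  filter_upwards [hMev, c0, c1, c2, isOpen_interior.mem_nhds hθ] with θ' h3 h4 h5 h6 h7
  have hJ0 : 0 ≤ F.mean Jbar θ' := integral_nonneg h0
  have h20 : 0 ≤ F.mean (fun x => (1 + ‖F.stat m x‖) ^ 4) θ' :=
    integral_nonneg fun x => by positivity
  have i1 := (h1.integrable h7).add ((h2.integrable h7).const_mul (F.mean Jbar θ'))
  calc ∫ x, (Jbar x + F.mean Jbar θ') * (1 + ‖F.B m θ' x‖) ^ 4 ∂F.law m θ'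
      ≤ ∫ x, (1 + m * M) ^ 4 * (Jbar x * (1 + ‖F.stat m x‖) ^ 4 +
          F.mean Jbar θ' * (1 + ‖F.stat m x‖) ^ 4) ∂F.law m θ' := by
        refine integral_mono ?_ (i1.const_mul _) fun x => ?_
        · have i2 := (hJ.mul_one_add_norm_B θ').integrable h7
          have i3 := ((expInt_one (F := F) (m := m)).mul_one_add_norm_B θ').integrable h7
          simp only [one_mul] at i3
          refine (i2.add (i3.const_mul (F.mean Jbar θ'))).congr (ae_of_all _ fun x => ?_)
          simp only [Pi.add_apply]; ring
        · simp only
          rw [← add_mul, mul_left_comm, ← mul_pow]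
          have := h0 x
          gcongr
          exact (one_add_norm_B_le θ' x).trans (by gcongr)
    _ = (1 + m * M) ^ 4 * (F.mean (fun x => Jbar x * (1 + ‖F.stat m x‖) ^ 4) θ' +
          F.mean Jbar θ' * F.mean (fun x => (1 + ‖F.stat m x‖) ^ 4) θ') := by
        rw [integral_const_mul, integral_add (h1.integrable h7) ((h2.integrable h7).const_mul _),
          integral_const_mul]; rfl
    _ ≤ _ := by
        have : 0 ≤ F.mean Jbar θ + 1 := by linarith
        gcongr

lemma abs_mean_le (hJbar : F.ExpInt Jbar) (hθ : θ ∈ interior F.paramSpace)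
    (hle : ∀ᵐ x ∂F.law m θ, |J x| ≤ Jbar x) : |F.mean J θ| ≤ F.mean Jbar θ := by
  rw [← Real.norm_eq_abs]
  exact norm_integral_le_of_norm_le (hJbar.integrable hθ)
    (by simpa only [Real.norm_eq_abs] using hle)

/-- The Fourier transform of `J - E_θ J` along `B_m`. -/
lemma vanishingExpansion_sub_mean {K : ℝ} (hJbar : F.ExpInt Jbar)
    (hθ : θ ∈ interior F.paramSpace) (hJ : Measurable J)
    (hle : ∀ᵐ x ∂F.law m θ, |J x| ≤ Jbar x)
    (hK : ∫ x, (Jbar x + F.mean Jbar θ) * (1 + ‖F.B m θ x‖) ^ 4 ∂F.law m θ ≤ K) :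
    VanishingExpansion K
      (fourierMean (F.law m θ) (fun x => J x - F.mean J θ) (F.B m θ))
      (fun φ => -(∫ x, (J x - F.mean J θ) * ⟪φ, F.B m θ x⟫ ^ 2 ∂F.law m θ) / 2)
      (fun φ => ∫ x, (J x - F.mean J θ) * ⟪φ, F.B m θ x⟫ ∂F.law m θ) := by
  have := F.isProbabilityMeasure_law (interior_subset hθ) m
  have hB := F.measurable_B m θ
  have hJi := hJbar.of_abs_le hJ hle
  have i2 := (hJbar.mul_one_add_norm_B θ).integrable hθ
  have i3 := ((expInt_one (F := F) (m := m)).mul_one_add_norm_B θ).integrable hθ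
  simp only [one_mul] at i3
  have i4 : Integrable (fun x => (Jbar x + F.mean Jbar θ) * (1 + ‖F.B m θ x‖) ^ 4)
      (F.law m θ) := by
    refine (i2.add (i3.const_mul (F.mean Jbar θ))).congr (ae_of_all _ fun x => ?_)
    simp only [Pi.add_apply]; ring
  have hb : ∀ᵐ x ∂F.law m θ, |J x - F.mean J θ| * (1 + ‖F.B m θ x‖) ^ 4 ≤
      (Jbar x + F.mean Jbar θ) * (1 + ‖F.B m θ x‖) ^ 4 := by
    filter_upwards [hle] with x hx
    have := abs_mean_le hJbar hθ hle
    have := abs_sub (J x) (F.mean J θ)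
    gcongr
    linarith
  have i5 : Integrable (fun x => |J x - F.mean J θ| * (1 + ‖F.B m θ x‖) ^ 4) (F.law m θ) := by
    refine i4.mono' (by fun_prop) ?_
    filter_upwards [hb] with x hx
    rwa [Real.norm_of_nonneg (by positivity)]
  refine vanishingExpansion_fourierMean (by fun_prop) hB i5
    ((integral_mono_ae i5 i4 hb).trans hK) ?_
  rw [integral_sub (hJi.integrable hθ) (integrable_const _)]
  simp [mean]

/-- The Gaussian integral in the leading term of the expansion is the correction term. -/
lemma integral_gaussian_eq_R {c : ℝ} (hc : 0 < c) (hθ : θ ∈ interior F.paramSpace)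
    (hV : IsUnit (F.V θ).det) (hlow : ∀ φ, c * ‖φ‖ ^ 2 ≤ quadForm (F.V θ) φ) (hJ : F.ExpInt J) :
    ∫ φ, Real.exp (-((∫ x, ⟪φ, F.T x - F.mu θ⟫ ^ 2 ∂F.law₁ θ) / 2)) *
      (-(∫ x, (J x - F.mean J θ) * ⟪φ, F.B m θ x⟫ ^ 2 ∂F.law m θ) / 2 +
        (∫ x, (J x - F.mean J θ) * ⟪φ, F.B m θ x⟫ ∂F.law m θ) *
          ((∫ x, ⟪φ, F.T x - F.mu θ⟫ ^ 3 ∂F.law₁ θ) / 6)) =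
      F.R J θ * ∫ φ, Real.exp (-((∫ x, ⟪φ, F.T x - F.mu θ⟫ ^ 2 ∂F.law₁ θ) / 2)) := by
  have hJ0 : F.ExpInt fun x => J x - F.mean J θ :=
    expInt_of_integrable (hJ.measurable.sub_const _) fun θ' h => by
      have := F.isProbabilityMeasure_law (interior_subset h) m
      exact (hJ.integrable h).sub (integrable_const _)
  have h := integral_quadratic_add_linear_mul_cubic_gaussian hc (V_isSymm hθ)
    (D := F.D θ) (Matrix.mul_nonsing_inv _ hV) hlow
    (fun i j => F.mean (fun x => (J x - F.mean J θ) * F.B m θ x i * F.B m θ x j) θ)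
    (fun l => F.mean (fun x => (J x - F.mean J θ) * F.B m θ x l) θ) (F.kappa₃ θ)
    (fun i j p => (kappa₃_swap_left hθ i j p).symm) (fun i j p => (kappa₃_swap_right hθ i j p).symm)
  rw [← R_eq_gaussian hJ hθ hV] at h
  simp_rw [← quadForm_V hθ, cubicForm_kappa₃ hθ]
  rw [← h]
  congr 1; ext φ
  rw [integral_mul_inner fun i => (hJ0.mul_B θ i).integrable hθ,
    integral_mul_inner_sq fun i j => ((hJ0.mul_B θ i).mul_B θ j).integrable hθ]
  rfl

lemma measurable_integral_inner_pow {X : Type*} [MeasurableSpace X] {P : Measure X} [SFinite P]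
    {f : X → ℝ} {Y : X → EuclideanSpace ℝ (Fin k)} (hf : Measurable f) (hY : Measurable Y) (p : ℕ) :
    Measurable fun φ => ∫ x, f x * ⟪φ, Y x⟫ ^ p ∂P :=
  (StronglyMeasurable.integral_prod_right (f := fun φ x => f x * ⟪φ, Y x⟫ ^ p)
    (show Measurable fun q : EuclideanSpace ℝ (Fin k) × X => f q.2 * ⟪q.1, Y q.2⟫ ^ p by
      fun_prop).stronglyMeasurable).measurable

/-- The expansion of the ratio of Fourier integrals, uniformly in a neighbourhood of a parameter
and over all `J` dominated by `Jbar`. -/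
theorem eventually_ratio_bounds (hD : F.ConditionD) (hJbar : F.ExpInt Jbar)
    (h0 : ∀ x, 0 ≤ Jbar x) (hθ : θ ∈ interior F.paramSpace) :
    ∃ (C : ℝ) (N₀ : ℕ), ∀ᶠ θ' in 𝓝 θ,
      (∀ N ≥ N₀, Integrable (fun φ => ‖F.centredChar θ' φ‖ ^ N) volume) ∧
      ∀ J : (Fin m → Ω) → ℝ, Measurable J → (∀ᵐ x ∂F.law m θ', |J x| ≤ Jbar x) →
        |F.R J θ'| ≤ C ∧ ∀ N ≥ N₀,
          0 < ∫ φ, (F.centredChar θ' φ ^ m * F.centredChar θ' φ ^ N).re ∧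
          |(∫ φ, (fourierMean (F.law m θ') (fun x => J x - F.mean J θ') (F.B m θ') φ *
              F.centredChar θ' φ ^ N).re) /
            (∫ φ, (F.centredChar θ' φ ^ m * F.centredChar θ' φ ^ N).re) -
              F.R J θ' / (m + N : ℕ)| ≤ C / ((m + N : ℕ) : ℝ) ^ 2 := by
  obtain ⟨c, hc, hlow⟩ := eventually_le_quadForm_V hD hθ
  obtain ⟨K₁, hK₁⟩ := eventually_moment₁_le hθ
  obtain ⟨K₂, hK₂⟩ := eventually_moment_le hJbar h0 hθ
  set K := max 1 (max K₂ (max K₁ (m * (3 * K₁)))) with hK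
  have hK1 : 1 ≤ K := le_max_left _ _
  have hKK₂ : K₂ ≤ K := (le_max_left _ _).trans (le_max_right _ _)
  have hKK₁ : K₁ ≤ K := (le_max_left _ _).trans ((le_max_right _ _).trans (le_max_right _ _))
  have hKm : m * (3 * K₁) ≤ K :=
    (le_max_right _ _).trans ((le_max_right _ _).trans (le_max_right _ _))
  obtain ⟨δ, hδ, H⟩ := CubicExpansion.ratio_bounds (E := EuclideanSpace ℝ (Fin k)) hc hK1
  obtain ⟨ρ, r, M, hρ0, hρ1, hT⟩ := eventually_tailBound hD hθ hδ
  obtain ⟨C, N₀, HC⟩ := H ρ hρ0 hρ1 r M m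
  refine ⟨C, max r N₀, ?_⟩
  filter_upwards [hlow, hK₁, hK₂, hT, isOpen_interior.mem_nhds hθ] with θ' hlow hK₁ hK₂ hT hθ'
  have := F.isProbabilityMeasure_law₁ (interior_subset hθ')
  have := F.isProbabilityMeasure_law (interior_subset hθ') m
  have hV := isUnit_det_V hD hθ'
  have hTm : Measurable fun x => F.T x - F.mu θ' := F.measurable_T.sub_const _
  have hB := F.measurable_B m θ'
  have hone : Measurable fun _ : Ω => (1 : ℝ) := measurable_const
  refine ⟨fun N hN => ?_, fun J hJ hle => ?_⟩
  · refine hT.integrable.mono' ((hT.measurable.norm.pow_const N).aestronglyMeasurable)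
      (ae_of_all _ fun φ => ?_)
    rw [Real.norm_of_nonneg (by positivity)]
    exact pow_le_pow_of_le_one (norm_nonneg _) (hT.norm_le_one φ) ((le_max_left _ _).trans hN)
  have hJi := hJbar.of_abs_le hJ hle
  have hJ0 : Measurable fun x => J x - F.mean J θ' := hJ.sub_const _
  have hJ0i : Integrable (fun x => J x - F.mean J θ') (F.law m θ') :=
    (hJi.integrable hθ').sub (integrable_const _)
  have hcub : CubicExpansion c K (F.centredChar θ')
      (fun φ => ∫ x, ⟪φ, F.T x - F.mu θ'⟫ ^ 2 ∂F.law₁ θ')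
      (fun φ => (∫ x, ⟪φ, F.T x - F.mu θ'⟫ ^ 3 ∂F.law₁ θ') / 6) :=
    cubicExpansion_fourierMean hTm (integrable_one_add_norm_pow hθ') (hK₁.trans hKK₁)
      (integral_inner_T_sub hθ') fun φ => by rw [← quadForm_V hθ']; exact hlow φ
  have hvan := vanishingExpansion_sub_mean hJbar hθ' hJ hle (hK₂.trans hKK₂)
  have hqm := measurable_integral_inner_pow (P := F.law₁ θ') hone hTm 2
  have hsm := measurable_integral_inner_pow (P := F.law₁ θ') hone hTm 3
  have hAm := measurable_integral_inner_pow (P := F.law m θ') hJ0 hB 2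
  have ham := measurable_integral_inner_pow (P := F.law m θ') hJ0 hB 1
  simp only [one_mul, pow_one] at hqm hsm ham
  have hhom : Homogeneous (fun φ => ∫ x, ⟪φ, F.T x - F.mu θ'⟫ ^ 2 ∂F.law₁ θ')
      (fun φ => (∫ x, ⟪φ, F.T x - F.mu θ'⟫ ^ 3 ∂F.law₁ θ') / 6)
      (fun φ => -(∫ x, (J x - F.mean J θ') * ⟪φ, F.B m θ' x⟫ ^ 2 ∂F.law m θ') / 2)
      (fun φ => ∫ x, (J x - F.mean J θ') * ⟪φ, F.B m θ' x⟫ ∂F.law m θ') := by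
    refine ⟨fun x φ => ?_, fun x φ => ?_, fun x φ => ?_, fun x φ => ?_⟩
    · simp_rw [real_inner_smul_left, mul_pow, integral_const_mul]
    · simp_rw [real_inner_smul_left, mul_pow, integral_const_mul]; ring
    · simp_rw [real_inner_smul_left, mul_pow, mul_left_comm _ (x ^ 2), integral_const_mul]; ring
    · simp_rw [real_inner_smul_left, mul_left_comm _ x, integral_const_mul]
  have hH₁ : ∀ φ, ‖F.centredChar θ' φ ^ m - 1‖ ≤ K * ‖φ‖ ^ 2 := by
    intro φ
    refine (norm_pow_sub_one_le (hT.norm_le_one φ) m).trans ?_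
    have h1 : ‖F.centredChar θ' φ - 1‖ ≤ (3 * K₁) * ‖φ‖ ^ 2 :=
      norm_fourierMean_one_sub_one_le hTm (integrable_one_add_norm_pow hθ')
        (by gcongr) (integral_inner_T_sub hθ') φ
    calc m * ‖F.centredChar θ' φ - 1‖ ≤ m * ((3 * K₁) * ‖φ‖ ^ 2) := by gcongr
      _ = m * (3 * K₁) * ‖φ‖ ^ 2 := by ring
      _ ≤ _ := by gcongr
  obtain ⟨h1, h2⟩ := HC (F.centredChar θ') _ _ hcub hqm (hsm.div_const 6) hT
    (fourierMean (F.law m θ') (fun x => J x - F.mean J θ') (F.B m θ'))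
    (fun φ => F.centredChar θ' φ ^ m) _ _ hvan hhom
    (continuous_fourierMean hB hJ0i).measurable (hAm.neg.div_const 2) ham
    (hT.measurable.pow_const m)
    (fun φ => by
      rw [norm_pow]
      exact (pow_le_one₀ (norm_nonneg _) (hT.norm_le_one φ)).trans hK1)
    hH₁ (F.R J θ') (integral_gaussian_eq_R hc hθ' hV hlow hJi)
  exact ⟨h1, fun N hN => h2 N ((le_max_right _ _).trans hN)⟩

end ExpFamily

/-! ### Conditional expectations given a statistic with a continuous density -/

section ConditionalDensity

lemma integrable_comp_of_map_prod {X Y Z : Type*} [MeasurableSpace X] [MeasurableSpace Y]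
    [MeasurableSpace Z] {P : Measure X} {μ : Measure Y} [IsFiniteMeasure μ] {Q : Measure Z}
    {ξ : Z → X} {U : Z → Y} {J : X → ℝ} (hξ : Measurable ξ) (hU : Measurable U)
    (hQ : Q.map (fun z => (ξ z, U z)) = P.prod μ) (hJ : Integrable J P) :
    Integrable (fun z => J (ξ z)) Q := by
  have h := hJ.comp_fst μ
  rw [← hQ] at h
  exact h.comp_measurable (by fun_prop : Measurable fun z => (ξ z, U z))

variable {X Z : Type*} [MeasurableSpace X] [MeasurableSpace Z]
  {E : Type*} [NormedAddCommGroup E] [InnerProductSpace ℝ E] [FiniteDimensional ℝ E]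
  [MeasurableSpace E] [BorelSpace E]

/-- `p` is a bounded continuous Lebesgue density of `μ`. -/
structure IsContinuousDensity (μ : Measure E) (p : E → ℝ) : Prop where
  continuous : Continuous p
  nonneg : ∀ t, 0 ≤ p t
  bounded : ∃ M : ℝ, ∀ t, p t ≤ M
  integrable : Integrable p volume
  eq : μ = volume.withDensity fun t => ENNReal.ofReal (p t)

lemma isContinuousDensity_fourierDensity {μ : Measure E} [IsFiniteMeasure μ]
    (hμ : Integrable (charFun μ) volume) :
    IsContinuousDensity μ fun t => (fourierDensity μ t).re where
  continuous := Complex.continuous_re.comp (continuous_fourierDensity hμ)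
  nonneg := fourierDensity_re_nonneg hμ
  bounded := ⟨_, fun t => (Complex.re_le_norm _).trans (norm_fourierDensity_le μ t)⟩
  integrable := integrable_fourierDensity_re hμ
  eq := eq_withDensity_fourierDensity hμ

/-- If `U` is independent of a variable `ξ` with law `P`, and `U` has density `p`, then
`convDensity P S p J` is the density of `E[J(ξ); S(ξ) + U ∈ ·]`. -/
def convDensity (P : Measure X) (S : X → E) (p : E → ℝ) (J : X → ℝ) (t : E) : ℝ :=
  ∫ x, J x * p (t - S x) ∂P

variable {P : Measure X} {S : X → E} {μ : Measure E} {p : E → ℝ} {J : X → ℝ}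

lemma continuous_convDensity (hp : IsContinuousDensity μ p) (hS : Measurable S)
    (hJm : Measurable J) (hJ : Integrable J P) : Continuous (convDensity P S p J) := by
  obtain ⟨M, hM⟩ := hp.bounded
  have hpm := hp.continuous.measurable
  have hpc := hp.continuous
  refine continuous_of_dominated (bound := fun x => |J x| * M)
    (fun t => (by fun_prop : Measurable _).aestronglyMeasurable)
    (fun t => ae_of_all _ fun x => ?_) (hJ.abs.mul_const M) (ae_of_all _ fun x => by fun_prop)
  rw [Real.norm_eq_abs, abs_mul, abs_of_nonneg (hp.nonneg _)]
  gcongr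
  exact hM _

lemma convDensity_one_nonneg (hp : IsContinuousDensity μ p) (t : E) :
    0 ≤ convDensity P S p (fun _ => 1) t :=
  integral_nonneg fun x => by simpa using hp.nonneg _

lemma integrable_mul_comp_sub [SFinite P] (hp : IsContinuousDensity μ p) (hS : Measurable S)
    (hJm : Measurable J) (hJ : Integrable J P) :
    Integrable (fun z : X × E => J z.1 * p (z.2 - S z.1)) (P.prod volume) := by
  have hpm := hp.continuous.measurable
  refine (integrable_prod_iff (by fun_prop : Measurable _).aestronglyMeasurable).2
    ⟨ae_of_all _ fun x => (hp.integrable.comp_sub_right (S x)).const_mul (J x), ?_⟩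
  have h : ∀ x, ∫ t, ‖J x * p (t - S x)‖ = |J x| * ∫ t, p t := fun x => by
    rw [← integral_sub_right_eq_self p (S x), ← integral_const_mul]
    congr 1; ext t
    rw [Real.norm_eq_abs, abs_mul, abs_of_nonneg (hp.nonneg _)]
  simp_rw [h]
  exact hJ.abs.mul_const _

lemma integrable_mul_comp_sub_right (hp : IsContinuousDensity μ p) (hS : Measurable S)
    (hJ : Integrable J P) (t : E) :
    Integrable (fun x => J x * p (t - S x)) P := by
  obtain ⟨M, hM⟩ := hp.bounded
  have hpm := hp.continuous.measurable
  exact hJ.mul_bdd (c := M) (by fun_prop : Measurable _).aestronglyMeasurable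
    (ae_of_all _ fun x => by rw [Real.norm_of_nonneg (hp.nonneg _)]; exact hM _)

variable [IsProbabilityMeasure P]

lemma integrable_convDensity (hp : IsContinuousDensity μ p) (hS : Measurable S)
    (hJm : Measurable J) (hJ : Integrable J P) : Integrable (convDensity P S p J) volume :=
  (integrable_mul_comp_sub hp hS hJm hJ).integral_prod_right

/-- Where the density of the statistic vanishes, so do all the other densities. -/
lemma convDensity_eq_zero (hp : IsContinuousDensity μ p) (hS : Measurable S) {t : E}
    (h : convDensity P S p (fun _ => 1) t = 0) : convDensity P S p J t = 0 := by
  have h1 := (integral_eq_zero_iff_of_nonneg (fun x => by simpa using hp.nonneg (t - S x))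
    (integrable_mul_comp_sub_right (J := fun _ => 1) hp hS
      (integrable_const _) t)).1 h
  refine integral_eq_zero_of_ae ?_
  filter_upwards [h1] with x hx
  simp only [one_mul, Pi.zero_apply] at hx ⊢
  rw [hx, mul_zero]

lemma convDensity_sub_const (hp : IsContinuousDensity μ p) (hS : Measurable S)
    (hJ : Integrable J P) (c : ℝ) (t : E) :
    convDensity P S p (fun x => J x - c) t =
      convDensity P S p J t - c * convDensity P S p (fun _ => 1) t := by
  unfold convDensity
  rw [← integral_const_mul, ← integral_sub (integrable_mul_comp_sub_right hp hS hJ t)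
    ((integrable_mul_comp_sub_right (J := fun _ => 1) hp hS
      (integrable_const _) t).const_mul c)]
  congr 1; ext x; ring

variable [IsProbabilityMeasure μ]

lemma integral_prod_indicator (hp : IsContinuousDensity μ p) (hS : Measurable S)
    (hJm : Measurable J) (hJ : Integrable J P) {A : Set E} (hA : MeasurableSet A) :
    ∫ z, J z.1 * A.indicator (fun _ => (1 : ℝ)) (S z.1 + z.2) ∂(P.prod μ) =
      ∫ t in A, convDensity P S p J t := by
  have hpm := hp.continuous.measurable
  have hind : Measurable (A.indicator fun _ => (1 : ℝ)) := measurable_const.indicator hA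
  have hle : ∀ t, ‖A.indicator (fun _ => (1 : ℝ)) t‖ ≤ 1 := fun t =>
    (norm_indicator_le_norm_self _ _).trans (by simp)
  rw [integral_prod _ ((hJ.comp_fst μ).mul_bdd (c := 1)
    (by fun_prop : Measurable _).aestronglyMeasurable (ae_of_all _ fun z => hle _))]
  have h1 : ∀ x, ∫ u, J x * A.indicator (fun _ => (1 : ℝ)) (S x + u) ∂μ =
      ∫ t, J x * p (t - S x) * A.indicator (fun _ => (1 : ℝ)) t := fun x => by
    rw [hp.eq, integral_withDensity_eq_integral_toReal_smul (by fun_prop)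
      (ae_of_all _ fun _ => ENNReal.ofReal_lt_top), ← integral_sub_right_eq_self _ (S x)]
    congr 1; ext t
    rw [ENNReal.toReal_ofReal (hp.nonneg _), add_sub_cancel, smul_eq_mul]; ring
  simp only
  simp_rw [h1]
  rw [integral_integral_swap ((integrable_mul_comp_sub hp hS hJm hJ).mul_bdd (c := 1)
    (hind.comp measurable_snd).aestronglyMeasurable (ae_of_all _ fun z => hle _)),
    ← integral_indicator hA]
  congr 1; ext t
  rw [integral_mul_const]
  by_cases ht : t ∈ A <;> simp [ht, convDensity]

variable {Q : Measure Z} {ξ : Z → X} {U : Z → E}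

lemma setIntegral_preimage_eq (hp : IsContinuousDensity μ p) (hS : Measurable S)
    (hξ : Measurable ξ) (hU : Measurable U) (hQ : Q.map (fun z => (ξ z, U z)) = P.prod μ)
    (hJm : Measurable J) (hJ : Integrable J P) {A : Set E} (hA : MeasurableSet A) :
    ∫ z in (fun z => S (ξ z) + U z) ⁻¹' A, J (ξ z) ∂Q = ∫ t in A, convDensity P S p J t := by
  have hind : Measurable (A.indicator fun _ => (1 : ℝ)) := measurable_const.indicator hA
  rw [← integral_prod_indicator hp hS hJm hJ hA, ← hQ,
    integral_map (by fun_prop) (by fun_prop), ← integral_indicator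
      ((by fun_prop : Measurable fun z => S (ξ z) + U z) hA)]
  congr 1; ext z
  by_cases hz : S (ξ z) + U z ∈ A <;> simp [Set.indicator, hz]

variable [IsProbabilityMeasure Q]

lemma map_eq_withDensity_convDensity (hp : IsContinuousDensity μ p) (hS : Measurable S)
    (hξ : Measurable ξ) (hU : Measurable U) (hQ : Q.map (fun z => (ξ z, U z)) = P.prod μ) :
    Q.map (fun z => S (ξ z) + U z) =
      volume.withDensity fun t => ENNReal.ofReal (convDensity P S p (fun _ => 1) t) := by
  have hT : Measurable fun z => S (ξ z) + U z := by fun_prop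
  have hi := integrable_convDensity (P := P) (J := fun _ => 1) hp hS measurable_const
    (integrable_const _)
  ext A hA
  have h := setIntegral_preimage_eq (J := fun _ => (1 : ℝ)) hp hS hξ hU hQ measurable_const
    (integrable_const _) hA
  rw [Measure.map_apply hT hA, withDensity_apply _ hA, ← ofReal_integral_eq_lintegral_ofReal
    hi.integrableOn (ae_of_all _ fun t => convDensity_one_nonneg hp t), ← h]
  simp

/-- Bayes' formula: the conditional expectation given `S(ξ) + U` is a quotient of densities. -/
lemma convDensity_div_ae_eq_condExp (hp : IsContinuousDensity μ p) (hS : Measurable S)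
    (hξ : Measurable ξ) (hU : Measurable U) (hQ : Q.map (fun z => (ξ z, U z)) = P.prod μ)
    (hJm : Measurable J) (hJ : Integrable J P) :
    (fun z => convDensity P S p J (S (ξ z) + U z) /
        convDensity P S p (fun _ => 1) (S (ξ z) + U z)) =ᵐ[Q]
      Q[fun z => J (ξ z) | MeasurableSpace.comap (fun z => S (ξ z) + U z) inferInstance] := by
  have hT : Measurable fun z => S (ξ z) + U z := by fun_prop
  have hcJ := continuous_convDensity hp hS hJm hJ
  have hc1 := continuous_convDensity (P := P) (J := fun _ => 1) hp hS measurable_const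
    (integrable_const _)
  have hg : Measurable fun t => convDensity P S p J t / convDensity P S p (fun _ => 1) t :=
    hcJ.measurable.div hc1.measurable
  have hmap := map_eq_withDensity_convDensity hp hS hξ hU hQ
  have hcancel : ∀ t, (ENNReal.ofReal (convDensity P S p (fun _ => 1) t)).toReal •
      (convDensity P S p J t / convDensity P S p (fun _ => 1) t) = convDensity P S p J t := by
    intro t
    rw [ENNReal.toReal_ofReal (convDensity_one_nonneg hp t), smul_eq_mul]
    by_cases h : convDensity P S p (fun _ => 1) t = 0
    · rw [h, zero_mul, convDensity_eq_zero hp hS h]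
    · rw [mul_div_cancel₀ _ h]
  have hgi : Integrable (fun t => convDensity P S p J t / convDensity P S p (fun _ => 1) t)
      (Q.map fun z => S (ξ z) + U z) := by
    rw [hmap, integrable_withDensity_iff_integrable_smul' hc1.measurable.ennreal_ofReal
      (ae_of_all _ fun _ => ENNReal.ofReal_lt_top)]
    simp_rw [hcancel]
    exact integrable_convDensity hp hS hJm hJ
  have hgQ := hgi.comp_measurable hT
  refine ae_eq_condExp_of_forall_setIntegral_eq hT.comap_le
    (integrable_comp_of_map_prod hξ hU hQ hJ) (fun s _ _ => hgQ.integrableOn) ?_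
    (hg.comp (comap_measurable _)).aestronglyMeasurable
  rintro s ⟨A, hA, rfl⟩ -
  rw [setIntegral_preimage_eq hp hS hξ hU hQ hJm hJ hA,
    ← setIntegral_map hA hg.aestronglyMeasurable hT.aemeasurable
      (f := fun t => convDensity P S p J t / convDensity P S p (fun _ => 1) t), hmap,
    setIntegral_withDensity_eq_setIntegral_toReal_smul hc1.measurable.ennreal_ofReal
      (ae_of_all _ fun _ => ENNReal.ofReal_lt_top) _ hA]
  simp_rw [hcancel]

/-- Sufficiency: a change of measure by a density that is a function of `T` leaves the conditional
expectation given `T` unchanged. -/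
lemma ae_eq_condExp_withDensity {Z E : Type*} [MeasurableSpace Z] [MeasurableSpace E]
    {Q : Measure Z} [IsProbabilityMeasure Q] {T : Z → E} (hT : Measurable T) {w : E → ℝ}
    (hw : Measurable w) (hw0 : ∀ t, 0 ≤ w t) {g : E → ℝ} (hg : Measurable g) {f : Z → ℝ}
    (hf : Integrable f Q) {Q' : Measure Z} [IsProbabilityMeasure Q']
    (hQ' : Q' = Q.withDensity fun z => ENNReal.ofReal (w (T z))) (hf' : Integrable f Q')
    (h : (fun z => g (T z)) =ᵐ[Q] Q[f | MeasurableSpace.comap T inferInstance]) :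
    (fun z => g (T z)) =ᵐ[Q'] Q'[f | MeasurableSpace.comap T inferInstance] := by
  have hwT : Measurable fun z => ENNReal.ofReal (w (T z)) := by fun_prop
  have hfin : ∀ (ρ : Measure Z), ∀ᵐ z ∂ρ, ENNReal.ofReal (w (T z)) < ⊤ := fun ρ =>
    ae_of_all _ fun _ => ENNReal.ofReal_lt_top
  have hsm : StronglyMeasurable[MeasurableSpace.comap T inferInstance] fun z => w (T z) :=
    (hw.comp (comap_measurable T)).stronglyMeasurable
  have hwf : Integrable (fun z => w (T z) * f z) Q := by
    rw [hQ', integrable_withDensity_iff_integrable_smul' hwT (hfin _)] at hf'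
    refine hf'.congr (ae_of_all _ fun z => ?_)
    simp only
    rw [ENNReal.toReal_ofReal (hw0 _), smul_eq_mul]
  have hpull : Q[fun z => w (T z) * f z | MeasurableSpace.comap T inferInstance] =ᵐ[Q]
      fun z => w (T z) * g (T z) := by
    have h1 := condExp_mul_of_stronglyMeasurable_left hsm hwf hf
    filter_upwards [h1, h] with z hz1 hz2
    rw [Pi.mul_apply] at hz1
    rw [hz2]
    exact hz1
  have hwg : Integrable (fun z => w (T z) * g (T z)) Q := integrable_condExp.congr hpull
  have hgi : Integrable (fun z => g (T z)) Q' := by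
    rw [hQ', integrable_withDensity_iff_integrable_smul' hwT (hfin _)]
    refine hwg.congr (ae_of_all _ fun z => ?_)
    simp only
    rw [ENNReal.toReal_ofReal (hw0 _), smul_eq_mul]
  refine ae_eq_condExp_of_forall_setIntegral_eq hT.comap_le hf' (fun s _ _ => hgi.integrableOn) ?_
    (hg.comp (comap_measurable _)).aestronglyMeasurable
  intro s hs _
  have hs' := hT.comap_le s hs
  rw [hQ', setIntegral_withDensity_eq_setIntegral_toReal_smul hwT (hfin _) _ hs',
    setIntegral_withDensity_eq_setIntegral_toReal_smul hwT (hfin _) _ hs']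
  simp_rw [ENNReal.toReal_ofReal (hw0 _), smul_eq_mul]
  rw [← setIntegral_condExp hT.comap_le hwf hs]
  exact (setIntegral_congr_ae hs' (hpull.mono fun z hz _ => hz)).symm

end ConditionalDensity

/-! ### The conditional expectation given the sufficient statistic -/

section SplitSample

lemma map_append_pi {X : Type*} [MeasurableSpace X] (P : Measure X) [SigmaFinite P] (m N : ℕ) :
    ((Measure.pi fun _ : Fin m => P).prod (Measure.pi fun _ : Fin N => P)).map
      (fun z => Fin.append z.1 z.2) = Measure.pi fun _ : Fin (m + N) => P := by
  have hmeas : Measurable fun z : (Fin m → X) × (Fin N → X) => Fin.append z.1 z.2 := by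
    refine measurable_pi_iff.2 fun i => ?_
    refine Fin.addCases (fun i => ?_) (fun i => ?_) i
    · simp only [Fin.append_left]; fun_prop
    · simp only [Fin.append_right]; fun_prop
  refine (Measure.pi_eq fun s hs => ?_).symm
  rw [Measure.map_apply hmeas (MeasurableSet.univ_pi hs)]
  have h : (fun z : (Fin m → X) × (Fin N → X) => Fin.append z.1 z.2) ⁻¹' Set.univ.pi s =
      (Set.univ.pi fun i => s (Fin.castAdd N i)) ×ˢ (Set.univ.pi fun i => s (Fin.natAdd m i)) := by
    ext z
    simp only [Set.mem_preimage, Set.mem_univ_pi, Set.mem_prod]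
    refine ⟨fun h => ⟨fun i => ?_, fun i => ?_⟩, fun h i => ?_⟩
    · simpa using h (Fin.castAdd N i)
    · simpa using h (Fin.natAdd m i)
    · refine Fin.addCases (fun i => ?_) (fun i => ?_) i
      · simpa using h.1 i
      · simpa using h.2 i
  rw [h, Measure.prod_prod, Measure.pi_pi, Measure.pi_pi, Fin.prod_univ_add]

end SplitSample

namespace ExpFamily

variable {Ω : Type*} [MeasurableSpace Ω] {k : ℕ} {F : ExpFamily Ω k}
  {θ : EuclideanSpace ℝ (Fin k)} {m N : ℕ} {J : (Fin m → Ω) → ℝ}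

lemma stat_add (x : Fin (m + N) → Ω) :
    F.stat (m + N) x =
      F.stat m (fun i => x (Fin.castAdd N i)) + F.stat N fun i => x (Fin.natAdd m i) :=
  Fin.sum_univ_add _

/-- The first `m` observations are independent of the sum of the statistics of the remaining
ones. -/
lemma map_law_add (m N : ℕ) (θ : EuclideanSpace ℝ (Fin k)) :
    (F.law (m + N) θ).map (fun x => (fun i => x (Fin.castAdd N i),
      F.stat N fun i => x (Fin.natAdd m i))) =
      (F.law m θ).prod ((F.law N θ).map (F.stat N)) := by
  have hS := F.measurable_stat N
  have h := map_append_pi (F.law₁ θ) m N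
  have hmeas : Measurable fun z : (Fin m → Ω) × (Fin N → Ω) => Fin.append z.1 z.2 := by
    refine measurable_pi_iff.2 fun i => ?_
    refine Fin.addCases (fun i => ?_) (fun i => ?_) i
    · simp only [Fin.append_left]; fun_prop
    · simp only [Fin.append_right]; fun_prop
  have hm2 : Measurable fun x : Fin (m + N) → Ω =>
      ((fun i => x (Fin.castAdd N i), F.stat N fun i => x (Fin.natAdd m i)) :
        (Fin m → Ω) × EuclideanSpace ℝ (Fin k)) := by
    refine Measurable.prodMk ?_ (hS.comp ?_)
    · exact measurable_pi_iff.2 fun i => measurable_pi_apply _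
    · exact measurable_pi_iff.2 fun i => measurable_pi_apply _
  unfold law
  rw [← h, Measure.map_map hm2 hmeas]
  have h2 := Measure.map_prod_map (Measure.pi fun _ : Fin m => F.law₁ θ)
    (Measure.pi fun _ : Fin N => F.law₁ θ) measurable_id hS
  rw [Measure.map_id] at h2
  rw [h2]
  congr 1; ext z
  · simp
  · simp

variable (F) in
/-- The density of `T_N`. -/
def statDensity (N : ℕ) (θ t : EuclideanSpace ℝ (Fin k)) : ℝ :=
  (fourierDensity ((F.law N θ).map (F.stat N)) t).re

lemma integrable_charFun_stat (hθ : θ ∈ interior F.paramSpace)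
    (hN : Integrable (fun φ => ‖F.centredChar θ φ‖ ^ N) volume) :
    Integrable (charFun ((F.law N θ).map (F.stat N))) volume := by
  have := F.isProbabilityMeasure_law (interior_subset hθ) N
  have := Measure.isProbabilityMeasure_map (μ := F.law N θ) (F.measurable_stat N).aemeasurable
  refine hN.mono' continuous_charFun.aestronglyMeasurable (ae_of_all _ fun φ => ?_)
  rw [norm_charFun_map_stat]

/-- The numerator of the conditional expectation at the mean value as a Fourier integral. -/
lemma convDensity_at_mean (hθ : θ ∈ interior F.paramSpace)
    (hN : Integrable (fun φ => ‖F.centredChar θ φ‖ ^ N) volume) (hJ : Integrable J (F.law m θ)) :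
    convDensity (F.law m θ) (F.stat m) (F.statDensity N θ) J (((m + N : ℕ) : ℝ) • F.mu θ) =
      ((2 * Real.pi) ^ k)⁻¹ *
        ∫ φ, (fourierMean (F.law m θ) J (F.B m θ) φ * F.centredChar θ φ ^ N).re := by
  have := F.isProbabilityMeasure_law (interior_subset hθ) m
  have hB := F.measurable_B m θ
  have hχ := continuous_centredChar hθ
  have hNc : Integrable (fun φ => F.centredChar θ φ ^ N) volume := by
    refine hN.mono' (hχ.pow N).aestronglyMeasurable (ae_of_all _ fun φ => ?_)
    rw [norm_pow]
  have hprod : Integrable (Function.uncurry fun (x : Fin m → Ω) (φ : EuclideanSpace ℝ (Fin k)) =>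
      (J x : ℂ) * Complex.exp ((⟪φ, F.B m θ x⟫ : ℝ) * Complex.I) * F.centredChar θ φ ^ N)
      ((F.law m θ).prod volume) := by
    have h1 : Integrable (fun z : (Fin m → Ω) × EuclideanSpace ℝ (Fin k) =>
        (J z.1 : ℂ) * F.centredChar θ z.2 ^ N) ((F.law m θ).prod volume) :=
      Integrable.mul_prod (f := fun x => (J x : ℂ)) hJ.ofReal hNc
    refine (h1.mul_bdd (c := 1) (g := fun z => Complex.exp ((⟪z.2, F.B m θ z.1⟫ : ℝ) * Complex.I))
      (by fun_prop : Measurable _).aestronglyMeasurable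
      (ae_of_all _ fun z => by rw [Complex.norm_exp_ofReal_mul_I])).congr (ae_of_all _ fun z => ?_)
    simp only [Function.uncurry]; ring
  have hdens : ∀ x, F.statDensity N θ (((m + N : ℕ) : ℝ) • F.mu θ - F.stat m x) =
      ((2 * Real.pi) ^ k)⁻¹ * (∫ φ, Complex.exp ((⟪φ, F.B m θ x⟫ : ℝ) * Complex.I) *
        F.centredChar θ φ ^ N).re := by
    intro x
    rw [statDensity, fourierDensity_eq, Complex.re_ofReal_mul, finrank_euclideanSpace_fin]
    congr 3; ext φ
    rw [charFun_map_stat, centredChar, fourierMean_sub_const, mul_pow, ← mul_assoc,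
      ← Complex.exp_nat_mul, ← Complex.exp_add]
    congr 2
    rw [B_eq]
    simp only [inner_sub_right, real_inner_smul_right]
    push_cast; ring
  have h1 : ∫ φ, (fourierMean (F.law m θ) J (F.B m θ) φ * F.centredChar θ φ ^ N).re =
      (∫ φ, fourierMean (F.law m θ) J (F.B m θ) φ * F.centredChar θ φ ^ N).re := by
    have h2 := hprod.integral_prod_right
    simp only [Function.uncurry, integral_mul_const] at h2
    exact integral_re h2
  have h2 : ∫ φ, fourierMean (F.law m θ) J (F.B m θ) φ * F.centredChar θ φ ^ N =
      ∫ x, (∫ φ, (J x : ℂ) * Complex.exp ((⟪φ, F.B m θ x⟫ : ℝ) * Complex.I) *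
        F.centredChar θ φ ^ N) ∂F.law m θ := by
    rw [integral_integral_swap hprod]
    simp_rw [integral_mul_const, fourierMean]
  have h3 := hprod.integral_prod_left
  simp only [Function.uncurry] at h3
  rw [h1, h2, ← RCLike.re_eq_complex_re, ← integral_re h3, convDensity, ← integral_const_mul]
  congr 1; ext x
  rw [hdens]
  simp_rw [mul_assoc]
  rw [integral_const_mul, RCLike.re_eq_complex_re, Complex.re_ofReal_mul]
  ring

lemma isContinuousDensity_statDensity (hθ : θ ∈ interior F.paramSpace)
    (hN : Integrable (fun φ => ‖F.centredChar θ φ‖ ^ N) volume) :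
    IsContinuousDensity ((F.law N θ).map (F.stat N)) (F.statDensity N θ) := by
  have := F.isProbabilityMeasure_law (interior_subset hθ) N
  have := Measure.isProbabilityMeasure_map (μ := F.law N θ) (F.measurable_stat N).aemeasurable
  exact isContinuousDensity_fourierDensity (integrable_charFun_stat hθ hN)

variable (F) in
/-- The numerator in Bayes' formula for `E(J | T_{m+N} = t)`, the density of
`E_θ[J; T_{m+N} ∈ ·]`. -/
def numerator (N : ℕ) (θ : EuclideanSpace ℝ (Fin k)) (J : (Fin m → Ω) → ℝ) :
    EuclideanSpace ℝ (Fin k) → ℝ :=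
  convDensity (F.law m θ) (F.stat m) (F.statDensity N θ) J

lemma continuous_numerator (hθ : θ ∈ interior F.paramSpace)
    (hN : Integrable (fun φ => ‖F.centredChar θ φ‖ ^ N) volume) (hJm : Measurable J)
    (hJ : Integrable J (F.law m θ)) : Continuous (F.numerator N θ J) :=
  continuous_convDensity (isContinuousDensity_statDensity hθ hN) (F.measurable_stat m) hJm hJ

/-- The quotient of densities is a version of the conditional expectation, for all parameters
simultaneously. -/
lemma isCondVersion_numerator_div (hθ : θ ∈ interior F.paramSpace)
    (hN : Integrable (fun φ => ‖F.centredChar θ φ‖ ^ N) volume) (hJ : F.ExpInt J)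
    (h : m ≤ m + N) :
    F.IsCondVersion h J fun t =>
      F.numerator N θ J t / F.numerator N θ (fun _ : Fin m → Ω => 1) t := by
  have hm := F.isProbabilityMeasure_law (interior_subset hθ) m
  have hNp := F.isProbabilityMeasure_law (interior_subset hθ) N
  have hmN := F.isProbabilityMeasure_law (interior_subset hθ) (m + N)
  have := Measure.isProbabilityMeasure_map (μ := F.law N θ) (F.measurable_stat N).aemeasurable
  have hp := isContinuousDensity_statDensity hθ hN
  have hS := F.measurable_stat m
  have hξ : Measurable fun (x : Fin (m + N) → Ω) (i : Fin m) => x (Fin.castAdd N i) :=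
    measurable_pi_iff.2 fun i => measurable_pi_apply _
  have hU : Measurable fun x : Fin (m + N) → Ω => F.stat N fun i => x (Fin.natAdd m i) :=
    (F.measurable_stat N).comp (measurable_pi_iff.2 fun i => measurable_pi_apply _)
  have hstat : F.stat (m + N) = fun x => F.stat m (fun i => x (Fin.castAdd N i)) +
      F.stat N fun i => x (Fin.natAdd m i) := funext stat_add
  have hg : Measurable fun t => F.numerator N θ J t / F.numerator N θ (fun _ : Fin m → Ω => 1) t :=
    (continuous_numerator hθ hN hJ.measurable (hJ.integrable hθ)).measurable.div
      (continuous_numerator hθ hN measurable_const (integrable_const _)).measurable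
  have hext : ∀ θ' ∈ interior F.paramSpace,
      Integrable (extend h J) (F.law (m + N) θ') := fun θ' hθ' => by
    have := F.isProbabilityMeasure_law (interior_subset hθ') N
    have := Measure.isProbabilityMeasure_map (μ := F.law N θ') (F.measurable_stat N).aemeasurable
    exact integrable_comp_of_map_prod (J := J)
      (ξ := fun (x : Fin (m + N) → Ω) (i : Fin m) => x (Fin.castAdd N i))
      hξ hU (map_law_add m N θ') (hJ.integrable hθ')
  refine ⟨hg, fun θ' hθ' => ?_⟩
  have hmN' := F.isProbabilityMeasure_law (interior_subset hθ') (m + N)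
  refine ae_eq_condExp_withDensity (Q := F.law (m + N) θ) (F.measurable_stat (m + N))
    (w := fun t => Real.exp (⟪θ' - θ, t⟫ - (m + N : ℕ) * (F.kappa θ' - F.kappa θ)))
    (by fun_prop) (fun t => (Real.exp_pos _).le) hg (hext θ hθ)
    (F.law_eq_withDensity_law (m + N) θ θ') (hext θ' hθ') ?_
  have h1 := convDensity_div_ae_eq_condExp hp hS hξ hU (map_law_add m N θ) hJ.measurable
    (hJ.integrable hθ)
  rw [hstat]
  exact h1

lemma map_stat_eq_withDensity (hθ : θ ∈ interior F.paramSpace)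
    (hN : Integrable (fun φ => ‖F.centredChar θ φ‖ ^ N) volume) :
    (F.law (m + N) θ).map (F.stat (m + N)) = volume.withDensity fun t =>
      ENNReal.ofReal (F.numerator N θ (fun _ : Fin m → Ω => 1) t) := by
  have hm := F.isProbabilityMeasure_law (interior_subset hθ) m
  have hNp := F.isProbabilityMeasure_law (interior_subset hθ) N
  have hmN := F.isProbabilityMeasure_law (interior_subset hθ) (m + N)
  have := Measure.isProbabilityMeasure_map (μ := F.law N θ) (F.measurable_stat N).aemeasurable
  have h := map_eq_withDensity_convDensity (isContinuousDensity_statDensity hθ hN)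
    (F.measurable_stat m) (ξ := fun (x : Fin (m + N) → Ω) (i : Fin m) => x (Fin.castAdd N i))
    (measurable_pi_iff.2 fun i => measurable_pi_apply _)
    (U := fun x : Fin (m + N) → Ω => F.stat N fun i => x (Fin.natAdd m i))
    ((F.measurable_stat N).comp (measurable_pi_iff.2 fun i => measurable_pi_apply _))
    (map_law_add m N θ)
  rw [show F.stat (m + N) = _ from funext stat_add]
  exact h

/-- A point at which the density of `T_n` is positive belongs to the support of `T_n`. -/
lemma map_stat_pos (hθ : θ ∈ interior F.paramSpace)
    (hN : Integrable (fun φ => ‖F.centredChar θ φ‖ ^ N) volume) {t : EuclideanSpace ℝ (Fin k)}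
    (ht : 0 < F.numerator N θ (fun _ : Fin m → Ω => 1) t) (θ' : EuclideanSpace ℝ (Fin k))
    {W : Set (EuclideanSpace ℝ (Fin k))} (hW : W ∈ 𝓝 t) :
    0 < (F.law (m + N) θ').map (F.stat (m + N)) W := by
  have hm := F.isProbabilityMeasure_law (interior_subset hθ) m
  have hc := continuous_numerator (m := m) hθ hN measurable_const (integrable_const (1 : ℝ))
  have hac := (F.law_absolutelyContinuous (m + N) θ' θ).map (F.measurable_stat (m + N))
  refine pos_iff_ne_zero.2 fun h0 => ?_
  have h1 := hac h0
  rw [map_stat_eq_withDensity hθ hN] at h1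
  have h2 : W ∩ {t | 0 < F.numerator N θ (fun _ : Fin m → Ω => 1) t} ∈ 𝓝 t :=
    inter_mem hW (hc.continuousAt.eventually (lt_mem_nhds ht))
  obtain ⟨O, hO, hOo, htO⟩ := mem_nhds_iff.1 h2
  have h3 := measure_mono_null (hO.trans Set.inter_subset_left) h1
  rw [withDensity_apply _ hOo.measurableSet,
    setLIntegral_eq_zero_iff hOo.measurableSet hc.measurable.ennreal_ofReal] at h3
  have h4 : ∀ᵐ t, t ∉ O := by
    filter_upwards [h3] with s hs hsO
    have := (hO hsO).2
    have h5 := hs hsO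
    rw [ENNReal.ofReal_eq_zero] at h5
    exact not_lt.2 h5 this
  exact (hOo.measure_pos volume ⟨t, htO⟩).ne' (by simpa [ae_iff] using h4)

/-- The value of the conditional expectation at a point is unique. -/
lemma IsCondValue.unique (hne : (interior F.paramSpace).Nonempty) {n : ℕ} {h : m ≤ n}
    {t : EuclideanSpace ℝ (Fin k)} {v w : ℝ} (hv : F.IsCondValue h J t v)
    (hw : F.IsCondValue h J t w) : v = w := by
  obtain ⟨θ, hθ⟩ := hne
  obtain ⟨hsupp, g₁, hg₁, hc₁, rfl⟩ := hv
  obtain ⟨-, g₂, hg₂, hc₂, rfl⟩ := hw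
  by_contra hcon
  have h1 : {s | g₁ s ≠ g₂ s} ∈ 𝓝 t := by
    filter_upwards [(hc₁.sub hc₂).eventually_ne (sub_ne_zero.2 hcon)] with s hs
    exact sub_ne_zero.1 hs
  have h2 := hsupp θ hθ _ h1
  have h3 : ∀ᵐ x ∂F.law n θ, g₁ (F.stat n x) = g₂ (F.stat n x) := by
    filter_upwards [hg₁.2 θ hθ, hg₂.2 θ hθ] with x hx1 hx2
    rw [hx1, hx2]
  have hms : MeasurableSet {s | g₁ s ≠ g₂ s} := (measurableSet_eq_fun hg₁.1 hg₂.1).compl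
  rw [Measure.map_apply (F.measurable_stat n) hms] at h2
  exact h2.ne' h3

lemma isCondValue_numerator_div (hθ : θ ∈ interior F.paramSpace)
    (hN : Integrable (fun φ => ‖F.centredChar θ φ‖ ^ N) volume) (hJ : F.ExpInt J)
    (h : m ≤ m + N) {t : EuclideanSpace ℝ (Fin k)}
    (ht : 0 < F.numerator N θ (fun _ : Fin m → Ω => 1) t) :
    F.IsCondValue h J t (F.numerator N θ J t / F.numerator N θ (fun _ : Fin m → Ω => 1) t) := by
  have hm := F.isProbabilityMeasure_law (interior_subset hθ) m
  refine ⟨fun θ' _ W hW => map_stat_pos hθ hN ht θ' hW, _,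
    isCondVersion_numerator_div hθ hN hJ h, ?_, rfl⟩
  exact (continuous_numerator hθ hN hJ.measurable (hJ.integrable hθ)).continuousAt.div
    (continuous_numerator hθ hN measurable_const (integrable_const _)).continuousAt ht.ne'

lemma numerator_one_at_mean (hθ : θ ∈ interior F.paramSpace)
    (hN : Integrable (fun φ => ‖F.centredChar θ φ‖ ^ N) volume) :
    F.numerator N θ (fun _ : Fin m → Ω => 1) (((m + N : ℕ) : ℝ) • F.mu θ) =
      ((2 * Real.pi) ^ k)⁻¹ * ∫ φ, (F.centredChar θ φ ^ m * F.centredChar θ φ ^ N).re := by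
  have hm := F.isProbabilityMeasure_law (interior_subset hθ) m
  rw [numerator, convDensity_at_mean hθ hN (integrable_const _)]
  simp_rw [fourierMean_law_B]

/-- Subtracting `E_θ J` from the conditional expectation centres `J`, which makes the amplitude of
the Fourier integral in the numerator vanish at the origin. -/
lemma numerator_div_sub_mean (hθ : θ ∈ interior F.paramSpace)
    (hN : Integrable (fun φ => ‖F.centredChar θ φ‖ ^ N) volume) (hJ : Integrable J (F.law m θ))
    (h : 0 < ∫ φ, (F.centredChar θ φ ^ m * F.centredChar θ φ ^ N).re) :
    F.numerator N θ J (((m + N : ℕ) : ℝ) • F.mu θ) /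
        F.numerator N θ (fun _ : Fin m → Ω => 1) (((m + N : ℕ) : ℝ) • F.mu θ) - F.mean J θ =
      (∫ φ, (fourierMean (F.law m θ) (fun x => J x - F.mean J θ) (F.B m θ) φ *
        F.centredChar θ φ ^ N).re) /
        ∫ φ, (F.centredChar θ φ ^ m * F.centredChar θ φ ^ N).re := by
  have hm := F.isProbabilityMeasure_law (interior_subset hθ) m
  have hpi : 0 < ((2 * Real.pi) ^ k)⁻¹ := by positivity
  have h1 := numerator_one_at_mean (m := m) hθ hN
  have h2 := convDensity_sub_const (isContinuousDensity_statDensity hθ hN) (F.measurable_stat m)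
    hJ (F.mean J θ) (((m + N : ℕ) : ℝ) • F.mu θ)
  have h3 := convDensity_at_mean hθ hN (J := fun x => J x - F.mean J θ)
    (hJ.sub (integrable_const _))
  have hpos : 0 < F.numerator N θ (fun _ : Fin m → Ω => 1) (((m + N : ℕ) : ℝ) • F.mu θ) := by
    rw [h1]; positivity
  have e : ∀ a b c : ℝ, b ≠ 0 → a / b - c = (a - c * b) / b := fun a b c hb => by field_simp
  rw [e _ _ _ hpos.ne', numerator, numerator, ← h2, h3, ← numerator, h1,
    mul_div_mul_left _ _ hpi.ne']

/-- The expansion near one parameter. -/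
lemma eventually_expansion {Jbar : (Fin m → Ω) → ℝ} (hD : F.ConditionD) (hJbar : F.ExpInt Jbar)
    (h0 : ∀ x, 0 ≤ Jbar x) (hθ : θ ∈ interior F.paramSpace) :
    ∃ (C : ℝ) (N₁ : ℕ), ∀ᶠ θ' in 𝓝 θ,
      ∀ J : (Fin m → Ω) → ℝ, Measurable J → (∀ᵐ x ∂F.law m θ', |J x| ≤ Jbar x) →
        |F.R J θ'| ≤ C ∧ ∀ n ≥ N₁, ∀ h : m ≤ n,
          (∃! v : ℝ, F.IsCondValue h J ((n : ℝ) • F.mu θ') v) ∧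
          ∀ v : ℝ, F.IsCondValue h J ((n : ℝ) • F.mu θ') v →
            |v - (F.mean J θ' + F.R J θ' / n)| ≤ C / (n : ℝ) ^ 2 := by
  obtain ⟨C, N₀, H⟩ := eventually_ratio_bounds hD hJbar h0 hθ
  -- `T_n` is split into the sum over the first `m` observations and that over `N = n - m ≥ N₀`
  refine ⟨C, m + N₀, ?_⟩
  filter_upwards [H, isOpen_interior.mem_nhds hθ] with θ' H hθ' J hJ hle
  have hJi := hJbar.of_abs_le hJ hle
  obtain ⟨hR, H2⟩ := H.2 J hJ hle
  refine ⟨hR, fun n hn h => ?_⟩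
  obtain ⟨N, rfl⟩ := Nat.exists_eq_add_of_le h
  have hNN : N₀ ≤ N := by omega
  have hint := H.1 N hNN
  obtain ⟨hpos, hbound⟩ := H2 N hNN
  have hnum : 0 < F.numerator N θ' (fun _ : Fin m → Ω => 1) (((m + N : ℕ) : ℝ) • F.mu θ') := by
    rw [numerator_one_at_mean hθ' hint]; positivity
  have hval := isCondValue_numerator_div hθ' hint hJi h hnum
  refine ⟨⟨_, hval, fun w hw => hw.unique ⟨θ, hθ⟩ hval⟩, fun v hv => ?_⟩
  rw [hv.unique ⟨θ, hθ⟩ hval, ← sub_sub, numerator_div_sub_mean hθ' hint (hJi.integrable hθ') hpos]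
  exact hbound

end ExpFamily

theorem theorem3 {Ω : Type*} [MeasurableSpace Ω] {k : ℕ} (F : ExpFamily Ω k)
    (hD : F.ConditionD) (m : ℕ) (hm : 0 < m)
    (Jbar : (Fin m → Ω) → ℝ) (hJbar_meas : Measurable Jbar) (hJbar_nonneg : ∀ x, 0 ≤ Jbar x)
    (hJbar_int : ∀ θ ∈ interior F.paramSpace, Integrable Jbar (F.law m θ)) :
    -- the two expressions for `R` make sense and agree
    (∀ θ ∈ interior F.paramSpace, ∀ J : (Fin m → Ω) → ℝ, Measurable J →
      (∀ᵐ x ∂F.law m θ, |J x| ≤ Jbar x) →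
        Integrable (fun x => J x * F.Q m θ x) (F.law m θ) ∧
        Integrable (fun x => J x * F.psi₁₁ θ (F.B m θ x)) (F.law m θ) ∧
        ContDiffAt ℝ 2 (F.mean J) θ ∧
        F.R J θ = - (1 / 2) * ((F.V θ)⁻¹ * hessian (F.mean J) θ).trace
          - F.psi₁₁ θ (gradient (F.mean J) θ)) ∧
    ∀ Γ : Set (EuclideanSpace ℝ (Fin k)), IsCompact Γ → Γ ⊆ interior F.paramSpace →
      -- the expansion, uniformly in `θ ∈ Γ` and `|J| ≤ Jbar`
      (∃ (C : ℝ) (N : ℕ), ∀ n : ℕ, N ≤ n → ∀ h : m ≤ n, ∀ θ ∈ Γ, ∀ J : (Fin m → Ω) → ℝ,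
        Measurable J → (∀ᵐ x ∂F.law m θ, |J x| ≤ Jbar x) →
          (∃! v : ℝ, F.IsCondValue h J ((n : ℝ) • F.mu θ) v) ∧
          ∀ v : ℝ, F.IsCondValue h J ((n : ℝ) • F.mu θ) v →
            |v - (F.mean J θ + F.R J θ / n)| ≤ C / (n : ℝ) ^ 2) ∧
      -- `R` is uniformly bounded
      (∃ C : ℝ, ∀ θ ∈ Γ, ∀ J : (Fin m → Ω) → ℝ,
        Measurable J → (∀ᵐ x ∂F.law m θ, |J x| ≤ Jbar x) → |F.R J θ| ≤ C) := by
  have hJbar := ExpFamily.expInt_of_integrable hJbar_meas hJbar_int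
  refine ⟨fun θ hθ J hJ hle => ?_, fun Γ hΓ hΓsub => ?_⟩
  · have hJi := hJbar.of_abs_le hJ hle
    exact ⟨ExpFamily.integrable_mul_Q hJi hθ, ExpFamily.integrable_mul_psi₁₁ hJi hθ,
      (hJi.contDiffOn 2).contDiffAt (isOpen_interior.mem_nhds hθ),
      ExpFamily.R_eq_trace hJi hθ (ExpFamily.isUnit_det_V hD hθ)⟩
  have key : ∃ (C : ℝ) (N : ℕ), ∀ θ ∈ Γ, ∀ J : (Fin m → Ω) → ℝ,
      Measurable J → (∀ᵐ x ∂F.law m θ, |J x| ≤ Jbar x) →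
        |F.R J θ| ≤ C ∧ ∀ n ≥ N, ∀ h : m ≤ n,
          (∃! v : ℝ, F.IsCondValue h J ((n : ℝ) • F.mu θ) v) ∧
          ∀ v : ℝ, F.IsCondValue h J ((n : ℝ) • F.mu θ) v →
            |v - (F.mean J θ + F.R J θ / n)| ≤ C / (n : ℝ) ^ 2 := by
    refine hΓ.induction_on (p := fun s => ∃ (C : ℝ) (N : ℕ), ∀ θ ∈ s, ∀ J : (Fin m → Ω) → ℝ,
      Measurable J → (∀ᵐ x ∂F.law m θ, |J x| ≤ Jbar x) →
        |F.R J θ| ≤ C ∧ ∀ n ≥ N, ∀ h : m ≤ n,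
          (∃! v : ℝ, F.IsCondValue h J ((n : ℝ) • F.mu θ) v) ∧
          ∀ v : ℝ, F.IsCondValue h J ((n : ℝ) • F.mu θ) v →
            |v - (F.mean J θ + F.R J θ / n)| ≤ C / (n : ℝ) ^ 2) ?_ ?_ ?_ ?_
    · exact ⟨0, 0, by simp⟩
    · rintro s t hst ⟨C, N, H⟩
      exact ⟨C, N, fun θ hθ => H θ (hst hθ)⟩
    · rintro s t ⟨C₁, N₁, H₁⟩ ⟨C₂, N₂, H₂⟩
      refine ⟨max C₁ C₂, max N₁ N₂, fun θ hθ J hJ hle => ?_⟩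
      rcases hθ with hθ | hθ
      · obtain ⟨hR, H⟩ := H₁ θ hθ J hJ hle
        refine ⟨hR.trans (le_max_left _ _), fun n hn h => ?_⟩
        obtain ⟨h1, h2⟩ := H n ((le_max_left _ _).trans hn) h
        refine ⟨h1, fun v hv => (h2 v hv).trans ?_⟩
        gcongr
        exact le_max_left _ _
      · obtain ⟨hR, H⟩ := H₂ θ hθ J hJ hle
        refine ⟨hR.trans (le_max_right _ _), fun n hn h => ?_⟩
        obtain ⟨h1, h2⟩ := H n ((le_max_right _ _).trans hn) h
        refine ⟨h1, fun v hv => (h2 v hv).trans ?_⟩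
        gcongr
        exact le_max_right _ _
    · intro θ hθ
      obtain ⟨C, N, H⟩ := ExpFamily.eventually_expansion hD hJbar hJbar_nonneg (hΓsub hθ)
      exact ⟨_, mem_nhdsWithin_of_mem_nhds H, C, N, fun θ' hθ' => hθ'⟩
  obtain ⟨C, N, H⟩ := key
  exact ⟨⟨C, N, fun n hn h θ hθ J hJ hle => (H θ hθ J hJ hle).2 n hn h⟩,
    ⟨C, fun θ hθ J hJ hle => (H θ hθ J hJ hle).1⟩⟩

end
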